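/- For an even lattice $L$ (a free abelian group of finite rank with a nondegenerate symmetric $\mathbb{Z}$-valued bilinear form such that $(x,x)$ is always even) of signature $(2,n)$, $n \geq 0$, put $\mathcal{D}_L = \{\sigma \in \mathbb{P}(L_{\mathbb{C}}) : (\sigma,\sigma)=0,\ (\sigma,\bar\sigma)>0\}$ and $A_L = L^\vee/L$, where $L^\vee$ is the dual lattice. Let $\mathrm{O}_L(\widehat{\mathbb{Z}})^*$ and $\mathrm{SO}_L(\widehat{\mathbb{Z}})^*$ be the subgroups of elements of $\mathrm{O}_L(\widehat{\mathbb{Z}})$ and $\mathrm{SO}_L(\widehat{\mathbb{Z}})$ that act trivially on $A_L$, and let $$M_L = \mathrm{O}_L(\mathbb{Q}) \backslash \mathcal{D}_L \times \mathrm{O}_L(\mathbb{A}_f) / \mathrm{O}_L(\widehat{\mathbb{Z}})^*, \qquad S_L = \mathrm{SO}_L(\mathbb{Q}) \backslash \mathcal{D}_L \times \mathrm{SO}_L(\mathbb{A}_f) / \mathrm{SO}_L(\widehat{\mathbb{Z}})^*,$$ where $q$ in the rational group and $k$ in the compact group act by $(\sigma, g) \mapsto (q\sigma, qgk)$. A primitive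 embedding $T \hookrightarrow S$ of such lattices (an isometric embedding with torsion-free cokernel) induces maps $M_T \to M_S$ and $S_T \to S_S$, $[\sigma, g] \mapsto [\sigma, g \oplus \mathrm{id}_{T^\perp}]$. The degree of such a map, restricted to a connected component, onto its image is the number of points of that component in the fibre through a general point of the component. There is a function $b \colon \mathbb{N} \to \mathbb{N}$ such that the following holds for every primitive embedding $T \hookrightarrow S$ of even lattices of signatures $(2,m)$ and $(2,n)$. 1. For every connected component $M_T^0$ of $M_T$, the induced map $M_T^0 \to M_S$ has a finite degree onto its image, which is at most $b(\mathrm{rank}(S) - \mathrm{rank}(T))$; if $\mathrm{rank}(S) - \mathrm{rank}(T) = 1$, this degree divides $4$. 2. For every connected component $S_T^0$ of $S_T$, the induced map $S_T^0 \to S_S$ has a finite degree onto its image, which is at most $b(\mathrm{rank}(S) - \mathrm{rank}(T))$; if $\mathrm{rank}(S) - \mathrm{rank}(T) = 1$, this degree divides $4$. -/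

import Mathlib

open scoped TensorProduct LinearAlgebra.Projectivization
open LinearMap (BilinForm)

universe u v

namespace OrthogonalModuli

noncomputable section

/-! ### Orthogonal groups of bilinear forms, and extension of isometries by the identity -/

section Isometries

variable {R : Type*} [CommRing R] {V W : Type*} [AddCommGroup V] [Module R V]
  [AddCommGroup W] [Module R W]

/-- The orthogonal group `O(V, B)`. -/
def orthogonalGroup (B : BilinForm R V) : Subgroup (V ≃ₗ[R] V) where
  carrier := {g | ∀ x y, B (g x) (g y) = B x y}
  one_mem' := fun _ _ => rfl
  mul_mem' := fun {a b} ha hb x y => (ha (b x) (b y)).trans (hb x y)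
  inv_mem' := fun {a} ha x y => by
    have h := ha (a⁻¹ x) (a⁻¹ y)
    have e : ∀ z, a (a⁻¹ z) = z := fun z => a.apply_symm_apply z
    rw [e, e] at h
    exact h.symm

/-- The special orthogonal group `SO(V, B)`, as a subgroup of `O(V, B)`. -/
def specialOrthogonalGroup (B : BilinForm R V) : Subgroup (orthogonalGroup B) :=
  (LinearEquiv.det.comp (orthogonalGroup B).subtype).ker

/-- Extension of scalars `O(V)(R) → O(V)(A)`. -/
def orthogonalGroup.baseChange (A : Type*) [CommRing A] [Algebra R A] (B : BilinForm R V) :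
    orthogonalGroup B →* orthogonalGroup (B.baseChange A) where
  toFun g := ⟨LinearEquiv.baseChange R A V V g.1, fun x y => by
    have h : ((B.baseChange A).compl₁₂ (LinearMap.baseChange A (g.1 : V →ₗ[R] V))
        (LinearMap.baseChange A (g.1 : V →ₗ[R] V))) = B.baseChange A := by
      ext x y
      simp [g.2 x y]
    exact LinearMap.congr_fun₂ h x y⟩
  map_one' := by
    apply Subtype.ext
    apply LinearEquiv.toLinearMap_injective
    ext x
    simp
  map_mul' g h := by
    apply Subtype.ext
    apply LinearEquiv.toLinearMap_injective
    ext x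
    simp

/-- `(i, p)` exhibits `V` as an orthogonal direct summand of `W`: the map `i` embeds `V`
isometrically in `W`, and `p` is the orthogonal projection of `W` to `V`. -/
structure IsOrthogonalSummand (B : BilinForm R V) (C : BilinForm R W)
    (i : V →ₗ[R] W) (p : W →ₗ[R] V) : Prop where
  proj_incl : ∀ v, p (i v) = v
  adjoint : ∀ w v, B (p w) v = C w (i v)
  adjoint' : ∀ w v, B v (p w) = C (i v) w

namespace IsOrthogonalSummand

variable {B : BilinForm R V} {C : BilinForm R W} {i : V →ₗ[R] W} {p : W →ₗ[R] V}

lemma baseChange (h : IsOrthogonalSummand B C i p) (A : Type*) [CommRing A] [Algebra R A] :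
    IsOrthogonalSummand (B.baseChange A) (C.baseChange A) (i.baseChange A) (p.baseChange A) where
  proj_incl v := by
    have e : (p.baseChange A) ∘ₗ (i.baseChange A) = LinearMap.id := by
      ext x
      simp [h.proj_incl]
    exact LinearMap.congr_fun e v
  adjoint w v := by
    have e : (B.baseChange A) ∘ₗ (p.baseChange A) =
        (C.baseChange A).compl₂ (i.baseChange A) := by
      ext x y
      simp [h.adjoint]
    exact LinearMap.congr_fun₂ e w v
  adjoint' w v := by
    have e : (B.baseChange A).compl₂ (p.baseChange A) =
        (C.baseChange A) ∘ₗ (i.baseChange A) := by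
      ext x y
      simp [h.adjoint']
    exact LinearMap.congr_fun₂ e v w

/-- The endomorphism `w ↦ i (g (p w)) + (w - i (p w))`, which is `g` on `V` and the identity on
the orthogonal complement of `V`. -/
def extendLin (i : V →ₗ[R] W) (p : W →ₗ[R] V) (g : V →ₗ[R] V) : W →ₗ[R] W :=
  i ∘ₗ g ∘ₗ p + (LinearMap.id - i ∘ₗ p)

lemma extendLin_apply (g : V →ₗ[R] V) (w : W) :
    extendLin i p g w = i (g (p w)) + (w - i (p w)) := rfl

lemma extendLin_comp (h : IsOrthogonalSummand B C i p) (g g' : V →ₗ[R] V) (w : W) :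
    extendLin i p g (extendLin i p g' w) = extendLin i p (g ∘ₗ g') w := by
  simp [extendLin_apply, h.proj_incl]

lemma extendLin_id (w : W) : extendLin i p LinearMap.id w = w := by
  simp [extendLin_apply]

/-- Extension of isometries by the identity on the orthogonal complement, `O(V) → O(W)`. -/
def extend (h : IsOrthogonalSummand B C i p) : orthogonalGroup B →* orthogonalGroup C where
  toFun g := ⟨LinearEquiv.ofLinearMap (extendLin i p (g.1 : V →ₗ[R] V))
      (extendLin i p (g.1.symm : V →ₗ[R] V))
      (by ext w; simp [h.extendLin_comp, extendLin_id])
      (by ext w; simp [h.extendLin_comp, extendLin_id]), fun x y => by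
    have hg := g.2 (p x) (p y)
    simp [extendLin_apply, ← h.adjoint, ← h.adjoint', h.proj_incl, hg]⟩
  map_one' := by
    apply Subtype.ext
    apply LinearEquiv.ext
    intro w
    exact extendLin_id w
  map_mul' g g' := by
    apply Subtype.ext
    apply LinearEquiv.ext
    intro w
    exact (h.extendLin_comp _ _ w).symm

lemma extend_apply (h : IsOrthogonalSummand B C i p) (g : orthogonalGroup B) (w : W) :
    (h.extend g).1 w = i (g.1 (p w)) + (w - i (p w)) := rfl

lemma extend_incl (h : IsOrthogonalSummand B C i p) (g : orthogonalGroup B) (v : V) :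
    (h.extend g).1 (i v) = i (g.1 v) := by
  simp [h.extend_apply, h.proj_incl]

lemma extend_of_orthogonal (h : IsOrthogonalSummand B C i p) (hB : B.Nondegenerate)
    (g : orthogonalGroup B) (w : W) (hw : ∀ v, C w (i v) = 0) : (h.extend g).1 w = w := by
  have : p w = 0 := hB.1 _ fun v => by rw [h.adjoint, hw]
  simp [h.extend_apply, this]

lemma extend_baseChange (h : IsOrthogonalSummand B C i p) (A : Type*) [CommRing A] [Algebra R A]
    (g : orthogonalGroup B) :
    orthogonalGroup.baseChange A C (h.extend g) =
      (h.baseChange A).extend (orthogonalGroup.baseChange A B g) := by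
  apply Subtype.ext
  apply LinearEquiv.toLinearMap_injective
  ext w
  change (1 : A) ⊗ₜ[R] ((h.extend g).1 w) = i.baseChange A (LinearMap.baseChange A
    (g.1 : V →ₗ[R] V) (p.baseChange A (1 ⊗ₜ w))) + (1 ⊗ₜ w - i.baseChange A (p.baseChange A (1 ⊗ₜ w)))
  simp [h.extend_apply, TensorProduct.tmul_add, TensorProduct.tmul_sub]

lemma extend_mem_special [Module.Free R V] [Module.Finite R V] [Module.Free R W]
    [Module.Finite R W] (h : IsOrthogonalSummand B C i p) {g : orthogonalGroup B}
    (hg : g ∈ specialOrthogonalGroup B) : h.extend g ∈ specialOrthogonalGroup C := by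
  classical
  have hdet : LinearMap.det (g.1 : V →ₗ[R] V) = 1 := by
    have : LinearEquiv.det g.1 = 1 := hg
    rw [← LinearEquiv.coe_det, this, Units.val_one]
  change LinearEquiv.det (h.extend g).1 = 1
  apply Units.ext
  rw [LinearEquiv.coe_det, Units.val_one, ← hdet]
  let b := Module.Free.chooseBasis R V
  let c := Module.Free.chooseBasis R W
  let f : V →ₗ[R] V := (g.1 : V →ₗ[R] V) - LinearMap.id
  have e1 : ((h.extend g).1 : W →ₗ[R] W) = LinearMap.id + i ∘ₗ (f ∘ₗ p) := by
    ext w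
    simp [h.extend_apply, f]
    abel
  have e2 : (g.1 : V →ₗ[R] V) = LinearMap.id + (f ∘ₗ p) ∘ₗ i := by
    ext v
    simp [h.proj_incl, f]
  rw [e1, ← LinearMap.det_toMatrix c, map_add, LinearMap.toMatrix_id,
    LinearMap.toMatrix_comp c b c, Matrix.det_one_add_mul_comm, ← LinearMap.toMatrix_comp b c b,
    ← LinearMap.toMatrix_id b, ← map_add, LinearMap.det_toMatrix, ← e2]

end IsOrthogonalSummand

end Isometries

/-! ### Period domains -/

section PeriodDomain

variable {V W X : Type*} [AddCommGroup V] [Module ℚ V] [AddCommGroup W] [Module ℚ W]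
  [AddCommGroup X] [Module ℚ X]

/-- Complex conjugation on `V_ℂ = ℂ ⊗ V`. -/
def conj (V : Type*) [AddCommGroup V] [Module ℚ V] : (ℂ ⊗[ℚ] V) →ₗ[ℚ] (ℂ ⊗[ℚ] V) :=
  LinearMap.rTensor V (Complex.conjAe.toLinearMap.restrictScalars ℚ)

@[simp] lemma conj_tmul (a : ℂ) (x : V) :
    conj V (a ⊗ₜ[ℚ] x) = (starRingEnd ℂ a) ⊗ₜ[ℚ] x := rfl

lemma conj_smul (a : ℂ) (z : ℂ ⊗[ℚ] V) : conj V (a • z) = starRingEnd ℂ a • conj V z := by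
  induction z with
  | zero => simp
  | tmul b x => simp [TensorProduct.smul_tmul']
  | add x y hx hy => rw [smul_add, map_add, hx, hy, map_add, smul_add]

lemma conj_baseChange (f : V →ₗ[ℚ] W) (z : ℂ ⊗[ℚ] V) :
    conj W (f.baseChange ℂ z) = f.baseChange ℂ (conj V z) := by
  induction z with
  | zero => simp
  | tmul b x => simp
  | add x y hx hy => simp only [map_add, hx, hy]

/-- The condition on a vector `z` of `V_ℂ` that `(z, z) = 0` and `(z, z̄) > 0`. For a symmetric
form defined over `ℚ` the number `(z, z̄)` is real. -/
def IsPeriodVector (B : BilinForm ℚ V) (z : ℂ ⊗[ℚ] V) : Prop :=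
  B.baseChange ℂ z z = 0 ∧ 0 < (B.baseChange ℂ z (conj V z)).re

lemma IsPeriodVector.smul {B : BilinForm ℚ V} {z : ℂ ⊗[ℚ] V} (h : IsPeriodVector B z) {a : ℂ}
    (ha : a ≠ 0) : IsPeriodVector B (a • z) := by
  refine ⟨by simp [h.1], ?_⟩
  have e : B.baseChange ℂ (a • z) (conj V (a • z)) =
      (Complex.normSq a : ℂ) * B.baseChange ℂ z (conj V z) := by
    rw [conj_smul, map_smul, map_smul, LinearMap.smul_apply, smul_eq_mul, smul_eq_mul,
      ← mul_assoc, Complex.normSq_eq_conj_mul_self]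
  rw [e, Complex.re_ofReal_mul]
  exact mul_pos (Complex.normSq_pos.2 ha) h.2

/-- The period domain `D = {σ ∈ ℙ(V_ℂ) : (σ, σ) = 0, (σ, σ̄) > 0}`. The defining condition does
not depend on the representative of `σ`. -/
def PeriodDomain (B : BilinForm ℚ V) : Type _ :=
  {σ : ℙ ℂ (ℂ ⊗[ℚ] V) // IsPeriodVector B σ.rep}

/-- The quotient topology on the projective space `ℙ(V_ℂ)`. For a finite dimensional complex vector
space the module topology is the usual topology. -/
abbrev projectiveTopology (V : Type*) [AddCommGroup V] [Module ℚ V] :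
    TopologicalSpace (ℙ ℂ (ℂ ⊗[ℚ] V)) :=
  letI : TopologicalSpace (ℂ ⊗[ℚ] V) := moduleTopology ℂ (ℂ ⊗[ℚ] V)
  TopologicalSpace.coinduced (Projectivization.mk' ℂ) inferInstance

/-- The period domain has the subspace topology. -/
instance (B : BilinForm ℚ V) : TopologicalSpace (PeriodDomain B) :=
  TopologicalSpace.induced Subtype.val (projectiveTopology V)

/-- An injective isometry `V → W` of rational quadratic spaces. -/
structure IsIsometricEmbedding (B : BilinForm ℚ V) (C : BilinForm ℚ W) (f : V →ₗ[ℚ] W) :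
    Prop where
  injective : Function.Injective f
  isometry : ∀ x y, C (f x) (f y) = B x y

lemma baseChange_injective {f : V →ₗ[ℚ] W} (hf : Function.Injective f) :
    Function.Injective (f.baseChange ℂ) :=
  Module.Flat.lTensor_preserves_injective_linearMap (M := ℂ) f hf

lemma IsIsometricEmbedding.isPeriodVector {B : BilinForm ℚ V} {C : BilinForm ℚ W}
    {f : V →ₗ[ℚ] W} (h : IsIsometricEmbedding B C f) {z : ℂ ⊗[ℚ] V} (hz : IsPeriodVector B z) :
    IsPeriodVector C (f.baseChange ℂ z) := by
  have e : (C.baseChange ℂ).compl₁₂ (f.baseChange ℂ) (f.baseChange ℂ) = B.baseChange ℂ := by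
    ext x y
    simp [h.isometry]
  have e' : ∀ x y, C.baseChange ℂ (f.baseChange ℂ x) (f.baseChange ℂ y) = B.baseChange ℂ x y :=
    fun x y => LinearMap.congr_fun₂ e x y
  refine ⟨by rw [e', hz.1], ?_⟩
  rw [conj_baseChange, e']
  exact hz.2

/-- The map `σ ↦ f(σ)` on period domains induced by an isometric embedding. -/
def PeriodDomain.map {B : BilinForm ℚ V} {C : BilinForm ℚ W} (f : V →ₗ[ℚ] W)
    (h : IsIsometricEmbedding B C f) (σ : PeriodDomain B) : PeriodDomain C :=
  ⟨Projectivization.map (f.baseChange ℂ) (baseChange_injective h.injective) σ.1, by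
    obtain ⟨σ, hσ⟩ := σ
    have e : Projectivization.map (f.baseChange ℂ) (baseChange_injective h.injective) σ =
        Projectivization.mk ℂ (f.baseChange ℂ σ.rep)
          (fun h0 => σ.rep_nonzero (baseChange_injective h.injective (by rw [h0, map_zero]))) := by
      conv_lhs => rw [← σ.mk_rep]
      rfl
    change IsPeriodVector C (Projectivization.map (f.baseChange ℂ) _ σ).rep
    rw [e]
    obtain ⟨a, ha⟩ := Projectivization.exists_smul_eq_mk_rep ℂ (f.baseChange ℂ σ.rep)
      (fun h0 => σ.rep_nonzero (baseChange_injective h.injective (by rw [h0, map_zero])))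
    rw [← ha]
    exact (h.isPeriodVector hσ).smul a.ne_zero⟩

lemma PeriodDomain.map_id {B : BilinForm ℚ V} {f : V →ₗ[ℚ] V} (h : IsIsometricEmbedding B B f)
    (hf : f = LinearMap.id) (σ : PeriodDomain B) : PeriodDomain.map f h σ = σ := by
  subst hf
  obtain ⟨σ, hσ⟩ := σ
  apply Subtype.ext
  change Projectivization.map (LinearMap.baseChange ℂ LinearMap.id)
    (baseChange_injective h.injective) σ = σ
  induction σ using Projectivization.ind with
  | h v hv => simp [Projectivization.map_mk]

lemma PeriodDomain.map_map {B : BilinForm ℚ V} {C : BilinForm ℚ W} {D : BilinForm ℚ X}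
    {f : V →ₗ[ℚ] W} {g : W →ₗ[ℚ] X} {k : V →ₗ[ℚ] X} (hf : IsIsometricEmbedding B C f)
    (hg : IsIsometricEmbedding C D g) (hk : IsIsometricEmbedding B D k) (e : g ∘ₗ f = k)
    (σ : PeriodDomain B) :
    PeriodDomain.map g hg (PeriodDomain.map f hf σ) = PeriodDomain.map k hk σ := by
  subst e
  obtain ⟨σ, hσ⟩ := σ
  apply Subtype.ext
  change Projectivization.map (g.baseChange ℂ) (baseChange_injective hg.injective)
    (Projectivization.map (f.baseChange ℂ) (baseChange_injective hf.injective) σ) =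
    Projectivization.map ((g ∘ₗ f).baseChange ℂ) (baseChange_injective hk.injective) σ
  induction σ using Projectivization.ind with
  | h v hv => simp [Projectivization.map_mk, LinearMap.baseChange_comp]

lemma isIsometricEmbedding_coe {B : BilinForm ℚ V} (q : orthogonalGroup B) :
    IsIsometricEmbedding B B (q.1 : V →ₗ[ℚ] V) :=
  ⟨q.1.injective, q.2⟩

/-- The action of `O(V)(ℚ)` on the period domain. -/
instance (B : BilinForm ℚ V) : MulAction (orthogonalGroup B) (PeriodDomain B) where
  smul q σ := PeriodDomain.map (q.1 : V →ₗ[ℚ] V) (isIsometricEmbedding_coe q) σ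
  one_smul σ := PeriodDomain.map_id _ rfl σ
  mul_smul q r σ := (PeriodDomain.map_map (isIsometricEmbedding_coe r) (isIsometricEmbedding_coe q)
    (isIsometricEmbedding_coe (q * r)) rfl σ).symm

lemma PeriodDomain.smul_def {B : BilinForm ℚ V} (q : orthogonalGroup B) (σ : PeriodDomain B) :
    q • σ = PeriodDomain.map (q.1 : V →ₗ[ℚ] V) (isIsometricEmbedding_coe q) σ := rfl

end PeriodDomain

/-! ### Finite adeles -/

/-- The ring `𝔸_f` of finite adeles of `ℚ`. -/
abbrev FinAdele : Type := IsDedekindDomain.FiniteAdeleRing ℤ ℚ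

/-- The subring `ℤ̂ ⊆ 𝔸_f` of integral finite adeles. -/
def ZHat : Subring FinAdele where
  carrier := {a | ∀ v : IsDedekindDomain.HeightOneSpectrum ℤ, a v ∈ v.adicCompletionIntegers ℚ}
  zero_mem' := fun v => zero_mem (v.adicCompletionIntegers ℚ)
  one_mem' := fun v => one_mem (v.adicCompletionIntegers ℚ)
  add_mem' := fun ha hb v => add_mem (ha v) (hb v)
  mul_mem' := fun ha hb v => mul_mem (ha v) (hb v)
  neg_mem' := fun ha v => neg_mem (ha v)

/-! ### Even lattices -/

/-- An even lattice: a free abelian group of finite rank with a nondegenerate symmetric bilinear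
form with values in `ℤ` such that `(x, x)` is even for all `x`. -/
structure EvenLattice : Type (u + 1) where
  carrier : Type u
  [addCommGroup : AddCommGroup carrier]
  [free : Module.Free ℤ carrier]
  [finite : Module.Finite ℤ carrier]
  form : BilinForm ℤ carrier
  symm : ∀ x y, form x y = form y x
  nondegenerate : form.Nondegenerate
  even : ∀ x, Even (form x x)

namespace EvenLattice

attribute [instance] addCommGroup free finite

instance : CoeSort EvenLattice.{u} (Type u) := ⟨carrier⟩

variable (L : EvenLattice.{u})

/-- The rank of a lattice. -/
def rank : ℕ := Module.finrank ℤ L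

/-- The real quadratic space `L_ℝ` has signature `(r, s)`. -/
def HasSignature (r s : ℕ) : Prop :=
  sigPos (L.form.baseChange ℝ).toQuadraticMap = r ∧
    sigNeg (L.form.baseChange ℝ).toQuadraticMap = s

/-- The rational vector space `L_ℚ`. -/
abbrev RatSpace : Type u := ℚ ⊗[ℤ] L

/-- The rational extension of the form. -/
abbrev ratForm : BilinForm ℚ L.RatSpace := L.form.baseChange ℚ

lemma ratForm_symm (x y : L.RatSpace) : L.ratForm x y = L.ratForm y x := by
  have e : L.ratForm = L.ratForm.flip := by
    ext x y
    simp [L.symm x y]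
  exact LinearMap.congr_fun₂ e x y

lemma ratForm_nondegenerate : L.ratForm.Nondegenerate := by
  classical
  let b := Module.Free.chooseBasis ℤ L
  have h := (LinearMap.BilinForm.nondegenerate_iff_det_ne_zero b).1 L.nondegenerate
  rw [LinearMap.BilinForm.nondegenerate_iff_det_ne_zero (b.baseChange ℚ)]
  have e : LinearMap.BilinForm.toMatrix (b.baseChange ℚ) L.ratForm =
      (Int.castRingHom ℚ).mapMatrix (LinearMap.BilinForm.toMatrix b L.form) := by
    ext i j
    simp [LinearMap.BilinForm.toMatrix_apply]
  rw [e, ← RingHom.map_det]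
  simpa using h

/-- `L_{𝔸_f} = L ⊗ 𝔸_f`. -/
abbrev AdeleSpace : Type u := FinAdele ⊗[ℚ] L.RatSpace

/-- The form on `L ⊗ 𝔸_f`. -/
abbrev adeleForm : BilinForm FinAdele L.AdeleSpace := L.ratForm.baseChange FinAdele

/-- The group `O_L(ℚ)`. -/
abbrev ORat : Type u := orthogonalGroup L.ratForm

/-- The group `O_L(𝔸_f)`. -/
abbrev OAdele : Type u := orthogonalGroup L.adeleForm

/-- The diagonal map `O_L(ℚ) → O_L(𝔸_f)`. -/
abbrev diag : L.ORat →* L.OAdele := orthogonalGroup.baseChange FinAdele L.ratForm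

/-- The dual lattice `L^∨ ⊆ L_ℚ`, of all `x` with `(x, L) ⊆ ℤ`. -/
def dual : Set L.RatSpace := {x | ∀ t : L, ∃ n : ℤ, L.ratForm x (1 ⊗ₜ t) = n}

/-- `L ⊗ ℤ̂`, as the `ℤ̂`-submodule of `L ⊗ 𝔸_f` spanned by `L`. -/
def hat : Submodule ZHat L.AdeleSpace :=
  Submodule.span ZHat (Set.range fun t : L => (1 : FinAdele) ⊗ₜ[ℚ] ((1 : ℚ) ⊗ₜ[ℤ] t))

/-- `L^∨ ⊗ ℤ̂`, as the `ℤ̂`-submodule of `L ⊗ 𝔸_f` spanned by `L^∨`. The discriminant group is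
`A_L = L^∨ / L = (L^∨ ⊗ ℤ̂) / (L ⊗ ℤ̂)`. -/
def dualHat : Submodule ZHat L.AdeleSpace :=
  Submodule.span ZHat ((fun x : L.RatSpace => (1 : FinAdele) ⊗ₜ[ℚ] x) '' L.dual)

/-- `O_L(ℤ̂)`, the group of isometries `g` of `L ⊗ 𝔸_f` with `g(L ⊗ ℤ̂) = L ⊗ ℤ̂`. -/
def OZHat : Subgroup L.OAdele where
  carrier := {g | ∀ x, g.1 x ∈ L.hat ↔ x ∈ L.hat}
  one_mem' := fun _ => Iff.rfl
  mul_mem' := fun {a b} ha hb x => (ha (b.1 x)).trans (hb x)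
  inv_mem' := fun {a} ha x => by
    have h := ha ((a⁻¹).1 x)
    have e : a.1 ((a⁻¹).1 x) = x := a.1.apply_symm_apply x
    rw [e] at h
    exact h.symm

/-- `O_L(ℤ̂)^*`, the kernel of `O_L(ℤ̂) → O(A_L)`: the elements of `O_L(ℤ̂)` which
induce the identity on `A_L = (L^∨ ⊗ ℤ̂) / (L ⊗ ℤ̂)`. -/
def OZHatStar : Subgroup L.OAdele where
  carrier := {g | g ∈ L.OZHat ∧ ∀ y ∈ L.dualHat, g.1 y - y ∈ L.hat}
  one_mem' := ⟨one_mem _, fun y _ => by simp⟩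
  mul_mem' := fun {a b} ha hb => ⟨mul_mem ha.1 hb.1, fun y hy => by
    have h1 : a.1 (b.1 y - y) ∈ L.hat := (ha.1 _).2 (hb.2 y hy)
    have h2 := ha.2 y hy
    have e : (a * b).1 y - y = a.1 (b.1 y - y) + (a.1 y - y) := by
      change a.1 (b.1 y) - y = _
      rw [map_sub]
      abel
    rw [e]
    exact add_mem h1 h2⟩
  inv_mem' := fun {a} ha => ⟨inv_mem ha.1, fun y hy => by
    rw [← ha.1]
    have e : a.1 ((a⁻¹).1 y) = y := a.1.apply_symm_apply y
    rw [map_sub, e, ← neg_sub]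
    exact neg_mem (ha.2 y hy)⟩

/-- `SO_L(ℚ)`. -/
abbrev SORat : Subgroup L.ORat := specialOrthogonalGroup L.ratForm

/-- `SO_L(𝔸_f)`. -/
abbrev SOAdele : Subgroup L.OAdele := specialOrthogonalGroup L.adeleForm

/-- `SO_L(ℤ̂)^*`, the kernel of `SO_L(ℤ̂) → O(A_L)`. -/
def SOZHatStar : Subgroup L.OAdele := L.SOAdele ⊓ L.OZHatStar

/-! ### The double coset spaces -/

/-- The equivalence relation on `D × G(𝔸_f)` with quotient `G(ℚ) \ D × G(𝔸_f) / K`: here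
`(σ, g)` is equivalent to `(q σ, q g k)` for all `q` in `G(ℚ)` and `k` in `K`. -/
def cosetSetoid (GQ : Subgroup L.ORat) (GA K : Subgroup L.OAdele) :
    Setoid (PeriodDomain L.ratForm × GA) where
  r a b := ∃ q ∈ GQ, ∃ k ∈ K, b.1 = q • a.1 ∧ (b.2 : L.OAdele) = L.diag q * a.2 * k
  iseqv :=
    { refl := fun a => ⟨1, one_mem _, 1, one_mem _, by simp, by simp⟩
      symm := by
        rintro a b ⟨q, hq, k, hk, h1, h2⟩
        exact ⟨q⁻¹, inv_mem hq, k⁻¹, inv_mem hk, by simp [h1], by simp [h2, mul_assoc]⟩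
      trans := by
        rintro a b c ⟨q, hq, k, hk, h1, h2⟩ ⟨q', hq', k', hk', h1', h2'⟩
        exact ⟨q' * q, mul_mem hq' hq, k * k', mul_mem hk hk', by simp [h1, h1', mul_smul],
          by simp [h2, h2', mul_assoc]⟩ }

/-- `G(ℚ) \ D × G(𝔸_f) / K`. -/
def CosetSpace (GQ : Subgroup L.ORat) (GA K : Subgroup L.OAdele) : Type u :=
  Quotient (L.cosetSetoid GQ GA K)

/-- The quotient topology, where `G(𝔸_f)` is discrete. For an open subgroup `K` of `G(𝔸_f)`, the
adelic topology of `G(𝔸_f)` gives the same quotient topology, as `G(𝔸_f) / K` is discrete. -/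
instance (GQ : Subgroup L.ORat) (GA K : Subgroup L.OAdele) :
    TopologicalSpace (L.CosetSpace GQ GA K) :=
  letI : TopologicalSpace GA := ⊥
  TopologicalSpace.coinduced (Quotient.mk (L.cosetSetoid GQ GA K)) inferInstance

/-- `M_L = O_L(ℚ) \ D_L × O_L(𝔸_f) / O_L(ℤ̂)^*`. -/
abbrev M : Type u := L.CosetSpace ⊤ ⊤ L.OZHatStar

/-- `S_L = SO_L(ℚ) \ D_L × SO_L(𝔸_f) / SO_L(ℤ̂)^*`. -/
abbrev Sh : Type u := L.CosetSpace L.SORat L.SOAdele L.SOZHatStar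

end EvenLattice

/-! ### Primitive embeddings and the induced maps -/

/-- A primitive embedding `T ↪ S` of lattices: an injective isometry with torsion-free cokernel. -/
structure PrimitiveEmbedding (T : EvenLattice.{u}) (S : EvenLattice.{v}) where
  toLin : T →ₗ[ℤ] S
  injective : Function.Injective toLin
  isometry : ∀ x y, S.form (toLin x) (toLin y) = T.form x y
  primitive : ∀ (m : ℤ) (s : S), m ≠ 0 → m • s ∈ LinearMap.range toLin →
    s ∈ LinearMap.range toLin

namespace PrimitiveEmbedding

variable {T : EvenLattice.{u}} {S : EvenLattice.{v}} (ι : PrimitiveEmbedding T S)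

/-- The map `T_ℚ → S_ℚ`. -/
abbrev rat : T.RatSpace →ₗ[ℚ] S.RatSpace := ι.toLin.baseChange ℚ

lemma rat_isometry (x y : T.RatSpace) : S.ratForm (ι.rat x) (ι.rat y) = T.ratForm x y := by
  have e : S.ratForm.compl₁₂ ι.rat ι.rat = T.ratForm := by
    ext x y
    simp [ι.isometry]
  exact LinearMap.congr_fun₂ e x y

lemma rat_isIsometricEmbedding : IsIsometricEmbedding T.ratForm S.ratForm ι.rat where
  injective := Module.Flat.lTensor_preserves_injective_linearMap (M := ℚ) ι.toLin ι.injective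
  isometry := ι.rat_isometry

/-- The orthogonal projection `S_ℚ → T_ℚ`. -/
def proj : S.RatSpace →ₗ[ℚ] T.RatSpace :=
  (T.ratForm.toDual T.ratForm_nondegenerate).symm.toLinearMap ∘ₗ S.ratForm.compl₂ ι.rat

lemma proj_adjoint (w : S.RatSpace) (x : T.RatSpace) :
    T.ratForm (ι.proj w) x = S.ratForm w (ι.rat x) := by
  simp [proj, LinearMap.BilinForm.apply_toDual_symm_apply]

lemma isOrthogonalSummand : IsOrthogonalSummand T.ratForm S.ratForm ι.rat ι.proj where
  proj_incl x := by
    have h : ∀ y, T.ratForm (ι.proj (ι.rat x) - x) y = 0 := fun y => by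
      rw [map_sub, LinearMap.sub_apply, ι.proj_adjoint, ι.rat_isometry, sub_self]
    exact sub_eq_zero.1 (T.ratForm_nondegenerate.1 _ h)
  adjoint := ι.proj_adjoint
  adjoint' w x := by
    rw [T.ratForm_symm, S.ratForm_symm]
    exact ι.proj_adjoint w x

/-- Extension of isometries by the identity on `T^⊥`, over `ℚ`. -/
abbrev extendRat : T.ORat →* S.ORat := ι.isOrthogonalSummand.extend

/-- Extension of isometries by the identity on `T^⊥`, over `𝔸_f`. -/
abbrev extendAdele : T.OAdele →* S.OAdele := (ι.isOrthogonalSummand.baseChange FinAdele).extend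

/-- The map `D_T → D_S`. -/
abbrev period : PeriodDomain T.ratForm → PeriodDomain S.ratForm :=
  PeriodDomain.map ι.rat ι.rat_isIsometricEmbedding

lemma period_smul (q : T.ORat) (σ : PeriodDomain T.ratForm) :
    ι.period (q • σ) = ι.extendRat q • ι.period σ := by
  have hk : IsIsometricEmbedding T.ratForm S.ratForm (ι.rat ∘ₗ (q.1 : T.RatSpace →ₗ[ℚ] T.RatSpace)) :=
    ⟨ι.rat_isIsometricEmbedding.injective.comp q.1.injective, fun x y => by
      simp only [LinearMap.comp_apply, ι.rat_isometry]
      exact q.2 x y⟩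
  rw [PeriodDomain.smul_def, PeriodDomain.smul_def, period,
    PeriodDomain.map_map (isIsometricEmbedding_coe q) ι.rat_isIsometricEmbedding hk rfl,
    PeriodDomain.map_map ι.rat_isIsometricEmbedding (isIsometricEmbedding_coe (ι.extendRat q)) hk]
  ext x
  exact ι.isOrthogonalSummand.extend_incl q _

lemma incl_mem_hat {x : T.AdeleSpace} (hx : x ∈ T.hat) : ι.rat.baseChange FinAdele x ∈ S.hat := by
  have : T.hat ≤ S.hat.comap ((ι.rat.baseChange FinAdele).restrictScalars ZHat) := by
    rw [EvenLattice.hat, Submodule.span_le]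
    rintro _ ⟨t, rfl⟩
    exact Submodule.subset_span ⟨ι.toLin t, rfl⟩
  exact this hx

lemma proj_mem_dualHat {y : S.AdeleSpace} (hy : y ∈ S.dualHat) :
    ι.proj.baseChange FinAdele y ∈ T.dualHat := by
  have : S.dualHat ≤ T.dualHat.comap ((ι.proj.baseChange FinAdele).restrictScalars ZHat) := by
    rw [EvenLattice.dualHat, Submodule.span_le]
    rintro _ ⟨x, hx, rfl⟩
    refine Submodule.subset_span ⟨ι.proj x, fun t => ?_, rfl⟩
    obtain ⟨n, hn⟩ := hx (ι.toLin t)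
    exact ⟨n, by rw [ι.proj_adjoint, ← hn]; rfl⟩
  exact this hy

lemma _root_.OrthogonalModuli.EvenLattice.hat_le_dualHat (L : EvenLattice.{u}) :
    L.hat ≤ L.dualHat := by
  rw [EvenLattice.hat, Submodule.span_le]
  rintro _ ⟨t, rfl⟩
  exact Submodule.subset_span ⟨1 ⊗ₜ t, fun s => ⟨L.form t s, by simp⟩, rfl⟩

lemma extendAdele_sub_mem {g : T.OAdele} (hg : g ∈ T.OZHatStar) {y : S.AdeleSpace}
    (hy : y ∈ S.dualHat) : (ι.extendAdele g).1 y - y ∈ S.hat := by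
  have e : (ι.extendAdele g).1 y - y = ι.rat.baseChange FinAdele
      (g.1 (ι.proj.baseChange FinAdele y) - ι.proj.baseChange FinAdele y) := by
    rw [IsOrthogonalSummand.extend_apply, map_sub]
    abel
  rw [e]
  exact ι.incl_mem_hat (hg.2 _ (ι.proj_mem_dualHat hy))

lemma extendAdele_mem_OZHatStar {g : T.OAdele} (hg : g ∈ T.OZHatStar) :
    ι.extendAdele g ∈ S.OZHatStar := by
  have key : ∀ {g : T.OAdele}, g ∈ T.OZHatStar → ∀ {x}, x ∈ S.hat →
      (ι.extendAdele g).1 x ∈ S.hat := fun hg x hx => by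
    have h := add_mem (ι.extendAdele_sub_mem hg (S.hat_le_dualHat hx)) hx
    rwa [sub_add_cancel] at h
  refine ⟨fun x => ⟨fun hx => ?_, key hg⟩, fun y hy => ι.extendAdele_sub_mem hg hy⟩
  have h := key (inv_mem hg) hx
  rw [map_inv] at h
  have e : ((ι.extendAdele g)⁻¹).1 ((ι.extendAdele g).1 x) = x :=
    (ι.extendAdele g).1.symm_apply_apply x
  rwa [e] at h

lemma extendAdele_mem_SOAdele {g : T.OAdele} (hg : g ∈ T.SOAdele) :
    ι.extendAdele g ∈ S.SOAdele :=
  IsOrthogonalSummand.extend_mem_special _ hg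

lemma extendRat_mem_SORat {g : T.ORat} (hg : g ∈ T.SORat) : ι.extendRat g ∈ S.SORat :=
  IsOrthogonalSummand.extend_mem_special _ hg

/-- The map of double coset spaces `[σ, g] ↦ [σ, g ⊕ id]`, where `g ⊕ id` is the extension of `g`
by the identity on `T^⊥`. -/
def cosetMap {GQ : Subgroup T.ORat} {GA K : Subgroup T.OAdele} {GQ' : Subgroup S.ORat}
    {GA' K' : Subgroup S.OAdele} (hQ : ∀ q ∈ GQ, ι.extendRat q ∈ GQ')
    (hA : ∀ g ∈ GA, ι.extendAdele g ∈ GA') (hK : ∀ k ∈ K, ι.extendAdele k ∈ K') :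
    T.CosetSpace GQ GA K → S.CosetSpace GQ' GA' K' :=
  Quotient.map (fun a => (ι.period a.1, ⟨ι.extendAdele a.2, hA _ a.2.2⟩)) (by
    rintro a b ⟨q, hq, k, hk, h1, h2⟩
    refine ⟨ι.extendRat q, hQ q hq, ι.extendAdele k, hK k hk, ?_, ?_⟩
    · change ι.period b.1 = _
      rw [h1, ι.period_smul]
    · change ι.extendAdele b.2 = S.diag (ι.extendRat q) * ι.extendAdele a.2 * ι.extendAdele k
      rw [h2, map_mul, map_mul, EvenLattice.diag, EvenLattice.diag,
        IsOrthogonalSummand.extend_baseChange])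

/-- The induced map `M_T → M_S`. -/
def mapM : T.M → S.M :=
  ι.cosetMap (fun _ _ => Subgroup.mem_top _) (fun _ _ => Subgroup.mem_top _)
    (fun _ hk => ι.extendAdele_mem_OZHatStar hk)

/-- The induced map `S_T → S_S`. -/
def mapSh : T.Sh → S.Sh :=
  ι.cosetMap (fun _ hq => ι.extendRat_mem_SORat hq) (fun _ hg => ι.extendAdele_mem_SOAdele hg)
    (fun _ hk => ⟨ι.extendAdele_mem_SOAdele hk.1, ι.extendAdele_mem_OZHatStar hk.2⟩)

end PrimitiveEmbedding

/-- The map `f` has degree `d` onto its image: the fibre of `f` through a general point of `X` has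
exactly `d` points, where general means in a dense open subset. At most one `d` has this property
if `X` is nonempty. For a morphism of irreducible complex varieties which is finite onto its image,
it is the degree of the extension of function fields: the fibres with a different number of points
lie in a proper Zariski closed subset, whose complement is open and dense in the usual topology. -/
def HasDegreeOntoImage {X Y : Type*} [TopologicalSpace X] (f : X → Y) (d : ℕ) : Prop :=
  ∃ U : Set X, IsOpen U ∧ Dense U ∧ ∀ x ∈ U, (f ⁻¹' {f x}).encard = d

lemma HasDegreeOntoImage.unique {X Y : Type*} [TopologicalSpace X] [Nonempty X] {f : X → Y}
    {d e : ℕ} (hd : HasDegreeOntoImage f d) (he : HasDegreeOntoImage f e) : d = e := by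
  obtain ⟨U, hU, hU', h⟩ := hd
  obtain ⟨V, hV, hV', h'⟩ := he
  obtain ⟨x, hx⟩ := (hU'.inter_of_isOpen_left hV' hU).nonempty
  exact_mod_cast (h x hx.1).symm.trans (h' x hx.2)

end

end OrthogonalModuli

namespace OrthogonalModuli

open Topology

/-! ### Denominators of finite adeles -/

section Adeles

open IsDedekindDomain

/-! Take the component of `[σ₀, g]`. The points `[σ, g]` form an open and closed subset `Γ_T \ D_T`,
where `Γ_T = G(ℚ) ∩ g K g⁻¹`, and this subset maps to `Γ \ D_S` for the corresponding arithmetic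
group `Γ` of `S`. Two points of `D_T` have the same image exactly when some `q ∈ Γ` carries one to
the other inside `D_S`.

For general `σ` such a `q` preserves `T_ℚ`: otherwise it produces a lattice vector of bounded norm
which is orthogonal to `σ` and has nonzero projection to `T_ℚ` (`exists_compatiblePair_of_notMem`).
So the fibre through `σ` is an orbit, modulo `Γ_T`, of the group of pairs `(h, q)` with `q ∈ Γ`
extending `h ∈ O(T_ℚ)`, restricted to the pairs which preserve the component. Its cardinality is the
index of the subgroup of pairs which act on `D_T` through `Γ_T`.

To bound this index, let `q` act on a lattice in the orthogonal complement of `T_ℚ`. The complement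
is orthogonal to a period vector, hence negative definite, and an isometry of a definite integral
lattice which is trivial modulo `3` is trivial (`eq_self_of_congr_mod_three`). Hence pairs in the
kernel of the reduction to `GL_r(𝔽_3)` (`exists_hom_GL`) have `q = h ⊕ id`, and primitivity of `T`
gives `h ∈ Γ_T` (`extendRat_mem_arithmeticGroup_iff`). The degree therefore divides the order of
`GL_r(𝔽_3)`, which is `2` for `r = 1`.

The exceptional points lie on hyperplane sections and on proper eigenspaces of isometries. Both
families are locally finite on `D_T`, because the majorant at a period point is positive definite
and varies continuously, so that locally only finitely many lattice vectors have bounded majorant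
(`exists_nhds_finite_majorant_le`). The complement of the family is thus open, and it is reached
from any point along short paths of isotropic vectors
(`PeriodDomain.exists_preconnected_of_finite`), so it is dense in each component. In rank two `D_T`
has at most two points and all are general.

The groups enter only through their compatibility with extension by the identity and through `K' ≤
O_S(ℤ̂)`, so one theorem, `exists_hasDegreeOntoImage_cosetMap`, serves both `O` and `SO`. -/

lemma finAdele_mul_apply (a b : FinAdele) (v : HeightOneSpectrum ℤ) : (a * b) v = a v * b v := rfl

lemma finAdele_intCast_apply (n : ℤ) (v : HeightOneSpectrum ℤ) :
    (n : FinAdele) v = (n : v.adicCompletion ℚ) := rfl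

/-- Every finite adele has a nonzero integral multiple in `ℤ̂`. -/
lemma exists_intCast_mul_mem_ZHat (a : FinAdele) : ∃ M : ℤ, M ≠ 0 ∧ (M : FinAdele) * a ∈ ZHat := by
  classical
  have hfin : {v : HeightOneSpectrum ℤ | a v ∉ v.adicCompletionIntegers ℚ}.Finite := a.2
  have h1 : ∀ v : HeightOneSpectrum ℤ, ∃ M : ℤ, M ≠ 0 ∧
      (M : v.adicCompletion ℚ) * a v ∈ v.adicCompletionIntegers ℚ := fun v => by
    obtain ⟨M, hM, h⟩ :=
      HeightOneSpectrum.adicCompletion.mul_nonZeroDivisor_mem_adicCompletionIntegers v (a v)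
    refine ⟨M, nonZeroDivisors.ne_zero hM, ?_⟩
    rw [mul_comm]
    simpa using h
  choose M hM h using h1
  refine ⟨∏ v ∈ hfin.toFinset, M v, Finset.prod_ne_zero_iff.2 fun v _ => hM v, fun v => ?_⟩
  rw [finAdele_mul_apply, finAdele_intCast_apply]
  by_cases hv : a v ∈ v.adicCompletionIntegers ℚ
  · exact mul_mem (intCast_mem _ _) hv
  · rw [← Finset.mul_prod_erase _ M (hfin.mem_toFinset.2 hv), Int.cast_mul, mul_right_comm]
    exact mul_mem (h v) (intCast_mem _ _)

lemma exists_common_intCast_mul_mem_ZHat {ι : Type*} [Finite ι] (a : ι → FinAdele) :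
    ∃ M : ℤ, M ≠ 0 ∧ ∀ i, (M : FinAdele) * a i ∈ ZHat := by
  classical
  cases nonempty_fintype ι
  choose M hM h using fun i => exists_intCast_mul_mem_ZHat (a i)
  refine ⟨∏ i, M i, Finset.prod_ne_zero_iff.2 fun i _ => hM i, fun i => ?_⟩
  rw [← Finset.mul_prod_erase _ M (Finset.mem_univ i), Int.cast_mul, mul_right_comm]
  exact mul_mem (h i) (intCast_mem _ _)

/-- A rational number which lies in `ℤ̂` is an integer. -/
lemma exists_int_of_algebraMap_mem_ZHat {q : ℚ} (h : algebraMap ℚ FinAdele q ∈ ZHat) :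
    ∃ n : ℤ, q = n := by
  obtain ⟨n, hn⟩ := HeightOneSpectrum.mem_integers_of_valuation_le_one ℚ q fun v => by
    have := h v
    rwa [FiniteAdeleRing.algebraMap_apply, HeightOneSpectrum.mem_adicCompletionIntegers,
      HeightOneSpectrum.valuedAdicCompletion_eq_valuation'] at this
  exact ⟨n, by simpa using hn.symm⟩

lemma algebraMap_intCast_mem_ZHat (n : ℤ) : algebraMap ℚ FinAdele n ∈ ZHat := by
  rw [map_intCast]
  exact intCast_mem _ n

end Adeles

/-! ### Integral adelic points and the rational lattices they cut out -/

namespace EvenLattice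

variable (L : EvenLattice.{u})

/-- A basis of the free abelian group `L`. -/
noncomputable abbrev basis := Module.Free.chooseBasis ℤ L

/-- The basis of `L_ℚ` given by a basis of `L`. -/
noncomputable abbrev ratBasis := L.basis.baseChange ℚ

/-- The basis of `L ⊗ 𝔸_f` given by a basis of `L`. -/
noncomputable abbrev adeleBasis := L.ratBasis.baseChange FinAdele

lemma mem_hat_iff {x : L.AdeleSpace} : x ∈ L.hat ↔ ∀ i, L.adeleBasis.repr x i ∈ ZHat := by
  constructor
  · intro hx i
    induction hx using Submodule.span_induction with
    | mem x h =>
      obtain ⟨t, rfl⟩ := h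
      have : L.adeleBasis.repr ((1 : FinAdele) ⊗ₜ[ℚ] ((1 : ℚ) ⊗ₜ[ℤ] t)) i =
          ((L.basis.repr t i : ℤ) : FinAdele) := by
        simp [Module.Basis.baseChange_repr_tmul, Algebra.smul_def]
      rw [this]
      exact intCast_mem _ _
    | zero => simp
    | add x y _ _ hx hy => simpa using add_mem hx hy
    | smul a x _ hx =>
      have : L.adeleBasis.repr (a • x) i = (a : FinAdele) * L.adeleBasis.repr x i := by
        change L.adeleBasis.repr ((a : FinAdele) • x) i = _
        simp
      rw [this]
      exact mul_mem a.2 hx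
  · intro h
    rw [← L.adeleBasis.sum_repr x]
    refine sum_mem fun i _ => ?_
    have e : L.adeleBasis.repr x i • L.adeleBasis i =
        (⟨_, h i⟩ : ZHat) • ((1 : FinAdele) ⊗ₜ[ℚ] ((1 : ℚ) ⊗ₜ[ℤ] L.basis i)) := by
      change _ = L.adeleBasis.repr x i • ((1 : FinAdele) ⊗ₜ[ℚ] ((1 : ℚ) ⊗ₜ[ℤ] L.basis i))
      simp
    rw [e]
    exact Submodule.smul_mem _ _ (Submodule.subset_span ⟨_, rfl⟩)

lemma intCast_smul_mem_hat {x : L.AdeleSpace} (n : ℤ) (hx : x ∈ L.hat) :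
    (n : FinAdele) • x ∈ L.hat := by
  have : (n : FinAdele) • x = ((n : ZHat)) • x := by
    change _ = ((n : ZHat) : FinAdele) • x
    simp
  rw [this]
  exact Submodule.smul_mem _ _ hx

lemma exists_intCast_smul_mem_hat (x : L.AdeleSpace) :
    ∃ M : ℤ, M ≠ 0 ∧ (M : FinAdele) • x ∈ L.hat := by
  obtain ⟨M, hM, h⟩ := exists_common_intCast_mul_mem_ZHat fun i => L.adeleBasis.repr x i
  refine ⟨M, hM, L.mem_hat_iff.2 fun i => ?_⟩
  rw [map_smul]
  exact h i

lemma tmul_mem_hat_iff {w : L.RatSpace} :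
    (1 : FinAdele) ⊗ₜ[ℚ] w ∈ L.hat ↔ ∀ i, ∃ n : ℤ, L.ratBasis.repr w i = n := by
  rw [mem_hat_iff]
  refine forall_congr' fun i => ?_
  have : L.adeleBasis.repr ((1 : FinAdele) ⊗ₜ[ℚ] w) i =
      algebraMap ℚ FinAdele (L.ratBasis.repr w i) := by
    simp [Module.Basis.baseChange_repr_tmul, Algebra.smul_def]
  rw [this]
  constructor
  · exact exists_int_of_algebraMap_mem_ZHat
  · rintro ⟨n, hn⟩
    rw [hn]
    exact algebraMap_intCast_mem_ZHat n

lemma adeleForm_mem_ZHat {x y : L.AdeleSpace} (hx : x ∈ L.hat) (hy : y ∈ L.hat) :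
    L.adeleForm x y ∈ ZHat := by
  induction hx using Submodule.span_induction with
  | zero => simp
  | add x x' _ _ h h' => simpa using add_mem h h'
  | smul a x _ h =>
    have : L.adeleForm (a • x) y = (a : FinAdele) * L.adeleForm x y := by
      change L.adeleForm ((a : FinAdele) • x) y = _
      simp
    rw [this]
    exact mul_mem a.2 h
  | mem x h =>
    obtain ⟨t, rfl⟩ := h
    induction hy using Submodule.span_induction with
    | zero => simp
    | add x x' _ _ h h' => simpa using add_mem h h'
    | smul a y _ h =>
      have : ∀ z, L.adeleForm z (a • y) = (a : FinAdele) * L.adeleForm z y := fun z => by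
        change L.adeleForm z ((a : FinAdele) • y) = _
        simp
      rw [this]
      exact mul_mem a.2 h
    | mem y h =>
      obtain ⟨s, rfl⟩ := h
      have : L.adeleForm ((1 : FinAdele) ⊗ₜ[ℚ] ((1 : ℚ) ⊗ₜ[ℤ] t))
          ((1 : FinAdele) ⊗ₜ[ℚ] ((1 : ℚ) ⊗ₜ[ℤ] s)) = ((L.form t s : ℤ) : FinAdele) := by
        simp [Algebra.smul_def]
      rw [this]
      exact intCast_mem _ _

/-- The lattice `L_ℚ ∩ g (L ⊗ ℤ̂)` in `L_ℚ`, for `g` in `O_L(𝔸_f)`. -/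
noncomputable def translate (g : L.OAdele) : AddSubgroup L.RatSpace where
  carrier := {w | (g⁻¹).1 ((1 : FinAdele) ⊗ₜ[ℚ] w) ∈ L.hat}
  zero_mem' := by simp
  add_mem' := fun {a b} ha hb => by
    simpa [TensorProduct.tmul_add] using add_mem ha hb
  neg_mem' := fun {a} ha => by
    have h : -(g⁻¹).1 ((1 : FinAdele) ⊗ₜ[ℚ] a) ∈ L.hat := neg_mem ha
    simpa [TensorProduct.tmul_neg] using h

lemma mem_translate {g : L.OAdele} {w : L.RatSpace} :
    w ∈ L.translate g ↔ (g⁻¹).1 ((1 : FinAdele) ⊗ₜ[ℚ] w) ∈ L.hat := Iff.rfl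

lemma tmul_intCast_smul (M : ℤ) (w : L.RatSpace) :
    (1 : FinAdele) ⊗ₜ[ℚ] (M • w) = (M : FinAdele) • ((1 : FinAdele) ⊗ₜ[ℚ] w) := by
  exact (map_zsmul (TensorProduct.mk ℚ FinAdele L.RatSpace 1) M w).trans
    (Int.cast_smul_eq_zsmul FinAdele M _).symm

lemma exists_zsmul_mem_translate (g : L.OAdele) (w : L.RatSpace) :
    ∃ M : ℤ, M ≠ 0 ∧ M • w ∈ L.translate g := by
  obtain ⟨M, hM, h⟩ := L.exists_intCast_smul_mem_hat ((g⁻¹).1 ((1 : FinAdele) ⊗ₜ[ℚ] w))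
  refine ⟨M, hM, ?_⟩
  rwa [mem_translate, tmul_intCast_smul, map_smul]

lemma exists_intCast_smul_map_mem_hat (g : L.OAdele) :
    ∃ M : ℤ, M ≠ 0 ∧ ∀ x ∈ L.hat, (M : FinAdele) • (g.1 x : L.AdeleSpace) ∈ L.hat := by
  classical
  choose M hM h using fun i => L.exists_intCast_smul_mem_hat
    (g.1 (L.adeleBasis i))
  refine ⟨∏ i, M i, Finset.prod_ne_zero_iff.2 fun i _ => hM i, fun x hx => ?_⟩
  rw [← L.adeleBasis.sum_repr x, map_sum g.1, Finset.smul_sum]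
  refine sum_mem fun i _ => ?_
  have e : ((∏ i, M i : ℤ) : FinAdele) • g.1 (L.adeleBasis.repr x i • L.adeleBasis i) =
      (⟨_, L.mem_hat_iff.1 hx i⟩ : ZHat) • (((∏ j ∈ Finset.univ.erase i, M j : ℤ) : FinAdele) •
        ((M i : FinAdele) • g.1 (L.adeleBasis i))) := by
    change _ = L.adeleBasis.repr x i • (((∏ j ∈ Finset.univ.erase i, M j : ℤ) : FinAdele) •
        ((M i : FinAdele) • g.1 (L.adeleBasis i)))
    rw [← Finset.mul_prod_erase _ M (Finset.mem_univ i), Int.cast_mul, map_smul, smul_smul,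
      smul_smul, smul_smul]
    congr 1
    ring
  rw [e]
  exact Submodule.smul_mem _ _ (L.intCast_smul_mem_hat _ (h i))

/-- The lattice `L_ℚ ∩ g (L ⊗ ℤ̂)` is contained in a multiple `M⁻¹ L`. -/
lemma exists_translate_le (g : L.OAdele) : ∃ M : ℤ, M ≠ 0 ∧ ∀ w ∈ L.translate g, ∀ i,
    ∃ n : ℤ, (M : ℚ) * L.ratBasis.repr w i = n := by
  obtain ⟨M, hM, h⟩ := L.exists_intCast_smul_map_mem_hat g
  refine ⟨M, hM, fun w hw i => ?_⟩
  have h1 := h _ hw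
  have e : g.1 ((g⁻¹).1 ((1 : FinAdele) ⊗ₜ[ℚ] w)) = (1 : FinAdele) ⊗ₜ[ℚ] w :=
    g.1.apply_symm_apply _
  rw [e, ← tmul_intCast_smul, tmul_mem_hat_iff] at h1
  obtain ⟨n, hn⟩ := h1 i
  exact ⟨n, by rw [← hn]; simp⟩

lemma exists_int_ratForm_eq {g : L.OAdele} {w w' : L.RatSpace} (hw : w ∈ L.translate g)
    (hw' : w' ∈ L.translate g) : ∃ n : ℤ, L.ratForm w w' = n := by
  apply exists_int_of_algebraMap_mem_ZHat
  have h := L.adeleForm_mem_ZHat hw hw'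
  rw [(g⁻¹).2] at h
  simpa [Algebra.smul_def] using h

/-- This is how integrality of an arithmetic group is used later: its elements permute one fixed
lattice of the rational quadratic space. -/
lemma map_mem_translate {g : L.OAdele} {q : L.ORat} (hq : g⁻¹ * L.diag q * g ∈ L.OZHat)
    {w : L.RatSpace} : q.1 w ∈ L.translate g ↔ w ∈ L.translate g := by
  have e : (g⁻¹ * L.diag q * g).1 ((g⁻¹).1 ((1 : FinAdele) ⊗ₜ[ℚ] w)) =
      (g⁻¹).1 ((1 : FinAdele) ⊗ₜ[ℚ] q.1 w) := by
    have e : g.1 ((g⁻¹).1 ((1 : FinAdele) ⊗ₜ[ℚ] w)) = (1 : FinAdele) ⊗ₜ[ℚ] w :=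
      g.1.apply_symm_apply _
    change (g⁻¹).1 ((L.diag q).1 (g.1 ((g⁻¹).1 ((1 : FinAdele) ⊗ₜ[ℚ] w)))) = _
    rw [e]
    rfl
  rw [mem_translate, mem_translate, ← e]
  exact hq _

end EvenLattice

/-! ### Determinants of extended isometries -/

namespace IsOrthogonalSummand

variable {R : Type*} [CommRing R] {V W : Type*} [AddCommGroup V] [Module R V]
  [AddCommGroup W] [Module R W] {B : BilinForm R V} {C : BilinForm R W} {i : V →ₗ[R] W}
  {p : W →ₗ[R] V}

/-- With `f = g - 1`, the extension is `1 + i (f p)` while `g` is `1 + (f p) i`, and `det (1 + XY) =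
det (1 + YX)`. -/
lemma det_extend [Module.Free R V] [Module.Finite R V] [Module.Free R W]
    [Module.Finite R W] (h : IsOrthogonalSummand B C i p) (g : orthogonalGroup B) :
    LinearMap.det ((h.extend g).1 : W →ₗ[R] W) = LinearMap.det (g.1 : V →ₗ[R] V) := by
  classical
  let b := Module.Free.chooseBasis R V
  let c := Module.Free.chooseBasis R W
  let f : V →ₗ[R] V := (g.1 : V →ₗ[R] V) - LinearMap.id
  have e1 : ((h.extend g).1 : W →ₗ[R] W) = LinearMap.id + i ∘ₗ (f ∘ₗ p) := by
    ext w
    simp [h.extend_apply, f]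
    abel
  have e2 : (g.1 : V →ₗ[R] V) = LinearMap.id + (f ∘ₗ p) ∘ₗ i := by
    ext v
    simp [h.proj_incl, f]
  rw [e1, ← LinearMap.det_toMatrix c, map_add, LinearMap.toMatrix_id,
    LinearMap.toMatrix_comp c b c, Matrix.det_one_add_mul_comm, ← LinearMap.toMatrix_comp b c b,
    ← LinearMap.toMatrix_id b, ← map_add, LinearMap.det_toMatrix, ← e2]

lemma _root_.OrthogonalModuli.mem_specialOrthogonalGroup_iff {g : orthogonalGroup B} :
    g ∈ specialOrthogonalGroup B ↔ LinearMap.det (g.1 : V →ₗ[R] V) = 1 := by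
  rw [← LinearEquiv.coe_det, Units.val_eq_one]
  rfl

lemma extend_mem_special_iff [Module.Free R V] [Module.Finite R V] [Module.Free R W]
    [Module.Finite R W] (h : IsOrthogonalSummand B C i p) {g : orthogonalGroup B} :
    h.extend g ∈ specialOrthogonalGroup C ↔ g ∈ specialOrthogonalGroup B := by
  rw [mem_specialOrthogonalGroup_iff, mem_specialOrthogonalGroup_iff, h.det_extend]

end IsOrthogonalSummand

/-! ### Primitivity and the discriminant kernel -/

namespace PrimitiveEmbedding

variable {T : EvenLattice.{u}} {S : EvenLattice.{v}} (ι : PrimitiveEmbedding T S)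

/-- A primitive sublattice is a direct summand. -/
lemma exists_retraction : ∃ ρ : S →ₗ[ℤ] T, ∀ t, ρ (ι.toLin t) = t := by
  have : Module.IsTorsionFree ℤ (S ⧸ LinearMap.range ι.toLin) := by
    rw [Module.isTorsionFree_iff_smul_eq_zero]
    intro m x hx
    obtain ⟨s, rfl⟩ := Submodule.Quotient.mk_surjective _ x
    rw [← Submodule.Quotient.mk_smul, Submodule.Quotient.mk_eq_zero] at hx
    by_cases hm : m = 0
    · exact Or.inl hm
    · exact Or.inr ((Submodule.Quotient.mk_eq_zero _).2 (ι.primitive m s hm hx))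
  have : Module.Free ℤ (S ⧸ LinearMap.range ι.toLin) := Module.free_of_finite_type_torsion_free'
  obtain ⟨l, hl⟩ := Module.projective_lifting_property (LinearMap.range ι.toLin).mkQ .id
    (Submodule.mkQ_surjective _)
  have h : ∀ s, s - l ((LinearMap.range ι.toLin).mkQ s) ∈ LinearMap.range ι.toLin := fun s => by
    have := LinearMap.congr_fun hl ((LinearMap.range ι.toLin).mkQ s)
    refine (Submodule.Quotient.mk_eq_zero _).1 ?_
    exact (map_sub (LinearMap.range ι.toLin).mkQ _ _).trans (sub_eq_zero.2 this.symm)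
  refine ⟨(LinearEquiv.ofInjective ι.toLin ι.injective).symm.toLinearMap ∘ₗ
    (LinearMap.id - l ∘ₗ (LinearMap.range ι.toLin).mkQ).codRestrict _ h, fun t => ?_⟩
  refine (LinearEquiv.symm_apply_eq _).2 (Subtype.ext ?_)
  have : (LinearMap.range ι.toLin).mkQ (ι.toLin t) = 0 :=
    (Submodule.Quotient.mk_eq_zero _).2 ⟨t, rfl⟩
  simp [this]

/-- A retraction `S → T` of lattices, extended to adeles, maps `S ⊗ ℤ̂` to `T ⊗ ℤ̂` and undoes the
inclusion. -/
lemma mem_hat_of_incl_mem_hat {x : T.AdeleSpace} (hx : ι.rat.baseChange FinAdele x ∈ S.hat) :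
    x ∈ T.hat := by
  obtain ⟨ρ, hρ⟩ := ι.exists_retraction
  have h : S.hat ≤ T.hat.comap (((ρ.baseChange ℚ).baseChange FinAdele).restrictScalars ZHat) := by
    rw [EvenLattice.hat, Submodule.span_le]
    rintro _ ⟨s, rfl⟩
    exact Submodule.subset_span ⟨ρ s, rfl⟩
  have e : ((ρ.baseChange ℚ).baseChange FinAdele) ∘ₗ (ι.rat.baseChange FinAdele) =
      LinearMap.id := by
    rw [← LinearMap.baseChange_comp, ← LinearMap.baseChange_comp,
      show ρ ∘ₗ ι.toLin = LinearMap.id from LinearMap.ext hρ, LinearMap.baseChange_id,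
      LinearMap.baseChange_id]
  have h2 := h hx
  rw [Submodule.mem_comap] at h2
  rwa [← LinearMap.id_apply (R := FinAdele) x, ← e]

/-- The functional `(y, ρ ·)`, with `ρ` a retraction of `S` onto `T`, is integral on `S` and
restricts to `(y, ·)` on `T`. The vector representing it is the required lift. -/
lemma exists_dual_proj_eq {y : T.RatSpace} (hy : y ∈ T.dual) : ∃ x ∈ S.dual, ι.proj x = y := by
  obtain ⟨ρ, hρ⟩ := ι.exists_retraction
  let x : S.RatSpace := (S.ratForm.toDual S.ratForm_nondegenerate).symm
    (T.ratForm y ∘ₗ ρ.baseChange ℚ)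
  have hx : ∀ w, S.ratForm x w = T.ratForm y (ρ.baseChange ℚ w) := fun w => by
    simp [x, LinearMap.BilinForm.apply_toDual_symm_apply]
  refine ⟨x, fun s => ?_, ?_⟩
  · obtain ⟨n, hn⟩ := hy (ρ s)
    exact ⟨n, by rw [hx, ← hn]; rfl⟩
  · refine sub_eq_zero.1 (T.ratForm_nondegenerate.1 _ fun v => ?_)
    have e : ρ.baseChange ℚ (ι.rat v) = v := by
      rw [← LinearMap.comp_apply, ← LinearMap.baseChange_comp,
        show ρ ∘ₗ ι.toLin = LinearMap.id from LinearMap.ext hρ, LinearMap.baseChange_id,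
        LinearMap.id_apply]
    rw [map_sub, LinearMap.sub_apply, ι.proj_adjoint, hx, e, sub_self]

lemma exists_dualHat_proj_eq {y : T.AdeleSpace} (hy : y ∈ T.dualHat) :
    ∃ x ∈ S.dualHat, ι.proj.baseChange FinAdele x = y := by
  have h : T.dualHat ≤ S.dualHat.map ((ι.proj.baseChange FinAdele).restrictScalars ZHat) := by
    rw [EvenLattice.dualHat, Submodule.span_le]
    rintro _ ⟨y, hy, rfl⟩
    obtain ⟨x, hx, rfl⟩ := ι.exists_dual_proj_eq hy
    exact ⟨_, Submodule.subset_span ⟨x, hx, rfl⟩, rfl⟩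
  exact h hy

/-- The converse direction is where primitivity matters: `T ⊗ ℤ̂` is cut out by `S ⊗ ℤ̂`, and every
class of `T^∨` is the projection of one of `S^∨`. It makes `h ⊕ id` arithmetic only when `h` is. -/
lemma extendAdele_mem_OZHatStar_iff {k : T.OAdele} :
    ι.extendAdele k ∈ S.OZHatStar ↔ k ∈ T.OZHatStar := by
  refine ⟨fun h => ⟨fun x => ⟨fun hx => ?_, fun hx => ?_⟩, fun y hy => ?_⟩,
    ι.extendAdele_mem_OZHatStar⟩
  · refine ι.mem_hat_of_incl_mem_hat ((h.1 _).1 ?_)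
    rw [IsOrthogonalSummand.extend_incl]
    exact ι.incl_mem_hat hx
  · refine ι.mem_hat_of_incl_mem_hat ?_
    have := (h.1 _).2 (ι.incl_mem_hat hx)
    rwa [IsOrthogonalSummand.extend_incl] at this
  · obtain ⟨x, hx, rfl⟩ := ι.exists_dualHat_proj_eq hy
    refine ι.mem_hat_of_incl_mem_hat ?_
    have e : (ι.extendAdele k).1 x - x = ι.rat.baseChange FinAdele
        (k.1 (ι.proj.baseChange FinAdele x) - ι.proj.baseChange FinAdele x) := by
      rw [IsOrthogonalSummand.extend_apply, map_sub]
      abel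
    rw [← e]
    exact h.2 x hx

end PrimitiveEmbedding

/-! ### Majorants in signature `(2, n)` -/

section Majorant

variable {E : Type*} [AddCommGroup E] [Module ℝ E] [Module.Finite ℝ E] {β : BilinForm ℝ E}

/-- In a real quadratic space of signature `(2, n)`, the orthogonal complement of a positive definite
plane has no vectors of positive norm. -/
lemma nonpos_of_orthogonal_plane (hsymm : ∀ x y, β x y = β y x)
    (hsig : sigPos β.toQuadraticMap = 2) {x y : E} {a : ℝ} (ha : 0 < a) (hx : β x x = a)
    (hy : β y y = a) (hxy : β x y = 0) {u : E} (hux : β u x = 0) (huy : β u y = 0) :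
    β u u ≤ 0 := by
  by_contra! hu
  -- Otherwise `x`, `y`, `u` span a positive definite subspace of dimension three, which exceeds
  -- `sigPos`.
  let f : (Fin 3 → ℝ) →ₗ[ℝ] E := Fintype.linearCombination ℝ ![x, y, u]
  have hf : ∀ c : Fin 3 → ℝ, f c = c 0 • x + c 1 • y + c 2 • u := fun c => by
    simp [f, Fintype.linearCombination_apply, Fin.sum_univ_three]
  have hq : ∀ c : Fin 3 → ℝ, β (f c) (f c) = c 0 ^ 2 * a + c 1 ^ 2 * a + c 2 ^ 2 * β u u :=
    fun c => by
      rw [hf]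
      simp only [map_add, map_smul, LinearMap.add_apply, LinearMap.smul_apply, smul_eq_mul,
        hx, hy, hxy, hsymm y x, hsymm x u, hsymm y u, hux, huy]
      ring
  have hpos : ∀ c : Fin 3 → ℝ, c ≠ 0 → 0 < β (f c) (f c) := fun c hc => by
    rw [hq]
    by_contra! hle
    have h0 := mul_nonneg (sq_nonneg (c 0)) ha.le
    have h1 := mul_nonneg (sq_nonneg (c 1)) ha.le
    have h2 := mul_nonneg (sq_nonneg (c 2)) hu.le
    have e0 : c 0 ^ 2 * a = 0 := by linarith
    have e1 : c 1 ^ 2 * a = 0 := by linarith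
    have e2 : c 2 ^ 2 * β u u = 0 := by linarith
    refine hc (funext fun i => ?_)
    fin_cases i
    · simpa [ha.ne'] using e0
    · simpa [ha.ne'] using e1
    · simpa [hu.ne'] using e2
  have hinj : Function.Injective f := (injective_iff_map_eq_zero f).2 fun c hc => by
    by_contra h
    have := hpos c h
    simp [hc] at this
  have h3 : Module.finrank ℝ (LinearMap.range f) = 3 := by
    rw [LinearMap.finrank_range_of_inj hinj]
    simp
  have hdef : (β.toQuadraticMap.restrict (LinearMap.range f)).PosDef := by
    rintro ⟨_, c, rfl⟩ hc
    refine hpos c fun h => hc (Subtype.ext ?_)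
    simp [h]
  have := le_sigPos_of_posDef β.toQuadraticMap hdef
  omega

/-- The majorant of a real quadratic form of signature `(2, n)` attached to a positive definite
plane is positive definite. -/
lemma majorant_plane_pos (hsymm : ∀ x y, β x y = β y x) (hnd : β.Nondegenerate)
    (hsig : sigPos β.toQuadraticMap = 2) {x y : E} {a : ℝ} (ha : 0 < a) (hx : β x x = a)
    (hy : β y y = a) (hxy : β x y = 0) {u : E} (hu : u ≠ 0) :
    0 < 2 * (β u x ^ 2 + β u y ^ 2) - a * β u u := by
  have hproj : ∀ w : E, ∃ w', β w' x = 0 ∧ β w' y = 0 ∧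
      w' = w - (β w x / a) • x - (β w y / a) • y := fun w => by
    refine ⟨_, ?_, ?_, rfl⟩
    · simp only [map_sub, map_smul, LinearMap.sub_apply, LinearMap.smul_apply, smul_eq_mul, hx,
        hsymm y x, hxy]
      field_simp
      ring
    · simp only [map_sub, map_smul, LinearMap.sub_apply, LinearMap.smul_apply, smul_eq_mul, hy, hxy]
      field_simp
      ring
  obtain ⟨v, hvx, hvy, hv⟩ := hproj u
  have hvv : a * β v v = a * β u u - (β u x ^ 2 + β u y ^ 2) := by
    have : β v v = β v u := by
      conv_lhs => rw [hv, map_sub, map_sub, map_smul, map_smul, ← hv, hvx, hvy]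
      simp
    rw [this, hv]
    simp only [map_sub, map_smul, LinearMap.sub_apply, LinearMap.smul_apply, smul_eq_mul,
      hsymm x u, hsymm y u]
    field_simp
    ring
  have hneg := nonpos_of_orthogonal_plane hsymm hsig ha hx hy hxy hvx hvy
  -- Put `s = (u, x)² + (u, y)²`, so that `a (v, v) = a (u, u) - s`. If the majorant is not
  -- positive, then `a (v, v) ≥ s ≥ 0`, while `(v, v) ≤ 0`. Hence `s = 0`, and `u` is an isotropic
  -- vector orthogonal to the plane. Semidefiniteness of the form there places `u` in the radical.
  by_contra! hle
  have h1 : 0 ≤ a * β v v := by nlinarith [sq_nonneg (β u x), sq_nonneg (β u y)]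
  have h2 : a * β v v ≤ 0 := mul_nonpos_of_nonneg_of_nonpos ha.le hneg
  have hux : β u x = 0 := by nlinarith [sq_nonneg (β u x), sq_nonneg (β u y)]
  have huy : β u y = 0 := by nlinarith [sq_nonneg (β u x), sq_nonneg (β u y)]
  have huu : β u u = 0 := by
    have : a * β u u = 0 := by rw [hux, huy] at hvv; linarith
    simpa [ha.ne'] using this
  have hz : ∀ w, β u w = 0 := fun w => by
    obtain ⟨w', hwx, hwy, hw⟩ := hproj w
    have huw : β u w = β u w' := by
      rw [hw]
      simp [hux, huy]
    rw [huw]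
    by_contra hne
    have hall : ∀ t : ℝ, 2 * t * β u w' + t ^ 2 * β w' w' ≤ 0 := fun t => by
      have h := nonpos_of_orthogonal_plane hsymm hsig ha hx hy hxy (u := u + t • w')
        (by simp [hux, hwx]) (by simp [huy, hwy])
      simp only [map_add, map_smul, LinearMap.add_apply, LinearMap.smul_apply, smul_eq_mul, huu,
        hsymm w' u] at h
      linarith
    have hww := nonpos_of_orthogonal_plane hsymm hsig ha hx hy hxy hwx hwy
    have hk : 0 < 1 + |β w' w'| := by positivity
    -- For this `t` the linear term `2 t (u, w')` outweighs `t² (w', w')`; the summand `1` keeps the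
    -- denominator nonzero.
    have h := hall (β u w' / (1 + |β w' w'|))
    have hsq : 0 < β u w' ^ 2 := by positivity
    have e : 2 * (β u w' / (1 + |β w' w'|)) * β u w' +
        (β u w' / (1 + |β w' w'|)) ^ 2 * β w' w' =
        β u w' ^ 2 * (2 + 2 * |β w' w'| + β w' w') / (1 + |β w' w'|) ^ 2 := by
      field_simp
    rw [e] at h
    have : 0 < β u w' ^ 2 * (2 + 2 * |β w' w'| + β w' w') / (1 + |β w' w'|) ^ 2 := by
      have := neg_abs_le (β w' w')
      have := abs_nonneg (β w' w')
      have h5 : 0 < 2 + 2 * |β w' w'| + β w' w' := by linarith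
      positivity
    linarith
  exact hu (hnd.1 u hz)

end Majorant

/-! ### Local uniformity of majorants in coordinates -/

section Coordinates

variable {I : Type*} [Fintype I] (G : I → I → ℝ)

/-- The majorant attached to the isotropic vector `z`, up to the factor `(z, z̄)`, in terms of a
Gram matrix `G`. -/
noncomputable def gramMajorant (z : I → ℂ) (u : I → ℝ) : ℝ :=
  4 * Complex.normSq (∑ i, ∑ j, G i j * z i * u j) -
    (∑ i, ∑ j, G i j * z i * starRingEnd ℂ (z j)).re * ∑ i, ∑ j, G i j * u i * u j

lemma continuous_gramMajorant :
    Continuous fun p : (I → ℂ) × (I → ℝ) => gramMajorant G p.1 p.2 := by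
  unfold gramMajorant
  have h1 : Continuous fun p : (I → ℂ) × (I → ℝ) => ∑ i, ∑ j, (G i j : ℂ) * p.1 i * (p.2 j : ℂ) := by
    fun_prop
  have h2 : Continuous fun p : (I → ℂ) × (I → ℝ) =>
      (∑ i, ∑ j, (G i j : ℂ) * p.1 i * starRingEnd ℂ (p.1 j)).re := by
    refine Complex.continuous_re.comp ?_
    refine continuous_finsetSum _ fun i _ => continuous_finsetSum _ fun j _ => ?_
    exact (by fun_prop : Continuous fun p : (I → ℂ) × (I → ℝ) => (G i j : ℂ) * p.1 i).mul
      (Complex.continuous_conj.comp (by fun_prop))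
  exact ((Complex.continuous_normSq.comp h1).const_mul 4).sub (h2.mul (by fun_prop))

lemma gramMajorant_smul (z : I → ℂ) (t : ℝ) (u : I → ℝ) :
    gramMajorant G z (t • u) = t ^ 2 * gramMajorant G z u := by
  have h1 : ∑ i, ∑ j, (G i j : ℂ) * z i * ((t • u) j : ℝ) =
      t * ∑ i, ∑ j, (G i j : ℂ) * z i * u j := by
    simp only [Finset.mul_sum, Pi.smul_apply, smul_eq_mul, Complex.ofReal_mul]
    exact Finset.sum_congr rfl fun i _ => Finset.sum_congr rfl fun j _ => by ring
  have h2 : ∑ i, ∑ j, G i j * (t • u) i * (t • u) j = t ^ 2 * ∑ i, ∑ j, G i j * u i * u j := by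
    simp only [Finset.mul_sum, Pi.smul_apply, smul_eq_mul]
    exact Finset.sum_congr rfl fun i _ => Finset.sum_congr rfl fun j _ => by ring
  rw [gramMajorant, gramMajorant, h1, h2, Complex.normSq_mul, Complex.normSq_ofReal]
  ring

/-- Positive definiteness of the majorant at `z₀` is locally uniform. -/
lemma exists_nhds_gramMajorant_ge {z₀ : I → ℂ} (h : ∀ u, u ≠ 0 → 0 < gramMajorant G z₀ u) :
    ∃ ε > 0, ∃ O ∈ 𝓝 z₀, ∀ z ∈ O, ∀ u, ε * ‖u‖ ^ 2 ≤ gramMajorant G z u := by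
  have hK : IsCompact (Metric.sphere (0 : I → ℝ) 1) := isCompact_sphere 0 1
  obtain ⟨ε, hε, hmin⟩ : ∃ ε > 0, ∀ u ∈ Metric.sphere (0 : I → ℝ) 1, ε < gramMajorant G z₀ u := by
    -- The sphere is empty when `I` is, and then there is no minimum to take.
    rcases (Metric.sphere (0 : I → ℝ) 1).eq_empty_or_nonempty with he | hne
    · exact ⟨1, one_pos, by simp [he]⟩
    · obtain ⟨u, hu, hmin⟩ := hK.exists_isMinOn hne
        ((continuous_gramMajorant G).comp (Continuous.prodMk_right z₀)).continuousOn
      have hu0 : u ≠ 0 := by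
        rintro rfl
        simp at hu
      refine ⟨gramMajorant G z₀ u / 2, half_pos (h u hu0), fun v hv => ?_⟩
      have h1 : gramMajorant G z₀ u ≤ gramMajorant G z₀ v := hmin hv
      have h2 := h u hu0
      linarith
  -- Compactness of the sphere yields one neighbourhood of `z₀` that serves all directions `u`;
  -- homogeneity of degree two then extends the bound to all `u`.
  have hev : ∀ᶠ z in 𝓝 z₀, ∀ u ∈ Metric.sphere (0 : I → ℝ) 1, ε < gramMajorant G z u := by
    refine hK.eventually_forall_of_forall_eventually fun u hu => ?_
    exact (continuous_gramMajorant G).continuousAt.eventually (lt_mem_nhds (hmin u hu))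
  refine ⟨ε, hε, _, hev, fun z hz u => ?_⟩
  by_cases hu : u = 0
  · subst hu
    have : gramMajorant G z 0 = 0 := by simpa using gramMajorant_smul G z 0 0
    simp [this]
  · have hu' : ‖u‖ ≠ 0 := norm_ne_zero_iff.2 hu
    have h1 := hz (‖u‖⁻¹ • u) (by simp [norm_smul, hu'])
    rw [gramMajorant_smul] at h1
    have h2 : gramMajorant G z u = ‖u‖ ^ 2 * (‖u‖⁻¹ ^ 2 * gramMajorant G z u) := by
      field_simp
    rw [h2, mul_comm]
    exact mul_le_mul_of_nonneg_left h1.le (by positivity)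

/-- Finiteness of the set of vectors of a lattice in a bounded set. -/
lemma finite_bounded_of_isIntegral_multiple (M : ℤ) (hM : M ≠ 0) (R : ℝ) :
    {u : I → ℚ | (∀ i, ∃ n : ℤ, M * u i = n) ∧ ‖fun i => (u i : ℝ)‖ ≤ R}.Finite := by
  classical
  have hfin : (Set.Icc (fun _ : I => -⌈|(M : ℝ)| * R⌉) (fun _ : I => ⌈|(M : ℝ)| * R⌉)).Finite :=
    Set.finite_Icc _ _
  refine (hfin.image fun n i => (n i : ℚ) / M).subset ?_
  rintro u ⟨h1, h2⟩
  choose n hn using h1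
  have hM' : (M : ℚ) ≠ 0 := by exact_mod_cast hM
  have hb : ∀ i, |n i| ≤ ⌈|(M : ℝ)| * R⌉ := fun i => by
    have h3 : |(u i : ℝ)| ≤ R := (norm_le_pi_norm (fun i => (u i : ℝ)) i).trans h2
    have h4 : ((n i : ℤ) : ℝ) = M * u i := by exact_mod_cast (hn i).symm
    have h5 : ((|n i| : ℤ) : ℝ) ≤ |(M : ℝ)| * R := by
      rw [Int.cast_abs, h4, abs_mul]
      exact mul_le_mul_of_nonneg_left h3 (abs_nonneg _)
    exact_mod_cast h5.trans (Int.le_ceil _)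
  refine ⟨n, ⟨fun i => (abs_le.1 (hb i)).1, fun i => (abs_le.1 (hb i)).2⟩, funext fun i => ?_⟩
  rw [div_eq_iff hM', ← hn, mul_comm]

end Coordinates

/-! ### Topology and conjugation on the complexification -/

section ModuleTopology

variable {V W : Type*} [AddCommGroup V] [Module ℚ V] [AddCommGroup W] [Module ℚ W]

/-- The topology of the complex vector space `V_ℂ`. -/
noncomputable scoped instance complexTopology : TopologicalSpace (ℂ ⊗[ℚ] V) :=
  moduleTopology ℂ (ℂ ⊗[ℚ] V)

noncomputable scoped instance : IsModuleTopology ℂ (ℂ ⊗[ℚ] V) := ⟨rfl⟩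

noncomputable scoped instance : ContinuousAdd (ℂ ⊗[ℚ] V) := IsModuleTopology.toContinuousAdd ℂ _

lemma continuous_of_complex_linear {X : Type*} [AddCommGroup X] [Module ℂ X] [TopologicalSpace X]
    [ContinuousAdd X] [ContinuousSMul ℂ X] (f : (ℂ ⊗[ℚ] V) →ₗ[ℂ] X) : Continuous f :=
  IsModuleTopology.continuous_of_linearMap f

/-- Complex conjugation, as a semilinear map. -/
noncomputable def conjₛₗ (V : Type*) [AddCommGroup V] [Module ℚ V] :
    (ℂ ⊗[ℚ] V) →ₛₗ[starRingEnd ℂ] (ℂ ⊗[ℚ] V) where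
  toFun := conj V
  map_add' := map_add _
  map_smul' := conj_smul

lemma continuous_conj : Continuous (conj V) :=
  IsModuleTopology.continuous_of_linearMapₛₗ Complex.continuous_conj (conjₛₗ V)

lemma baseChange_conj (B : BilinForm ℚ V) (z w : ℂ ⊗[ℚ] V) :
    B.baseChange ℂ (conj V z) (conj V w) = starRingEnd ℂ (B.baseChange ℂ z w) := by
  induction z with
  | zero => simp
  | add x y hx hy => simp only [map_add, LinearMap.add_apply, hx, hy]
  | tmul a x =>
    induction w with
    | zero => simp
    | add x y hx hy => simp only [map_add, hx, hy]
    | tmul b y => simp [Algebra.smul_def]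

lemma baseChange_symm {B : BilinForm ℚ V} (hB : ∀ x y, B x y = B y x) (z w : ℂ ⊗[ℚ] V) :
    B.baseChange ℂ z w = B.baseChange ℂ w z := by
  have e : B.baseChange ℂ = (B.baseChange ℂ).flip := by
    ext x y
    simp [hB x y]
  exact LinearMap.congr_fun₂ e z w

lemma continuous_baseChange_form [Module.Finite ℚ V] (B : BilinForm ℚ V) :
    Continuous fun p : (ℂ ⊗[ℚ] V) × (ℂ ⊗[ℚ] V) => B.baseChange ℂ p.1 p.2 :=
  IsModuleTopology.continuous_bilinear_of_finite_left (B.baseChange ℂ)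

lemma continuous_baseChange_form_comp [Module.Finite ℚ V] (B : BilinForm ℚ V) {X : Type*}
    [TopologicalSpace X] {f g : X → ℂ ⊗[ℚ] V} (hf : Continuous f) (hg : Continuous g) :
    Continuous fun x => B.baseChange ℂ (f x) (g x) :=
  Continuous.comp (g := fun p : (ℂ ⊗[ℚ] V) × (ℂ ⊗[ℚ] V) => B.baseChange ℂ p.1 p.2)
    (f := fun x => (f x, g x)) (continuous_baseChange_form B) (hf.prodMk hg)

/-- For a period vector `z`, the majorant of the form attached to `z`, up to the factor
`(z, z̄)`. -/
noncomputable def majorant (B : BilinForm ℚ V) (z : ℂ ⊗[ℚ] V) (w : V) : ℝ :=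
  4 * Complex.normSq (B.baseChange ℂ z (1 ⊗ₜ w)) -
    (B.baseChange ℂ z (conj V z)).re * (B w w : ℝ)

end ModuleTopology

/-! ### Local finiteness of lattice vectors with bounded majorant -/

namespace EvenLattice

variable (L : EvenLattice.{u})

/-- The Gram matrix of a lattice. -/
noncomputable def gram (i j : Module.Free.ChooseBasisIndex ℤ L) : ℝ :=
  L.form (L.basis i) (L.basis j)

/-- The basis of `L_ℂ` given by a basis of `L`. -/
noncomputable abbrev complexBasis := L.ratBasis.baseChange ℂ

lemma complexForm_eq_sum (z w : ℂ ⊗[ℚ] L.RatSpace) : L.ratForm.baseChange ℂ z w =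
    ∑ i, ∑ j, (L.gram i j : ℂ) * L.complexBasis.repr z i * L.complexBasis.repr w j := by
  conv_lhs => rw [← L.complexBasis.sum_repr z, ← L.complexBasis.sum_repr w]
  simp only [map_sum, LinearMap.sum_apply, map_smul, LinearMap.smul_apply, smul_eq_mul]
  rw [Finset.sum_comm]
  refine Finset.sum_congr rfl fun i _ => ?_
  rw [Finset.mul_sum]
  refine Finset.sum_congr rfl fun j _ => ?_
  simp [gram]
  ring

lemma ratForm_eq_sum (z w : L.RatSpace) : (L.ratForm z w : ℝ) =
    ∑ i, ∑ j, L.gram i j * (L.ratBasis.repr z i : ℝ) * (L.ratBasis.repr w j : ℝ) := by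
  conv_lhs => rw [← L.ratBasis.sum_repr z, ← L.ratBasis.sum_repr w]
  simp only [map_sum, LinearMap.sum_apply, map_smul, LinearMap.smul_apply, smul_eq_mul,
    Rat.cast_sum]
  rw [Finset.sum_comm]
  refine Finset.sum_congr rfl fun i _ => ?_
  rw [Finset.mul_sum, Rat.cast_sum]
  refine Finset.sum_congr rfl fun j _ => ?_
  simp [gram]
  ring

lemma complexBasis_repr_conj (z : ℂ ⊗[ℚ] L.RatSpace) (i) :
    L.complexBasis.repr (conj _ z) i = starRingEnd ℂ (L.complexBasis.repr z i) := by
  induction z with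
  | zero => simp
  | add x y hx hy => simp only [map_add, Finsupp.add_apply, hx, hy]
  | tmul a x => simp [Module.Basis.baseChange_repr_tmul, Algebra.smul_def]

lemma complexBasis_repr_tmul (w : L.RatSpace) (i) :
    L.complexBasis.repr ((1 : ℂ) ⊗ₜ[ℚ] w) i = ((L.ratBasis.repr w i : ℝ) : ℂ) := by
  simp [Module.Basis.baseChange_repr_tmul, Algebra.smul_def]

lemma majorant_eq_gramMajorant (z : ℂ ⊗[ℚ] L.RatSpace) (w : L.RatSpace) :
    majorant L.ratForm z w =
      gramMajorant L.gram (fun i => L.complexBasis.repr z i) fun i => L.ratBasis.repr w i := by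
  simp only [majorant, gramMajorant, complexForm_eq_sum, ratForm_eq_sum, complexBasis_repr_conj,
    complexBasis_repr_tmul]

lemma realForm_eq_sum (x y : Module.Free.ChooseBasisIndex ℤ L → ℝ) :
    L.form.baseChange ℝ ((L.basis.baseChange ℝ).equivFun.symm x)
      ((L.basis.baseChange ℝ).equivFun.symm y) = ∑ i, ∑ j, L.gram i j * x i * y j := by
  simp only [Module.Basis.equivFun_symm_apply, map_sum, LinearMap.sum_apply, map_smul,
    LinearMap.smul_apply, smul_eq_mul]
  rw [Finset.sum_comm]
  refine Finset.sum_congr rfl fun i _ => ?_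
  rw [Finset.mul_sum]
  refine Finset.sum_congr rfl fun j _ => ?_
  simp [gram]
  ring

lemma realForm_symm (x y : ℝ ⊗[ℤ] L) : L.form.baseChange ℝ x y = L.form.baseChange ℝ y x := by
  have e : L.form.baseChange ℝ = (L.form.baseChange ℝ).flip := by
    ext x y
    simp [L.symm x y]
  exact LinearMap.congr_fun₂ e x y

lemma realForm_nondegenerate : (L.form.baseChange ℝ).Nondegenerate := by
  classical
  have h := (LinearMap.BilinForm.nondegenerate_iff_det_ne_zero L.basis).1 L.nondegenerate
  rw [LinearMap.BilinForm.nondegenerate_iff_det_ne_zero (L.basis.baseChange ℝ)]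
  have e : LinearMap.BilinForm.toMatrix (L.basis.baseChange ℝ) (L.form.baseChange ℝ) =
      (Int.castRingHom ℝ).mapMatrix (LinearMap.BilinForm.toMatrix L.basis L.form) := by
    ext i j
    simp [LinearMap.BilinForm.toMatrix_apply]
  rw [e, ← RingHom.map_det]
  simpa using h

variable {L} {n : ℕ}

/-- Write `z = x + i y`. The equation `(z, z) = 0` says that `x` and `y` are orthogonal of equal
norm, and `(z, z̄) > 0` that this norm is positive. Then `gramMajorant` is twice the expression in
`majorant_plane_pos` for the plane of `x` and `y`. -/
lemma gramMajorant_pos (hL : L.HasSignature 2 n) {z : ℂ ⊗[ℚ] L.RatSpace}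
    (hz : IsPeriodVector L.ratForm z) {u : Module.Free.ChooseBasisIndex ℤ L → ℝ} (hu : u ≠ 0) :
    0 < gramMajorant L.gram (fun i => L.complexBasis.repr z i) u := by
  obtain ⟨h1, h2⟩ := hz
  rw [complexForm_eq_sum] at h1 h2
  simp only [complexBasis_repr_conj] at h2
  set c : Module.Free.ChooseBasisIndex ℤ L → ℂ := fun i => L.complexBasis.repr z i
  let vec := (L.basis.baseChange ℝ).equivFun.symm
  set x := vec fun i => (c i).re
  set y := vec fun i => (c i).im
  let β := L.form.baseChange ℝ
  have hyx : β y x = β x y := L.realForm_symm y x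
  have e1 : ∑ i, ∑ j, (L.gram i j : ℂ) * c i * c j =
      ((β x x - β y y : ℝ) : ℂ) + ((β x y + β y x : ℝ) : ℂ) * Complex.I := by
    simp only [β, x, y, vec, realForm_eq_sum, Complex.ext_iff]
    constructor
    · simp [Finset.sum_sub_distrib, mul_assoc, mul_sub]
    · simp [Finset.sum_add_distrib, mul_assoc, mul_add]
  have e2 : (∑ i, ∑ j, (L.gram i j : ℂ) * c i * starRingEnd ℂ (c j)).re = β x x + β y y := by
    simp only [β, x, y, vec, realForm_eq_sum]
    simp [Finset.sum_add_distrib, mul_assoc, mul_add]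
  have e3 : Complex.normSq (∑ i, ∑ j, (L.gram i j : ℂ) * c i * u j) =
      β (vec u) x ^ 2 + β (vec u) y ^ 2 := by
    rw [L.realForm_symm (vec u) x, L.realForm_symm (vec u) y]
    simp only [x, y, vec, realForm_eq_sum, Complex.normSq_apply]
    simp [mul_assoc]
    ring
  rw [e1] at h1
  have h3 := congrArg Complex.re h1
  have h4 := congrArg Complex.im h1
  simp at h3 h4
  rw [e2] at h2
  have hy : β y y = β x x := by linarith
  have hxy : β x y = 0 := by linarith [hyx]
  have hx : 0 < β x x := by linarith
  have hm := majorant_plane_pos L.realForm_symm L.realForm_nondegenerate hL.1 hx rfl hy hxy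
    (u := vec u) (fun h => hu (vec.map_eq_zero_iff.1 h))
  rw [gramMajorant, e3, e2, hy, ← L.realForm_eq_sum u u]
  have : 4 * (β (vec u) x ^ 2 + β (vec u) y ^ 2) - (β x x + β x x) * β (vec u) (vec u) =
    2 * (2 * (β (vec u) x ^ 2 + β (vec u) y ^ 2) - β x x * β (vec u) (vec u)) := by ring
  exact this ▸ mul_pos two_pos hm

lemma majorant_pos (hL : L.HasSignature 2 n) {z : ℂ ⊗[ℚ] L.RatSpace}
    (hz : IsPeriodVector L.ratForm z) {w : L.RatSpace} (hw : w ≠ 0) :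
    0 < majorant L.ratForm z w := by
  rw [majorant_eq_gramMajorant]
  refine gramMajorant_pos hL hz fun h => hw ?_
  refine L.ratBasis.repr.map_eq_zero_iff.1 (Finsupp.ext fun i => ?_)
  have := congrFun h i
  simpa using this

/-- A rational vector orthogonal to a period vector has negative norm. -/
lemma ratForm_neg_of_orthogonal (hL : L.HasSignature 2 n) {z : ℂ ⊗[ℚ] L.RatSpace}
    (hz : IsPeriodVector L.ratForm z) {w : L.RatSpace} (hw : w ≠ 0)
    (hzw : L.ratForm.baseChange ℂ z (1 ⊗ₜ w) = 0) : L.ratForm w w < 0 := by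
  have h := majorant_pos hL hz hw
  rw [majorant, hzw, map_zero, mul_zero, zero_sub, ← mul_neg] at h
  have := pos_of_mul_pos_right h hz.2.le
  have h2 : (L.ratForm w w : ℝ) < 0 := by linarith
  exact_mod_cast h2

/-- Local finiteness of lattice vectors with bounded majorant. -/
lemma exists_nhds_finite_majorant_le (hL : L.HasSignature 2 n) (g : L.OAdele)
    {z₀ : ℂ ⊗[ℚ] L.RatSpace} (hz : IsPeriodVector L.ratForm z₀) :
    ∃ O ∈ 𝓝 z₀, ∀ c : ℝ,
      {w | w ∈ L.translate g ∧ ∃ z ∈ O, majorant L.ratForm z w ≤ c}.Finite := by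
  obtain ⟨ε, hε, O, hO, h⟩ := exists_nhds_gramMajorant_ge L.gram
    (z₀ := fun i => L.complexBasis.repr z₀ i) fun u hu => gramMajorant_pos hL hz hu
  have hcont : Continuous fun z : ℂ ⊗[ℚ] L.RatSpace => fun i => L.complexBasis.repr z i :=
    continuous_of_complex_linear L.complexBasis.equivFun.toLinearMap
  refine ⟨_, hcont.continuousAt hO, fun c => ?_⟩
  obtain ⟨M, hM, hint⟩ := L.exists_translate_le g
  -- The radius comes from `ε ‖w‖² ≤ majorant ≤ c`, with an `ε` uniform over the neighbourhood.
  have hfin := finite_bounded_of_isIntegral_multiple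
    (I := Module.Free.ChooseBasisIndex ℤ L) M hM (Real.sqrt (c / ε))
  refine (hfin.preimage (f := fun w : L.RatSpace => fun i => L.ratBasis.repr w i)
    (L.ratBasis.equivFun.injective.injOn)).subset ?_
  rintro w ⟨hw, z, hz, hle⟩
  refine ⟨hint w hw, ?_⟩
  have h1 := h _ hz fun i => (L.ratBasis.repr w i : ℝ)
  rw [majorant_eq_gramMajorant] at hle
  refine Real.le_sqrt_of_sq_le ?_
  rw [le_div_iff₀ hε, mul_comm]
  exact h1.trans hle

end EvenLattice

/-! ### The period domain as a quotient of the period vectors -/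

section PeriodTopology

variable {V W : Type*} [AddCommGroup V] [Module ℚ V] [AddCommGroup W] [Module ℚ W]
  {B : BilinForm ℚ V} {C : BilinForm ℚ W}

lemma IsPeriodVector.ne_zero {z : ℂ ⊗[ℚ] V} (h : IsPeriodVector B z) : z ≠ 0 := by
  rintro rfl
  simpa using h.2

/-- The point of the period domain given by a period vector. -/
noncomputable def PeriodDomain.mk (z : {z : ℂ ⊗[ℚ] V // IsPeriodVector B z}) : PeriodDomain B :=
  ⟨Projectivization.mk ℂ z.1 z.2.ne_zero, by
    obtain ⟨a, ha⟩ := Projectivization.exists_smul_eq_mk_rep ℂ z.1 z.2.ne_zero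
    rw [← ha]
    exact z.2.smul a.ne_zero⟩

namespace PeriodDomain

lemma mk_surjective : Function.Surjective (mk (B := B)) := fun σ =>
  ⟨⟨σ.1.rep, σ.2⟩, Subtype.ext σ.1.mk_rep⟩

lemma mk_eq_mk_iff {z w : {z : ℂ ⊗[ℚ] V // IsPeriodVector B z}} :
    mk z = mk w ↔ ∃ a : ℂ, a • w.1 = z.1 :=
  Subtype.ext_iff.trans (Projectivization.mk_eq_mk_iff' ℂ _ _ _ _)

lemma map_mk {f : V →ₗ[ℚ] W} (h : IsIsometricEmbedding B C f)
    (z : {z : ℂ ⊗[ℚ] V // IsPeriodVector B z}) :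
    map f h (mk z) = mk ⟨f.baseChange ℂ z.1, h.isPeriodVector z.2⟩ := rfl

lemma map_injective {f : V →ₗ[ℚ] W} (h : IsIsometricEmbedding B C f) :
    Function.Injective (map f h) := fun _ _ hστ =>
  Subtype.ext (Projectivization.map_injective _ (baseChange_injective h.injective)
    (congrArg Subtype.val hστ))

/-- This allows topological questions on the period domain to be settled on period vectors, in a
complex vector space. -/
lemma isQuotientMap_mk : IsQuotientMap (mk (B := B)) := by
  refine ⟨⟨TopologicalSpace.ext_iff.2 fun A => ?_⟩, mk_surjective⟩
  rw [isOpen_coinduced]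
  refine ⟨fun hA => ?_, fun hA => ?_⟩
  · obtain ⟨A', hA', rfl⟩ := (@isOpen_induced_iff _ _ (projectiveTopology V) _ _).1 hA
    have h1 : IsOpen ((fun v : {v : ℂ ⊗[ℚ] V // v ≠ 0} => Projectivization.mk' ℂ v) ⁻¹' A') := hA'
    have h2 : Continuous fun z : {z : ℂ ⊗[ℚ] V // IsPeriodVector B z} =>
        (⟨z.1, z.2.ne_zero⟩ : {v : ℂ ⊗[ℚ] V // v ≠ 0}) :=
      Continuous.subtype_mk continuous_subtype_val _
    exact h1.preimage h2
  · obtain ⟨O, hO, hOA⟩ := isOpen_induced_iff.1 hA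
    have hmem : ∀ z : {z : ℂ ⊗[ℚ] V // IsPeriodVector B z}, z.1 ∈ O ↔ mk z ∈ A := fun z =>
      Set.ext_iff.1 hOA z
    -- The trace of `O` on the period vectors is stable under nonzero scalars, but `O` itself need
    -- not be. Its saturation is stable, so it descends to projective space.
    let O' : Set (ℂ ⊗[ℚ] V) := ⋃ a : ℂˣ, (fun z => (a : ℂ) • z) ⁻¹' O
    have hO' : IsOpen O' := isOpen_iUnion fun a => hO.preimage (continuous_const_smul (a : ℂ))
    let A' : Set (ℙ ℂ (ℂ ⊗[ℚ] V)) := {σ | σ.rep ∈ O'}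
    have hrep : ∀ v : {v : ℂ ⊗[ℚ] V // v ≠ 0}, Projectivization.mk' ℂ v ∈ A' ↔ v.1 ∈ O' := by
      rintro ⟨v, hv⟩
      obtain ⟨a, ha⟩ := Projectivization.exists_smul_eq_mk_rep ℂ v hv
      change (Projectivization.mk ℂ v hv).rep ∈ O' ↔ _
      rw [← ha]
      simp only [O', Set.mem_iUnion, Set.mem_preimage, Units.smul_def, smul_smul]
      constructor
      · rintro ⟨b, hb⟩
        exact ⟨b * a, by simpa using hb⟩
      · rintro ⟨b, hb⟩
        exact ⟨b * a⁻¹, by simpa using hb⟩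
    refine (@isOpen_induced_iff _ _ (projectiveTopology V) _ _).2 ⟨A', ?_, ?_⟩
    · change IsOpen ((fun v : {v : ℂ ⊗[ℚ] V // v ≠ 0} => Projectivization.mk' ℂ v) ⁻¹' A')
      have : (fun v : {v : ℂ ⊗[ℚ] V // v ≠ 0} => Projectivization.mk' ℂ v) ⁻¹' A' =
          Subtype.val ⁻¹' O' := Set.ext hrep
      rw [this]
      exact hO'.preimage continuous_subtype_val
    · ext σ
      obtain ⟨z, rfl⟩ := mk_surjective σ
      change Projectivization.mk' ℂ ⟨z.1, z.2.ne_zero⟩ ∈ A' ↔ _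
      rw [hrep]
      simp only [O', Set.mem_iUnion, Set.mem_preimage]
      constructor
      · rintro ⟨a, ha⟩
        rw [hmem ⟨_, z.2.smul a.ne_zero⟩] at ha
        rwa [mk_eq_mk_iff.2 (⟨a, rfl⟩ : ∃ b : ℂ, b • z.1 = (a : ℂ) • z.1)] at ha
      · intro hz
        exact ⟨1, by simpa using (hmem z).2 hz⟩

lemma continuous_mk : Continuous (mk (B := B)) := isQuotientMap_mk.continuous

lemma continuous_map {f : V →ₗ[ℚ] W} (h : IsIsometricEmbedding B C f) : Continuous (map f h) := by
  refine isQuotientMap_mk.continuous_iff.2 ?_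
  have hc : Continuous fun z : {z : ℂ ⊗[ℚ] V // IsPeriodVector B z} =>
      (⟨f.baseChange ℂ z.1, h.isPeriodVector z.2⟩ : {z : ℂ ⊗[ℚ] W // IsPeriodVector C z}) :=
    Continuous.subtype_mk
      ((continuous_of_complex_linear (f.baseChange ℂ)).comp continuous_subtype_val) _
  exact continuous_mk.comp hc

instance : ContinuousConstSMul (orthogonalGroup B) (PeriodDomain B) :=
  ⟨fun q => continuous_map (isIsometricEmbedding_coe q)⟩

/-- The set of points of the period domain in the projective subspace `ℙ(E)`. -/
def locus (B : BilinForm ℚ V) (E : Submodule ℂ (ℂ ⊗[ℚ] V)) : Set (PeriodDomain B) :=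
  {σ | σ.1.rep ∈ E}

lemma mk_mem_locus {E : Submodule ℂ (ℂ ⊗[ℚ] V)} {z : {z : ℂ ⊗[ℚ] V // IsPeriodVector B z}} :
    mk z ∈ locus B E ↔ z.1 ∈ E := by
  obtain ⟨a, ha⟩ := Projectivization.exists_smul_eq_mk_rep ℂ z.1 z.2.ne_zero
  change (Projectivization.mk ℂ z.1 z.2.ne_zero).rep ∈ E ↔ _
  rw [← ha]
  exact E.smul_mem_iff a.ne_zero

lemma isClosed_locus (E : Submodule ℂ (ℂ ⊗[ℚ] V)) : IsClosed (locus B E) := by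
  rw [← isQuotientMap_mk.isClosed_preimage]
  have : mk (B := B) ⁻¹' locus B E =
      ⋂ φ ∈ E.dualAnnihilator, {z | φ z.1 = 0} := by
    ext z
    rw [Set.mem_preimage, mk_mem_locus]
    conv_lhs => rw [← Subspace.dualAnnihilator_dualCoannihilator_eq (W := E)]
    simp only [Submodule.mem_dualCoannihilator, Set.mem_iInter, Set.mem_ofPred_eq]
  rw [this]
  exact isClosed_biInter fun φ _ => isClosed_eq
    ((continuous_of_complex_linear φ).comp continuous_subtype_val) continuous_const

end PeriodDomain

end PeriodTopology

/-! ### Functions polynomial on lines -/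

section PolynomialOnLines

open Polynomial

variable {X : Type*} [AddCommGroup X] [Module ℂ X]

/-- A function on a complex vector space which is polynomial on all lines. -/
def PolynomialOnLines (f : X → ℂ) : Prop :=
  ∀ a b : X, ∃ p : ℂ[X], ∀ t : ℂ, f (a + t • b) = p.eval t

lemma PolynomialOnLines.linear (f : X →ₗ[ℂ] ℂ) : PolynomialOnLines f := fun a b =>
  ⟨.C (f a) + .X * .C (f b), fun t => by simp [mul_comm t]⟩

lemma PolynomialOnLines.quadratic (β : BilinForm ℂ X) : PolynomialOnLines fun w => β w w :=
  fun a b => ⟨.C (β a a) + .X * .C (β a b + β b a) + .X * .X * .C (β b b), fun t => by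
    simp
    ring⟩

lemma PolynomialOnLines.const (c : ℂ) : PolynomialOnLines fun _ : X => c :=
  fun _ _ => ⟨.C c, fun t => by simp⟩

lemma PolynomialOnLines.mul {f g : X → ℂ} (hf : PolynomialOnLines f) (hg : PolynomialOnLines g) :
    PolynomialOnLines fun w => f w * g w := fun a b => by
  obtain ⟨p, hp⟩ := hf a b
  obtain ⟨q, hq⟩ := hg a b
  exact ⟨p * q, fun t => by simp [hp, hq]⟩

lemma PolynomialOnLines.sub {f g : X → ℂ} (hf : PolynomialOnLines f) (hg : PolynomialOnLines g) :
    PolynomialOnLines fun w => f w - g w := fun a b => by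
  obtain ⟨p, hp⟩ := hf a b
  obtain ⟨q, hq⟩ := hg a b
  exact ⟨p - q, fun t => by simp [hp, hq]⟩

/-- On the line joining a point where `f` does not vanish to one where `g` does not, both restrict
to nonzero polynomials, and `ℂ[X]` is an infinite-field polynomial ring without zero divisors. -/
lemma PolynomialOnLines.exists_mul_ne_zero {f g : X → ℂ} (hf : PolynomialOnLines f)
    (hg : PolynomialOnLines g) (hf0 : ∃ a, f a ≠ 0) (hg0 : ∃ b, g b ≠ 0) :
    ∃ c, f c * g c ≠ 0 := by
  obtain ⟨a, ha⟩ := hf0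
  obtain ⟨b, hb⟩ := hg0
  obtain ⟨p, hp⟩ := hf a (b - a)
  obtain ⟨q, hq⟩ := hg a (b - a)
  have hp0 : p ≠ 0 := by
    rintro rfl
    simpa [ha] using hp 0
  have hq0 : q ≠ 0 := by
    rintro rfl
    simpa [hb] using hq 1
  by_contra! h
  refine mul_ne_zero hp0 hq0 (Polynomial.funext fun t => ?_)
  rw [eval_mul, ← hp, ← hq, h, eval_zero]

lemma PolynomialOnLines.exists_prod_ne_zero {J : Type*} (s : Finset J) {f : J → X → ℂ}
    (hf : ∀ j ∈ s, PolynomialOnLines (f j)) (hf0 : ∀ j ∈ s, ∃ a, f j a ≠ 0) :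
    PolynomialOnLines (fun w => ∏ j ∈ s, f j w) ∧ ∃ a, ∏ j ∈ s, f j a ≠ 0 := by
  classical
  induction s using Finset.induction_on with
  | empty => simpa using PolynomialOnLines.const (X := X) 1
  | insert j s hj ih =>
    obtain ⟨h1, h2⟩ := ih (fun i hi => hf i (Finset.mem_insert_of_mem hi))
      fun i hi => hf0 i (Finset.mem_insert_of_mem hi)
    have h3 := hf j (Finset.mem_insert_self j s)
    simp only [Finset.prod_insert hj]
    exact ⟨h3.mul h1, h3.exists_mul_ne_zero h1 (hf0 j (Finset.mem_insert_self j s)) h2⟩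

end PolynomialOnLines

/-! ### Avoiding finitely many linear sections -/

section Density

variable {V : Type*} [AddCommGroup V] [Module ℚ V] {B : BilinForm ℚ V}

lemma IsPeriodVector.form_conj_ne_zero {z : ℂ ⊗[ℚ] V} (h : IsPeriodVector B z) :
    B.baseChange ℂ z (conj V z) ≠ 0 := fun h0 => by
  have := h.2
  simp [h0] at this

/-- Up to a scalar, the reflection of an isotropic vector `z` in the vector `w`. -/
noncomputable def isotropicReflection (B : BilinForm ℚ V) (z w : ℂ ⊗[ℚ] V) : ℂ ⊗[ℚ] V :=
  B.baseChange ℂ w w • z - (2 * B.baseChange ℂ z w) • w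

lemma isotropicReflection_isotropic (hsymm : ∀ x y, B x y = B y x) {z : ℂ ⊗[ℚ] V}
    (hz : B.baseChange ℂ z z = 0) (w : ℂ ⊗[ℚ] V) :
    B.baseChange ℂ (isotropicReflection B z w) (isotropicReflection B z w) = 0 := by
  simp only [isotropicReflection, map_sub, map_smul, LinearMap.sub_apply, LinearMap.smul_apply,
    smul_eq_mul, hz, baseChange_symm hsymm w z]
  ring

lemma polynomialOnLines_isotropicReflection (z : ℂ ⊗[ℚ] V) (φ : (ℂ ⊗[ℚ] V) →ₗ[ℂ] ℂ) :
    PolynomialOnLines fun w => φ (isotropicReflection B z w) := by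
  have h := ((PolynomialOnLines.quadratic (B.baseChange ℂ)).mul (.const (φ z))).sub
    (((PolynomialOnLines.const 2).mul (.linear (B.baseChange ℂ z))).mul (.linear φ))
  simpa [isotropicReflection] using h

variable [Module.Finite ℚ V]

lemma baseChange_nondegenerate (hB : B.Nondegenerate) : (B.baseChange ℂ).Nondegenerate := by
  classical
  let b := Module.finBasis ℚ V
  have h := (LinearMap.BilinForm.nondegenerate_iff_det_ne_zero b).1 hB
  rw [LinearMap.BilinForm.nondegenerate_iff_det_ne_zero (b.baseChange ℂ)]
  have e : LinearMap.BilinForm.toMatrix (b.baseChange ℂ) (B.baseChange ℂ) =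
      (algebraMap ℚ ℂ).mapMatrix (LinearMap.BilinForm.toMatrix b B) := by
    ext i j
    simp [LinearMap.BilinForm.toMatrix_apply]
  rw [e, ← RingHom.map_det]
  simpa using h

/-- Otherwise, by polarization, `z^⊥` is totally isotropic. In dimension at least three it contains
a nonzero `w` orthogonal also to `z̄`. Since `z^⊥` and `z̄` span the space, `w` lies in the radical,
contradicting nondegeneracy. -/
lemma exists_orthogonal_ne_zero (hsymm : ∀ x y, B x y = B y x) (hB : B.Nondegenerate)
    (hV : 3 ≤ Module.finrank ℚ V) {z : ℂ ⊗[ℚ] V} (hz : IsPeriodVector B z) :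
    ∃ w, B.baseChange ℂ z w = 0 ∧ B.baseChange ℂ w w ≠ 0 := by
  set β := B.baseChange ℂ
  have hs : ∀ x y, β x y = β y x := baseChange_symm hsymm
  by_contra! h
  have hpol : ∀ x y, β z x = 0 → β z y = 0 → β x y = 0 := fun x y hx hy => by
    have h1 := h (x + y) (by rw [map_add, hx, hy, add_zero])
    simp only [map_add, LinearMap.add_apply, h x hx, h y hy, hs y x] at h1
    linear_combination h1 / 2
  have hker : LinearMap.ker ((β z).prod (β (conj V z))) ≠ ⊥ := by
    apply LinearMap.ker_ne_bot_of_finrank_lt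
    rw [Module.finrank_prod, Module.finrank_self, Module.finrank_baseChange]
    omega
  obtain ⟨w, hw, hw0⟩ := Submodule.exists_mem_ne_zero_of_ne_bot hker
  have hw1 : β z w = 0 := congrArg Prod.fst hw
  have hw2 : β (conj V z) w = 0 := congrArg Prod.snd hw
  refine hw0 ((baseChange_nondegenerate hB).1 w fun x => ?_)
  have hc := hz.form_conj_ne_zero
  have h3 : β z (x - (β z x / β z (conj V z)) • conj V z) = 0 := by
    rw [map_sub, map_smul, smul_eq_mul, div_mul_cancel₀ _ hc, sub_self]
  have h4 := hpol w _ hw1 h3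
  rwa [map_sub, map_smul, hs w (conj V z), hw2, smul_zero, sub_zero] at h4

lemma continuous_isotropicReflection (z : ℂ ⊗[ℚ] V) : Continuous (isotropicReflection B z) := by
  have h1 : Continuous fun w : ℂ ⊗[ℚ] V => B.baseChange ℂ w w :=
    continuous_baseChange_form_comp B continuous_id continuous_id
  have h2 := continuous_of_complex_linear (B.baseChange ℂ z)
  have h3 : Continuous fun w : ℂ ⊗[ℚ] V =>
      B.baseChange ℂ w w • z + (-(2 * B.baseChange ℂ z w)) • w :=
    (h1.smul continuous_const).add ((h2.const_mul 2).neg.smul continuous_id)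
  convert! h3 using 2 with w
  rw [isotropicReflection, neg_smul, sub_eq_add_neg]

/-- If `φ z ≠ 0`, an anisotropic `w` orthogonal to `z` works, as its reflection is `(w, w) z`. If `φ
z = 0`, the value is `-2 (z, w) φ(w)`, a product of nonzero linear forms. -/
lemma exists_isotropicReflection_ne_zero (hsymm : ∀ x y, B x y = B y x) (hB : B.Nondegenerate)
    (hV : 3 ≤ Module.finrank ℚ V) {z : ℂ ⊗[ℚ] V} (hz : IsPeriodVector B z)
    {φ : (ℂ ⊗[ℚ] V) →ₗ[ℂ] ℂ} (hφ : φ ≠ 0) : ∃ w, φ (isotropicReflection B z w) ≠ 0 := by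
  by_cases h0 : φ z = 0
  · have hβ : B.baseChange ℂ z ≠ 0 := fun h => hz.form_conj_ne_zero (by rw [h]; rfl)
    obtain ⟨w, hw⟩ := (PolynomialOnLines.linear (B.baseChange ℂ z)).exists_mul_ne_zero
      (.linear φ) (by
        by_contra! h
        exact hβ (LinearMap.ext h)) (by
        by_contra! h
        exact hφ (LinearMap.ext h))
    refine ⟨w, fun h => hw ?_⟩
    simp only [isotropicReflection, map_sub, map_smul, h0, smul_eq_mul, mul_zero] at h
    linear_combination -h / 2
  · obtain ⟨w, hw1, hw2⟩ := exists_orthogonal_ne_zero hsymm hB hV hz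
    refine ⟨w, ?_⟩
    simp [isotropicReflection, hw1, hw2, h0]

/-- A point of a period domain of positive dimension can be joined within any neighbourhood of it to
points outside a given finite union of proper projective subspaces. -/
lemma PeriodDomain.exists_preconnected_of_finite (hsymm : ∀ x y, B x y = B y x)
    (hB : B.Nondegenerate) (hV : 3 ≤ Module.finrank ℚ V) (σ : PeriodDomain B)
    {𝓔 : Set (Submodule ℂ (ℂ ⊗[ℚ] V))} (hfin : 𝓔.Finite) (hproper : ∀ E ∈ 𝓔, E ≠ ⊤)
    {O : Set (PeriodDomain B)} (hO : IsOpen O) (hσ : σ ∈ O) :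
    ∃ P : Set (PeriodDomain B), IsPreconnected P ∧ σ ∈ P ∧
      ∃ τ ∈ P, τ ∈ O ∧ ∀ E ∈ 𝓔, τ ∉ locus B E := by
  obtain ⟨z, rfl⟩ := mk_surjective σ
  have hfun : ∀ E : Submodule ℂ (ℂ ⊗[ℚ] V), ∃ φ : (ℂ ⊗[ℚ] V) →ₗ[ℂ] ℂ,
      E ≠ ⊤ → φ ≠ 0 ∧ E ≤ LinearMap.ker φ := fun E => by
    by_cases hE : E = ⊤
    · exact ⟨0, fun h => absurd hE h⟩
    · obtain ⟨φ, h1, h2⟩ := Submodule.exists_le_ker_of_lt_top E (lt_top_iff_ne_top.2 hE)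
      exact ⟨φ, fun _ => ⟨h1, h2⟩⟩
  choose φ hφ using hfun
  obtain ⟨w₀, hw₀, hw₀'⟩ := exists_orthogonal_ne_zero hsymm hB hV z.2
  obtain ⟨hF, w₁, hw₁⟩ := PolynomialOnLines.exists_prod_ne_zero hfin.toFinset
    (f := fun E w => φ E (isotropicReflection B z.1 w))
    (fun E _ => polynomialOnLines_isotropicReflection z.1 (φ E))
    (fun E hE => exists_isotropicReflection_ne_zero hsymm hB hV z.2
      (hφ E (hproper E (hfin.mem_toFinset.1 hE))).1)
  obtain ⟨p, hp⟩ := hF w₀ (w₁ - w₀)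
  have hp0 : p ≠ 0 := by
    rintro rfl
    have := hp 1
    rw [one_smul, add_sub_cancel, Polynomial.eval_zero] at this
    exact hw₁ this
  -- This path of isotropic vectors starts at a nonzero multiple of `z`, because `w₀` is orthogonal
  -- to `z` and anisotropic. Along it the product of the `φ E` is the polynomial `p`, which is
  -- nonzero because of its value at `t = 1`.
  let γ : ℝ → ℂ ⊗[ℚ] V := fun t => isotropicReflection B z.1 (w₀ + (t : ℂ) • (w₁ - w₀))
  have hγ : Continuous γ := by
    refine (continuous_isotropicReflection z.1).comp (continuous_const.add ?_)
    exact Complex.continuous_ofReal.smul continuous_const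
  have hγ0 : γ 0 = B.baseChange ℂ w₀ w₀ • z.1 := by
    simp [γ, isotropicReflection, hw₀]
  obtain ⟨O', hO', hOO'⟩ := isOpen_induced_iff.1 (hO.preimage continuous_mk)
  have hpos : ∀ᶠ t in 𝓝 (0 : ℝ), 0 < (B.baseChange ℂ (γ t) (conj V (γ t))).re := by
    have hc : Continuous fun t => (B.baseChange ℂ (γ t) (conj V (γ t))).re :=
      Complex.continuous_re.comp (continuous_baseChange_form_comp B hγ (continuous_conj.comp hγ))
    refine hc.continuousAt.eventually (lt_mem_nhds ?_)
    beta_reduce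
    rw [hγ0]
    exact (z.2.smul hw₀').2
  have hmemO : ∀ᶠ t in 𝓝 (0 : ℝ), γ t ∈ O' := by
    refine hγ.continuousAt.eventually (hO'.mem_nhds ?_)
    rw [hγ0]
    have h1 : (⟨_, z.2.smul hw₀'⟩ : {z : ℂ ⊗[ℚ] V // IsPeriodVector B z}) ∈
        mk (B := B) ⁻¹' O := by
      rw [Set.mem_preimage, mk_eq_mk_iff.2 ⟨B.baseChange ℂ w₀ w₀, rfl⟩]
      exact hσ
    rw [← hOO'] at h1
    exact h1
  obtain ⟨δ, hδ, hball⟩ := Metric.eventually_nhds_iff.1 (hpos.and hmemO)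
  have hroots : {t : ℝ | p.eval (t : ℂ) = 0}.Finite := by
    refine (p.roots.toFinset.finite_toSet.preimage
      (f := fun t : ℝ => (t : ℂ)) Complex.ofReal_injective.injOn).subset fun t ht => ?_
    simpa [hp0] using ht
  -- Before `δ` the path stays among period vectors and inside `O'`; `t` is chosen to miss the
  -- finitely many roots of `p`.
  obtain ⟨t, ht, htp⟩ := ((Set.Ioo_infinite hδ).sdiff hroots).nonempty
  have hper : ∀ s ∈ Set.Icc 0 t, IsPeriodVector B (γ s) := fun s hs =>
    ⟨isotropicReflection_isotropic hsymm z.2.1 _, (hball (by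
      rw [Real.dist_eq, sub_zero, abs_of_nonneg hs.1]
      exact hs.2.trans_lt ht.2)).1⟩
  let c : Set.Icc 0 t → PeriodDomain B := fun s => mk ⟨γ s, hper s s.2⟩
  have hc : Continuous c :=
    continuous_mk.comp (Continuous.subtype_mk (hγ.comp continuous_subtype_val) _)
  have : PreconnectedSpace (Set.Icc 0 t) := isPreconnected_iff_preconnectedSpace.1 isPreconnected_Icc
  have h0t : (0 : ℝ) ∈ Set.Icc 0 t := ⟨le_rfl, ht.1.le⟩
  have htt : t ∈ Set.Icc 0 t := ⟨ht.1.le, le_rfl⟩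
  refine ⟨Set.range c, isPreconnected_range hc, ⟨⟨0, h0t⟩, ?_⟩, c ⟨t, htt⟩, ⟨_, rfl⟩, ?_, ?_⟩
  · exact mk_eq_mk_iff.2 ⟨_, hγ0.symm⟩
  · have h1 : γ t ∈ O' := (hball (by
      rw [Real.dist_eq, sub_zero, abs_of_pos ht.1]
      exact ht.2)).2
    change (⟨γ t, hper t htt⟩ : {z : ℂ ⊗[ℚ] V // IsPeriodVector B z}) ∈ mk (B := B) ⁻¹' O
    rw [← hOO']
    exact h1
  · intro E hE hmem
    rw [mk_mem_locus] at hmem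
    refine htp ?_
    change p.eval (t : ℂ) = 0
    rw [← hp]
    exact Finset.prod_eq_zero (hfin.mem_toFinset.2 hE) ((hφ E (hproper E hE)).2 hmem)

end Density

/-! ### Period domains in dimension two -/

section Surface

variable {V : Type*} [AddCommGroup V] [Module ℚ V] {B : BilinForm ℚ V}

lemma baseChange_conj_self {z : ℂ ⊗[ℚ] V}
    (hz : IsPeriodVector B z) : B.baseChange ℂ (conj V z) (conj V z) = 0 := by
  rw [baseChange_conj, hz.1, map_zero]

lemma linearIndependent_conj (hsymm : ∀ x y, B x y = B y x) {z : ℂ ⊗[ℚ] V}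
    (hz : IsPeriodVector B z) : LinearIndependent ℂ ![z, conj V z] := by
  rw [LinearIndependent.pair_iff]
  intro s t h
  have hc := hz.form_conj_ne_zero
  have h1 := congrArg (B.baseChange ℂ z) h
  have h2 := congrArg (B.baseChange ℂ (conj V z)) h
  simp only [map_add, map_smul, hz.1, baseChange_conj_self hz, map_zero,
    baseChange_symm hsymm (conj V z) z, smul_eq_mul, mul_zero, zero_add, add_zero, mul_eq_zero,
    hc, or_false] at h1 h2
  exact ⟨h2, h1⟩

/-- In dimension two, a period vector and its conjugate span the complex quadratic space. -/
lemma exists_eq_smul_add_smul_conj (hsymm : ∀ x y, B x y = B y x)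
    (hV : Module.finrank ℚ V = 2) {z : ℂ ⊗[ℚ] V} (hz : IsPeriodVector B z) (w : ℂ ⊗[ℚ] V) :
    ∃ s t : ℂ, w = s • z + t • conj V z := by
  have hspan := (linearIndependent_conj hsymm hz).span_eq_top_of_card_eq_finrank
    (by rw [Module.finrank_baseChange, hV]; simp)
  have hw : w ∈ Submodule.span ℂ (Set.range ![z, conj V z]) := hspan ▸ Submodule.mem_top
  simp only [Matrix.range_cons, Matrix.range_empty, Set.union_empty, Set.singleton_union] at hw
  obtain ⟨s, t, h⟩ := Submodule.mem_span_pair.1 hw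
  exact ⟨s, t, h.symm⟩

/-- The norm of `s z + t z̄` is `2 s t (z, z̄)`, so isotropy forces `s t = 0`. -/
lemma PeriodDomain.eq_or_eq_conj (hsymm : ∀ x y, B x y = B y x)
    (hV : Module.finrank ℚ V = 2) (z w : {z : ℂ ⊗[ℚ] V // IsPeriodVector B z}) :
    mk w = mk z ∨ ∃ t : ℂ, t • conj V z.1 = w.1 := by
  obtain ⟨s, t, h⟩ := exists_eq_smul_add_smul_conj hsymm hV z.2 w.1
  have h1 := w.2.1
  rw [h] at h1
  simp only [map_add, map_smul, LinearMap.add_apply, LinearMap.smul_apply, z.2.1,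
    baseChange_conj_self z.2, baseChange_symm hsymm (conj V z.1) z.1, smul_eq_mul, mul_zero,
    zero_add, add_zero] at h1
  have h2 : s * t = 0 := by
    have : s * t * B.baseChange ℂ z.1 (conj V z.1) = 0 := by linear_combination h1 / 2
    simpa [z.2.form_conj_ne_zero] using this
  rcases mul_eq_zero.1 h2 with rfl | rfl
  · exact Or.inr ⟨t, by rw [h]; simp⟩
  · exact Or.inl (mk_eq_mk_iff.2 ⟨s, by rw [h]; simp⟩)

/-- In dimension two, an isometry which fixes one point of the period domain fixes all points. -/
lemma PeriodDomain.smul_eq_of_smul_eq (hsymm : ∀ x y, B x y = B y x)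
    (hV : Module.finrank ℚ V = 2) {q : orthogonalGroup B} {σ : PeriodDomain B} (hσ : q • σ = σ)
    (τ : PeriodDomain B) : q • τ = τ := by
  obtain ⟨z, rfl⟩ := mk_surjective σ
  obtain ⟨w, rfl⟩ := mk_surjective τ
  rcases eq_or_eq_conj hsymm hV z w with h | ⟨t, ht⟩
  · rw [h, hσ]
  · rw [smul_def, map_mk, mk_eq_mk_iff] at hσ ⊢
    obtain ⟨a, ha⟩ := hσ
    refine ⟨starRingEnd ℂ a, ?_⟩
    simp only at ha ⊢
    rw [← ht, map_smul, ← conj_baseChange, ← ha, conj_smul, smul_comm]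

end Surface

/-! ### Isometries and majorants -/

section PeriodTopology

variable {V W : Type*} [AddCommGroup V] [Module ℚ V] [AddCommGroup W] [Module ℚ W]
  {B : BilinForm ℚ V} {C : BilinForm ℚ W}

lemma PeriodDomain.isOpenMap_mk : IsOpenMap (mk (B := B)) := fun A hA => by
  rw [← isQuotientMap_mk.isOpen_preimage]
  have e : mk ⁻¹' (mk '' A) = ⋃ a : ℂˣ,
      (fun z : {z : ℂ ⊗[ℚ] V // IsPeriodVector B z} =>
        (⟨(a : ℂ) • z.1, z.2.smul a.ne_zero⟩ : {z // IsPeriodVector B z})) ⁻¹' A := by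
    ext z
    simp only [Set.mem_preimage, Set.mem_image, Set.mem_iUnion]
    constructor
    · rintro ⟨w, hw, h⟩
      obtain ⟨a, ha⟩ := mk_eq_mk_iff.1 h
      have ha0 : a ≠ 0 := by
        rintro rfl
        exact w.2.ne_zero (by rw [← ha, zero_smul])
      refine ⟨Units.mk0 a ha0, ?_⟩
      convert! hw using 1
      exact Subtype.ext ha
    · rintro ⟨a, ha⟩
      exact ⟨_, ha, mk_eq_mk_iff.2 ⟨a, rfl⟩⟩
  rw [e]
  refine isOpen_iUnion fun a => hA.preimage (Continuous.subtype_mk ?_ _)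
  exact continuous_subtype_val.const_smul (a : ℂ)

lemma baseChange_isometry {f : V →ₗ[ℚ] W}
    (hf : IsIsometricEmbedding B C f) (z w : ℂ ⊗[ℚ] V) :
    C.baseChange ℂ (f.baseChange ℂ z) (f.baseChange ℂ w) = B.baseChange ℂ z w := by
  have e : (C.baseChange ℂ).compl₁₂ (f.baseChange ℂ) (f.baseChange ℂ) = B.baseChange ℂ := by
    ext x y
    simp [hf.isometry]
  exact LinearMap.congr_fun₂ e z w

lemma majorant_map {f : V →ₗ[ℚ] W} (hf : IsIsometricEmbedding B C f) (z : ℂ ⊗[ℚ] V) (x : V) :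
    majorant C (f.baseChange ℂ z) (f x) = majorant B z x := by
  rw [majorant, majorant, conj_baseChange, ← LinearMap.baseChange_tmul, baseChange_isometry hf,
    baseChange_isometry hf, hf.isometry]

/-- An isometry which fixes a point of the period domain preserves the majorant at this point. -/
lemma majorant_apply_of_eigenvector {q : orthogonalGroup B} {z : ℂ ⊗[ℚ] V}
    (hz : IsPeriodVector B z) {a : ℂ} (ha : (q.1 : V →ₗ[ℚ] V).baseChange ℂ z = a • z) (x : V) :
    majorant B z (q.1 x) = majorant B z x := by
  have hf := isIsometricEmbedding_coe q
  -- The isometry preserves the nonzero number `(z, z̄)`, and it also multiplies it by `|a|²`.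
  have h1 : Complex.normSq a = 1 := by
    have h := baseChange_isometry hf z (conj V z)
    rw [← conj_baseChange, ha, conj_smul, map_smul, map_smul, LinearMap.smul_apply, smul_smul,
      ← Complex.normSq_eq_conj_mul_self, smul_eq_mul] at h
    have h2 : (Complex.normSq a : ℂ) = 1 := by
      have h0 : B.baseChange ℂ z (conj V z) ≠ 0 := hz.form_conj_ne_zero
      exact (mul_eq_right₀ h0).1 h
    exact_mod_cast h2
  have h3 := baseChange_isometry hf z (1 ⊗ₜ x)
  rw [ha, LinearMap.baseChange_tmul, map_smul, LinearMap.smul_apply, smul_eq_mul] at h3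
  have h4 := congrArg Complex.normSq h3
  rw [Complex.normSq_mul, h1, one_mul] at h4
  rw [majorant, majorant, q.2]
  exact congrArg (fun t => 4 * t - _) h4

lemma continuous_majorant [Module.Finite ℚ V] (x : V) : Continuous fun z => majorant B z x := by
  have h1 : Continuous fun z : ℂ ⊗[ℚ] V => B.baseChange ℂ z (1 ⊗ₜ x) :=
    continuous_baseChange_form_comp B continuous_id continuous_const
  have h2 : Continuous fun z : ℂ ⊗[ℚ] V => B.baseChange ℂ z (conj V z) :=
    continuous_baseChange_form_comp B continuous_id continuous_conj
  exact ((Complex.continuous_normSq.comp h1).const_mul 4).sub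
    ((Complex.continuous_re.comp h2).mul_const _)

end PeriodTopology

/-! ### Isometries preserving the sublattice -/

namespace PrimitiveEmbedding

variable {T : EvenLattice.{u}} {S : EvenLattice.{v}} (ι : PrimitiveEmbedding T S)

/-- The orthogonal complement of `T_ℚ` in `S_ℚ`. -/
noncomputable abbrev complement : Submodule ℚ S.RatSpace := LinearMap.ker ι.proj

variable {ι}

lemma ratForm_incl_eq_zero {w : S.RatSpace} (hw : w ∈ ι.complement) (x : T.RatSpace) :
    S.ratForm w (ι.rat x) = 0 := by
  rw [← ι.proj_adjoint, LinearMap.mem_ker.1 hw, map_zero, LinearMap.zero_apply]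

lemma sub_proj_mem_complement (w : S.RatSpace) : w - ι.rat (ι.proj w) ∈ ι.complement := by
  rw [LinearMap.mem_ker, map_sub, ι.isOrthogonalSummand.proj_incl, sub_self]

lemma mem_complement_iff {w : S.RatSpace} :
    w ∈ ι.complement ↔ ∀ x, S.ratForm w (ι.rat x) = 0 :=
  ⟨ratForm_incl_eq_zero, fun h => T.ratForm_nondegenerate.1 _ fun x => by rw [ι.proj_adjoint, h]⟩

variable (ι) in
/-- Pairs of an isometry of `T_ℚ` and an isometry of `S_ℚ` in `Γ` which extends it. -/
def compatiblePairs (Γ : Subgroup S.ORat) : Subgroup (T.ORat × S.ORat) where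
  carrier := {p | p.2 ∈ Γ ∧ ∀ x, p.2.1 (ι.rat x) = ι.rat (p.1.1 x)}
  one_mem' := ⟨one_mem Γ, fun _ => rfl⟩
  mul_mem' := fun {a b} ha hb => ⟨mul_mem ha.1 hb.1, fun x =>
    (congrArg a.2.1 (hb.2 x)).trans (ha.2 _)⟩
  inv_mem' := fun {a} ha => ⟨inv_mem ha.1, fun x => by
    refine (LinearEquiv.symm_apply_eq a.2.1).2 ?_
    refine Eq.trans ?_ (ha.2 _).symm
    exact congrArg ι.rat (a.1.1.apply_symm_apply x).symm⟩

/-- An isometry of `S_ℚ` which preserves the orthogonal complement of `T_ℚ` restricts to an isometry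
of `T_ℚ`. -/
lemma exists_restriction {q : S.ORat}
    (hq : ∀ w ∈ ι.complement, (q⁻¹).1 w ∈ ι.complement) :
    ∃ h : T.ORat, ∀ x, q.1 (ι.rat x) = ι.rat (h.1 x) := by
  have hinv : ∀ w, q.1 ((q⁻¹).1 w) = w := fun w => q.1.apply_symm_apply w
  -- The complement component of `q x` is orthogonal to `T_ℚ`. It is also orthogonal to every `w'`
  -- in the complement, since `(q x, w') = (x, q⁻¹ w') = 0`. So it vanishes by nondegeneracy.
  have h1 : ∀ x, q.1 (ι.rat x) = ι.rat (ι.proj (q.1 (ι.rat x))) := fun x => by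
    refine sub_eq_zero.1 (S.ratForm_nondegenerate.1 _ fun w => ?_)
    have hd := sub_proj_mem_complement (ι := ι) (q.1 (ι.rat x))
    obtain ⟨w', hw, e⟩ : ∃ w' ∈ ι.complement, w = ι.rat (ι.proj w) + w' :=
      ⟨_, sub_proj_mem_complement w, by abel⟩
    have h2 := q.2 (ι.rat x) ((q⁻¹).1 w')
    rw [hinv, S.ratForm_symm (ι.rat x), ratForm_incl_eq_zero (hq _ hw)] at h2
    rw [e, map_add, ratForm_incl_eq_zero hd, zero_add, map_sub, LinearMap.sub_apply, h2,
      S.ratForm_symm, ratForm_incl_eq_zero hw, sub_zero]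
  let f : T.RatSpace →ₗ[ℚ] T.RatSpace := ι.proj ∘ₗ (q.1 : S.RatSpace →ₗ[ℚ] S.RatSpace) ∘ₗ ι.rat
  have hf : ∀ x, q.1 (ι.rat x) = ι.rat (f x) := h1
  have hinj : Function.Injective f := fun x y hxy => by
    refine ι.rat_isIsometricEmbedding.injective (q.1.injective ?_)
    rw [hf, hf, hxy]
  refine ⟨⟨LinearEquiv.ofInjectiveEndo f hinj, fun x y => ?_⟩, fun x => ?_⟩
  · change T.ratForm (f x) (f y) = _
    rw [← ι.rat_isometry, ← hf, ← hf, q.2, ι.rat_isometry]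
  · exact hf x

/-- The hyperplane of vectors of `T_ℂ` orthogonal to a vector of `T_ℚ`. -/
noncomputable def _root_.OrthogonalModuli.EvenLattice.hyperplane (T : EvenLattice.{u})
    (x : T.RatSpace) : Submodule ℂ (ℂ ⊗[ℚ] T.RatSpace) :=
  LinearMap.ker ((T.ratForm.baseChange ℂ).flip (1 ⊗ₜ x))

lemma mem_hyperplane {x : T.RatSpace} {z : ℂ ⊗[ℚ] T.RatSpace} :
    z ∈ T.hyperplane x ↔ T.ratForm.baseChange ℂ z (1 ⊗ₜ x) = 0 := Iff.rfl

lemma hyperplane_ne_top {x : T.RatSpace} (hx : x ≠ 0) : T.hyperplane x ≠ ⊤ := fun h => by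
  refine hx (T.ratForm_nondegenerate.1 _ fun y => ?_)
  have hy : (1 : ℂ) ⊗ₜ[ℚ] y ∈ T.hyperplane x := h ▸ Submodule.mem_top
  rw [mem_hyperplane] at hy
  rw [T.ratForm_symm]
  simpa using hy

lemma complexForm_incl (z : ℂ ⊗[ℚ] T.RatSpace) (w : S.RatSpace) :
    S.ratForm.baseChange ℂ (ι.rat.baseChange ℂ z) (1 ⊗ₜ w) =
      T.ratForm.baseChange ℂ z (1 ⊗ₜ ι.proj w) := by
  induction z with
  | zero => simp
  | add x y hx hy => simp only [map_add, LinearMap.add_apply, hx, hy]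
  | tmul a x => simp [ι.isOrthogonalSummand.adjoint']

end PrimitiveEmbedding

lemma EvenLattice.exists_spanning_translate (L : EvenLattice.{u}) (g : L.OAdele)
    (N : Submodule ℚ L.RatSpace) : ∃ (k : ℕ) (v : Fin k → L.RatSpace),
      (∀ j, v j ∈ N ∧ v j ∈ L.translate g) ∧ Submodule.span ℚ (Set.range v) = N := by
  let b := Module.finBasis ℚ N
  choose M hM h using fun j => L.exists_zsmul_mem_translate g (b j : L.RatSpace)
  have hN : ∀ j, M j • (b j : L.RatSpace) ∈ N := fun j => zsmul_mem (b j).2 (M j)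
  refine ⟨_, fun j => M j • (b j : L.RatSpace), fun j => ⟨hN j, h j⟩, le_antisymm ?_ ?_⟩
  · rw [Submodule.span_le]
    rintro _ ⟨j, rfl⟩
    exact hN j
  · intro w hw
    have e : w = ∑ j, (b.repr ⟨w, hw⟩ j / (M j : ℚ)) • (M j • (b j : L.RatSpace)) := by
      have e1 := congrArg N.subtype (b.sum_repr ⟨w, hw⟩)
      rw [map_sum] at e1
      refine e1.symm.trans (Finset.sum_congr rfl fun j _ => ?_)
      have : (M j : ℚ) ≠ 0 := by exact_mod_cast hM j
      rw [← Int.cast_smul_eq_zsmul ℚ, smul_smul, div_mul_cancel₀ _ this]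
      rfl
    rw [e]
    exact sum_mem fun j _ => Submodule.smul_mem _ _ (Submodule.subset_span ⟨j, rfl⟩)

/-! ### Generic points of the period domain -/

namespace PrimitiveEmbedding

variable {T : EvenLattice.{u}} {S : EvenLattice.{v}} {ι : PrimitiveEmbedding T S}

variable (ι) in
/-- The hyperplanes orthogonal to lattice vectors of norm at least `-c` not orthogonal to `T`. -/
def specialHyperplanes (g : S.OAdele) (c : ℝ) : Set (Submodule ℂ (ℂ ⊗[ℚ] T.RatSpace)) :=
  {E | ∃ w ∈ S.translate g, ι.proj w ≠ 0 ∧ -(S.ratForm w w : ℝ) ≤ c ∧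
    E = T.hyperplane (ι.proj w)}

variable (ι) in
/-- The proper eigenspaces of isometries of `T_ℚ` which extend to an element of `Γ`. -/
def specialEigenspaces (Γ : Subgroup S.ORat) : Set (Submodule ℂ (ℂ ⊗[ℚ] T.RatSpace)) :=
  {E | E ≠ ⊤ ∧ ∃ p ∈ ι.compatiblePairs Γ, ∃ a : ℂ,
    E = Module.End.eigenspace ((p.1.1 : T.RatSpace →ₗ[ℚ] T.RatSpace).baseChange ℂ) a}

/-- If a period vector `y` of `T` is orthogonal to the projection of `w`, its image in `S_ℂ` is
orthogonal to `w`, and the majorant of `w` there is `-(y, ȳ) (w, w)`. Both factors are bounded above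
near `σ`, so only finitely many lattice vectors `w` occur. -/
lemma finite_specialHyperplanes_inter {n : ℕ} (hS : S.HasSignature 2 n) (g : S.OAdele) (c : ℝ)
    (σ : PeriodDomain T.ratForm) : ∃ O : Set (PeriodDomain T.ratForm), IsOpen O ∧ σ ∈ O ∧
      {E ∈ ι.specialHyperplanes g c | (PeriodDomain.locus T.ratForm E ∩ O).Nonempty}.Finite := by
  obtain ⟨z, rfl⟩ := PeriodDomain.mk_surjective σ
  obtain ⟨O, hO, hfin⟩ := EvenLattice.exists_nhds_finite_majorant_le hS g
    (ι.rat_isIsometricEmbedding.isPeriodVector z.2)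
  obtain ⟨O₁, hO₁, hO₁', hz⟩ := mem_nhds_iff.1 hO
  have hc1 : Continuous fun z : {z // IsPeriodVector T.ratForm z} => ι.rat.baseChange ℂ z.1 :=
    (continuous_of_complex_linear (ι.rat.baseChange ℂ)).comp continuous_subtype_val
  have hc2 : Continuous fun z : {z // IsPeriodVector T.ratForm z} =>
      (T.ratForm.baseChange ℂ z.1 (conj _ z.1)).re :=
    Complex.continuous_re.comp (continuous_baseChange_form_comp _ continuous_subtype_val
      (continuous_conj.comp continuous_subtype_val))
  set K := (T.ratForm.baseChange ℂ z.1 (conj _ z.1)).re + 1 with hK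
  let A : Set {z // IsPeriodVector T.ratForm z} :=
    {z | ι.rat.baseChange ℂ z.1 ∈ O₁ ∧ (T.ratForm.baseChange ℂ z.1 (conj _ z.1)).re < K}
  have hA : IsOpen A := (hO₁'.preimage hc1).inter (isOpen_lt hc2 continuous_const)
  refine ⟨_, PeriodDomain.isOpenMap_mk A hA, ⟨z, ⟨hz, by rw [hK]; linarith⟩, rfl⟩, ?_⟩
  -- The maximum with `0` makes the product of the two upper bounds valid when `c` is negative.
  refine ((hfin (K * max c 0)).image fun w => T.hyperplane (ι.proj w)).subset ?_
  rintro E ⟨⟨w, hw, -, hwc, rfl⟩, τ, hτ, y, ⟨hyO, hyK⟩, rfl⟩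
  refine ⟨w, ⟨hw, _, hO₁ hyO, ?_⟩, rfl⟩
  rw [PeriodDomain.mk_mem_locus, mem_hyperplane, ← complexForm_incl] at hτ
  rw [majorant, hτ, map_zero, mul_zero, zero_sub, ← mul_neg, conj_baseChange,
    baseChange_isometry ι.rat_isIsometricEmbedding]
  exact mul_le_mul_of_nonneg hyK.le (hwc.trans (le_max_left _ _)) y.2.2.le (le_max_right _ _)

/-- An isometry with eigenvector `y` preserves the majorant at `y`. It therefore sends a fixed
finite spanning set of lattice vectors to lattice vectors of bounded majorant, of which there are
finitely many. These images determine the isometry, and each isometry has finitely many eigenvalues.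
-/
lemma finite_specialEigenspaces_inter {n : ℕ} (hS : S.HasSignature 2 n) {g : S.OAdele}
    {Γ : Subgroup S.ORat} (hΓ : ∀ q ∈ Γ, ∀ w, w ∈ S.translate g → q.1 w ∈ S.translate g)
    (σ : PeriodDomain T.ratForm) : ∃ O : Set (PeriodDomain T.ratForm), IsOpen O ∧ σ ∈ O ∧
      {E ∈ ι.specialEigenspaces Γ | (PeriodDomain.locus T.ratForm E ∩ O).Nonempty}.Finite := by
  obtain ⟨z, rfl⟩ := PeriodDomain.mk_surjective σ
  obtain ⟨O, hO, hfin⟩ := EvenLattice.exists_nhds_finite_majorant_le hS g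
    (ι.rat_isIsometricEmbedding.isPeriodVector z.2)
  obtain ⟨O₁, hO₁, hO₁', hz⟩ := mem_nhds_iff.1 hO
  obtain ⟨k, v, hv, hspan⟩ := S.exists_spanning_translate g (LinearMap.range ι.rat)
  choose t ht using fun j => (hv j).1
  have htspan : Submodule.span ℚ (Set.range t) = ⊤ := by
    refine Submodule.map_injective_of_injective ι.rat_isIsometricEmbedding.injective ?_
    rw [Submodule.map_span, ← Set.range_comp, Submodule.map_top, ← hspan]
    congr 2
    exact funext ht
  have hc1 : Continuous fun z : {z // IsPeriodVector T.ratForm z} => ι.rat.baseChange ℂ z.1 :=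
    (continuous_of_complex_linear (ι.rat.baseChange ℂ)).comp continuous_subtype_val
  let K : Fin k → ℝ := fun j => majorant T.ratForm z.1 (t j) + 1
  let A : Set {z // IsPeriodVector T.ratForm z} :=
    {z | ι.rat.baseChange ℂ z.1 ∈ O₁} ∩ ⋂ j, {z | majorant T.ratForm z.1 (t j) < K j}
  have hA : IsOpen A := (hO₁'.preimage hc1).inter (isOpen_iInter_of_finite fun j =>
    isOpen_lt ((continuous_majorant (t j)).comp continuous_subtype_val) continuous_const)
  refine ⟨_, PeriodDomain.isOpenMap_mk A hA, ⟨z, ⟨hz, Set.mem_iInter.2 fun j => ?_⟩, rfl⟩, ?_⟩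
  · exact lt_add_one (majorant T.ratForm z.1 (t j))
  let H : Set T.ORat := {h | ∀ j, ι.rat (h.1 (t j)) ∈
    {w | w ∈ S.translate g ∧ ∃ z ∈ O, majorant S.ratForm z w ≤ K j}}
  have hH : H.Finite := by
    refine ((Set.Finite.pi' fun j => hfin (K j)).preimage
      (f := fun (h : T.ORat) (j : Fin k) => ι.rat (h.1 (t j))) ?_).subset fun h hh => hh
    intro h _ h' _ hhh
    refine Subtype.ext (LinearEquiv.toLinearMap_injective ?_)
    refine LinearMap.ext_on_range htspan fun j => ?_
    exact ι.rat_isIsometricEmbedding.injective (congrFun hhh j)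
  refine (hH.biUnion (t := fun h => Module.End.eigenspace
    ((h.1 : T.RatSpace →ₗ[ℚ] T.RatSpace).baseChange ℂ) '' {a | Module.End.HasEigenvalue
      ((h.1 : T.RatSpace →ₗ[ℚ] T.RatSpace).baseChange ℂ) a}) fun h _ =>
    (Module.End.finite_hasEigenvalue _).image _).subset ?_
  rintro E ⟨⟨-, p, hp, a, rfl⟩, τ, hτ, y, ⟨hyO, hyK⟩, rfl⟩
  rw [PeriodDomain.mk_mem_locus] at hτ
  refine Set.mem_biUnion (x := p.1) (fun j => ⟨?_, _, hO₁ hyO, ?_⟩) ⟨a, ?_, rfl⟩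
  · rw [← hp.2, ht]
    exact hΓ _ hp.1 _ (hv j).2
  · rw [majorant_map ι.rat_isIsometricEmbedding,
      majorant_apply_of_eigenvector y.2 (Module.End.mem_eigenspace_iff.1 hτ)]
    exact (Set.mem_iInter.1 hyK j).le
  · exact Module.End.hasEigenvalue_of_hasEigenvector ⟨hτ, y.2.ne_zero⟩

variable (ι) in
/-- Points of the period domain at which only the isometries in `Γ` which preserve `T_ℚ` identify
the point with other points of `D_T`, and have no isotropy but the generic one. -/
def IsGeneric (Γ : Subgroup S.ORat) (σ : PeriodDomain T.ratForm) : Prop :=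
  (∀ q ∈ Γ, ∀ τ, ι.period τ = q • ι.period σ → ∃ h, (h, q) ∈ ι.compatiblePairs Γ) ∧
    ∀ p ∈ ι.compatiblePairs Γ, p.1 • σ = σ → ∀ τ : PeriodDomain T.ratForm, p.1 • τ = τ

lemma smul_mk {V : Type*} [AddCommGroup V] [Module ℚ V] {B : BilinForm ℚ V}
    (q : orthogonalGroup B) (z : {z : ℂ ⊗[ℚ] V // IsPeriodVector B z}) :
    q • PeriodDomain.mk z = PeriodDomain.mk ⟨(q.1 : V →ₗ[ℚ] V).baseChange ℂ z.1,
      (isIsometricEmbedding_coe q).isPeriodVector z.2⟩ := rfl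

/-- Lattice vectors `v j` spanning the complement are orthogonal to the image of `τ`, so the `q⁻¹ (v
j)` are lattice vectors of the same norms orthogonal to the image of `σ`. Were one of them outside
the complement, `σ` would lie on a special hyperplane. Hence `q⁻¹` preserves the complement, and `q`
restricts to `T_ℚ`. -/
lemma exists_compatiblePair_of_notMem {g : S.OAdele} {Γ : Subgroup S.ORat}
    (hΓ : ∀ q ∈ Γ, ∀ w, w ∈ S.translate g → q.1 w ∈ S.translate g) :
    ∃ c, ∀ σ : PeriodDomain T.ratForm,
      (∀ E ∈ ι.specialHyperplanes g c, σ ∉ PeriodDomain.locus T.ratForm E) →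
      ∀ q ∈ Γ, ∀ τ, ι.period τ = q • ι.period σ → ∃ h, (h, q) ∈ ι.compatiblePairs Γ := by
  obtain ⟨k, v, hv, hspan⟩ := S.exists_spanning_translate g ι.complement
  -- Any common bound for the norms of the `v j` serves; what matters is that it does not depend on
  -- `σ`, `q` or `τ`.
  refine ⟨∑ j, |(S.ratForm (v j) (v j) : ℝ)|, fun σ hσ q hq τ hτ => ?_⟩
  obtain ⟨z, rfl⟩ := PeriodDomain.mk_surjective σ
  obtain ⟨y, rfl⟩ := PeriodDomain.mk_surjective τ
  rw [period, PeriodDomain.map_mk, PeriodDomain.map_mk, smul_mk, PeriodDomain.mk_eq_mk_iff] at hτ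
  obtain ⟨a, ha⟩ := hτ
  simp only at ha
  have hinv : ∀ w, q.1 ((q⁻¹).1 w) = w := fun w => q.1.apply_symm_apply w
  have hnorm : ∀ w, S.ratForm ((q⁻¹).1 w) ((q⁻¹).1 w) = S.ratForm w w := fun w => (q⁻¹).2 w w
  have ha0 : a ≠ 0 := by
    rintro rfl
    rw [zero_smul] at ha
    exact (ι.rat_isIsometricEmbedding.isPeriodVector y.2).ne_zero ha.symm
  have hmem : ∀ j, (q⁻¹).1 (v j) ∈ ι.complement := fun j => by
    by_contra hne
    refine hσ _ ⟨_, hΓ _ (inv_mem hq) _ (hv j).2, hne, ?_, rfl⟩ ?_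
    · rw [hnorm]
      exact (neg_le_abs _).trans (Finset.single_le_sum
        (f := fun j => |(S.ratForm (v j) (v j) : ℝ)|) (fun _ _ => abs_nonneg _) (Finset.mem_univ j))
    · rw [PeriodDomain.mk_mem_locus, mem_hyperplane, ← complexForm_incl]
      have h1 := complexForm_incl (ι := ι) y.1 (v j)
      rw [LinearMap.mem_ker.1 (hv j).1, TensorProduct.tmul_zero, map_zero, ← ha, map_smul,
        LinearMap.smul_apply, smul_eq_mul, mul_eq_zero, or_iff_right ha0] at h1
      rw [← h1, ← baseChange_isometry (isIsometricEmbedding_coe q), LinearMap.baseChange_tmul]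
      exact congrArg (fun w => S.ratForm.baseChange ℂ _ ((1 : ℂ) ⊗ₜ[ℚ] w)) (hinv (v j))
  obtain ⟨h, hh⟩ := exists_restriction (ι := ι) (q := q) fun w hw => by
    have : ι.complement ≤ ι.complement.comap ((q⁻¹).1 : S.RatSpace →ₗ[ℚ] S.RatSpace) := by
      conv_lhs => rw [← hspan]
      rw [Submodule.span_le]
      rintro _ ⟨j, rfl⟩
      exact hmem j
    exact this hw
  exact ⟨h, hq, hh⟩

/-- The eigenspace through `σ` is not proper, so `p.1` acts on `T_ℂ` as a scalar. -/
lemma smul_eq_of_notMem_specialEigenspaces {Γ : Subgroup S.ORat} {σ : PeriodDomain T.ratForm}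
    (hσ : ∀ E ∈ ι.specialEigenspaces Γ, σ ∉ PeriodDomain.locus T.ratForm E)
    {p : T.ORat × S.ORat} (hp : p ∈ ι.compatiblePairs Γ) (hpσ : p.1 • σ = σ)
    (τ : PeriodDomain T.ratForm) : p.1 • τ = τ := by
  obtain ⟨z, rfl⟩ := PeriodDomain.mk_surjective σ
  rw [smul_mk, PeriodDomain.mk_eq_mk_iff] at hpσ
  obtain ⟨a, ha⟩ := hpσ
  have htop : Module.End.eigenspace ((p.1.1 : T.RatSpace →ₗ[ℚ] T.RatSpace).baseChange ℂ) a = ⊤ := by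
    by_contra hne
    refine hσ _ ⟨hne, p, hp, a, rfl⟩ ?_
    rw [PeriodDomain.mk_mem_locus, Module.End.mem_eigenspace_iff]
    exact ha.symm
  obtain ⟨y, rfl⟩ := PeriodDomain.mk_surjective τ
  rw [smul_mk, PeriodDomain.mk_eq_mk_iff]
  refine ⟨a, ?_⟩
  have hy : y.1 ∈ Module.End.eigenspace
      ((p.1.1 : T.RatSpace →ₗ[ℚ] T.RatSpace).baseChange ℂ) a := htop ▸ Submodule.mem_top
  exact (Module.End.mem_eigenspace_iff.1 hy).symm

/-- The generic points contain an open set which meets every neighbourhood of every point `σ` in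
the connected component of `σ`. -/
theorem exists_isOpen_isGeneric {n : ℕ} (hS : S.HasSignature 2 n) {g : S.OAdele}
    {Γ : Subgroup S.ORat} (hΓ : ∀ q ∈ Γ, ∀ w, w ∈ S.translate g → q.1 w ∈ S.translate g) :
    ∃ U : Set (PeriodDomain T.ratForm), IsOpen U ∧ (∀ σ ∈ U, ι.IsGeneric Γ σ) ∧
      ∀ (σ : PeriodDomain T.ratForm) (O : Set (PeriodDomain T.ratForm)), IsOpen O → σ ∈ O →
        ∃ P : Set (PeriodDomain T.ratForm), IsPreconnected P ∧ σ ∈ P ∧ ∃ τ ∈ P, τ ∈ O ∧ τ ∈ U := by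
  obtain ⟨c, hc⟩ := exists_compatiblePair_of_notMem (ι := ι) hΓ
  by_cases hdim : 3 ≤ Module.finrank ℚ T.RatSpace
  · let 𝓔 := ι.specialHyperplanes g c ∪ ι.specialEigenspaces Γ
    have hproper : ∀ E ∈ 𝓔, E ≠ ⊤ := by
      rintro E (⟨w, -, hw, -, rfl⟩ | ⟨hE, -⟩)
      · exact hyperplane_ne_top hw
      · exact hE
    have hlf : ∀ σ : PeriodDomain T.ratForm, ∃ O : Set (PeriodDomain T.ratForm), IsOpen O ∧ σ ∈ O ∧
        {E ∈ 𝓔 | (PeriodDomain.locus T.ratForm E ∩ O).Nonempty}.Finite := fun σ => by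
      obtain ⟨O₁, hO₁, hσ₁, hf₁⟩ := finite_specialHyperplanes_inter (ι := ι) hS g c σ
      obtain ⟨O₂, hO₂, hσ₂, hf₂⟩ := finite_specialEigenspaces_inter (ι := ι) hS hΓ σ
      refine ⟨O₁ ∩ O₂, hO₁.inter hO₂, ⟨hσ₁, hσ₂⟩, (hf₁.union hf₂).subset ?_⟩
      rintro E ⟨hE | hE, τ, hτ, hτ₁, hτ₂⟩
      · exact Or.inl ⟨hE, τ, hτ, hτ₁⟩
      · exact Or.inr ⟨hE, τ, hτ, hτ₂⟩
    refine ⟨{σ | ∀ E ∈ 𝓔, σ ∉ PeriodDomain.locus T.ratForm E}, ?_, ?_, ?_⟩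
    · rw [isOpen_iff_forall_mem_open]
      intro σ hσ
      obtain ⟨O, hO, hσO, hf⟩ := hlf σ
      -- Inside `O` only finitely many closed loci matter, so removing them leaves an open set.
      refine ⟨O \ ⋃ E ∈ {E ∈ 𝓔 | (PeriodDomain.locus T.ratForm E ∩ O).Nonempty},
        PeriodDomain.locus T.ratForm E, ?_, ?_, hσO, ?_⟩
      · rintro τ ⟨hτO, hτ⟩ E hE hτE
        exact hτ (Set.mem_biUnion (show E ∈ {E ∈ 𝓔 | _} from ⟨hE, τ, hτE, hτO⟩) hτE)
      · exact hO.sdiff (hf.isClosed_biUnion fun E _ => PeriodDomain.isClosed_locus E)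
      · intro h
        obtain ⟨E, hE, hσE⟩ := Set.mem_iUnion₂.1 h
        exact hσ E hE.1 hσE
    · intro σ hσ
      exact ⟨hc σ fun E hE => hσ E (Or.inl hE), fun p hp hpσ =>
        smul_eq_of_notMem_specialEigenspaces (fun E hE => hσ E (Or.inr hE)) hp hpσ⟩
    · intro σ O hO hσO
      obtain ⟨O', hO', hσO', hf⟩ := hlf σ
      obtain ⟨P, hP, hσP, τ, hτP, hτO, hτ⟩ := PeriodDomain.exists_preconnected_of_finite
        T.ratForm_symm T.ratForm_nondegenerate hdim σ hf (fun E hE => hproper E hE.1)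
        (hO.inter hO') ⟨hσO, hσO'⟩
      refine ⟨P, hP, hσP, τ, hτP, hτO.1, fun E hE hτE => ?_⟩
      exact hτ E ⟨hE, τ, hτE, hτO.2⟩ hτE
  -- The existence of `σ` forces rank two. Proper eigenspaces may now contain points of `D_T`, but
  -- an isometry fixing one point fixes every point. No special hyperplane contains a point: a
  -- rational vector orthogonal to `z` is orthogonal to `z̄` too, hence to everything.
  · refine ⟨Set.univ, isOpen_univ, fun σ _ => ?_, fun σ O _ hσ =>
      ⟨{σ}, isPreconnected_singleton, rfl, σ, rfl, hσ, trivial⟩⟩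
    obtain ⟨z, rfl⟩ := PeriodDomain.mk_surjective σ
    have hdim2 : Module.finrank ℚ T.RatSpace = 2 := by
      have h := (linearIndependent_conj T.ratForm_symm z.2).fintype_card_le_finrank
      rw [Module.finrank_baseChange, Fintype.card_fin] at h
      omega
    refine ⟨hc _ ?_, fun p _ hp => PeriodDomain.smul_eq_of_smul_eq T.ratForm_symm hdim2 hp⟩
    rintro E ⟨w, -, hw, -, rfl⟩ hz
    refine hyperplane_ne_top hw (eq_top_iff.2 fun y _ => ?_)
    rw [PeriodDomain.mk_mem_locus, mem_hyperplane] at hz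
    have hz' : T.ratForm.baseChange ℂ (conj _ z.1) (1 ⊗ₜ ι.proj w) = 0 := by
      have h := baseChange_conj T.ratForm z.1 (1 ⊗ₜ ι.proj w)
      rwa [hz, map_zero, conj_tmul, map_one] at h
    obtain ⟨s, t, rfl⟩ := exists_eq_smul_add_smul_conj T.ratForm_symm hdim2 z.2 y
    rw [mem_hyperplane, map_add, map_smul, map_smul, LinearMap.add_apply, LinearMap.smul_apply,
      LinearMap.smul_apply, hz, hz', smul_zero, smul_zero, add_zero]

end PrimitiveEmbedding

/-- An isometry of a negative definite integral lattice which is the identity modulo `3` is the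
identity. -/
lemma eq_self_of_congr_mod_three {V : Type*} [AddCommGroup V] [Module ℚ V] {B : BilinForm ℚ V}
    {A : AddSubgroup V} (hint : ∀ v ∈ A, ∃ n : ℤ, B v v = n) (hneg : ∀ v ∈ A, v ≠ 0 → B v v < 0)
    {q : orthogonalGroup B} (hq : ∀ v ∈ A, ∃ w ∈ A, q.1 v = v + (3 : ℤ) • w) {v : V}
    (hv : v ∈ A) : q.1 v = v := by
  have hneg' : ∀ v ∈ A, B v v ≤ 0 := fun v hv => by
    by_cases h : v = 0
    · simp [h]
    · exact (hneg v hv h).le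
  obtain ⟨m, hm⟩ : ∃ m : ℕ, B v v = -(m : ℚ) := by
    obtain ⟨n, hn⟩ := hint v hv
    have h0 := hneg' v hv
    rw [hn] at h0
    have h1 : n ≤ 0 := by exact_mod_cast h0
    refine ⟨n.natAbs, ?_⟩
    rw [hn, Nat.cast_natAbs, abs_of_nonpos h1]
    simp
  induction m using Nat.strong_induction_on generalizing v with
  | _ m ih =>
    by_cases hv0 : v = 0
    · rw [hv0, map_zero]
    obtain ⟨w, hw, hvw⟩ := hq v hv
    have e1 : B v v = B v v + 3 * (B v w + B w v) + 9 * B w w := by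
      have h := q.2 v v
      rw [hvw, ← Int.cast_smul_eq_zsmul ℚ] at h
      simp only [map_add, map_smul, LinearMap.add_apply, LinearMap.smul_apply, smul_eq_mul] at h
      push_cast at h
      linarith
    -- This is `(q v + v, q v + v) ≤ 0` with `q v = v + 3 w`. Combined with `e1` it gives `4 (v, v)
    -- ≤ 9 (w, w)`, so `w` is strictly shorter than `v` and the induction applies to it.
    have e2 : 4 * B v v + 6 * (B v w + B w v) + 9 * B w w ≤ 0 := by
      have h := hneg' (v + v + (3 : ℤ) • w) (add_mem (add_mem hv hv) (zsmul_mem hw 3))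
      rw [← Int.cast_smul_eq_zsmul ℚ] at h
      simp only [map_add, map_smul, LinearMap.add_apply, LinearMap.smul_apply, smul_eq_mul] at h
      push_cast at h
      linarith
    have hlt : B v v < B w w := by
      have := hneg v hv hv0
      linarith
    obtain ⟨k, hk⟩ := hint w hw
    have hk0 : k ≤ 0 := by
      have h := hneg' w hw
      rw [hk] at h
      exact_mod_cast h
    have hkm : B w w = -((k.natAbs : ℕ) : ℚ) := by
      rw [hk, Nat.cast_natAbs, abs_of_nonpos hk0]
      simp
    have hqw : q.1 w = w := by
      refine ih k.natAbs ?_ hw hkm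
      rw [hm, hkm, neg_lt_neg_iff] at hlt
      exact_mod_cast hlt
    -- As `q` fixes `w`, `q (q v) = v + 6 w`. Comparing norms with `e1` leaves only `(w, w) = 0`.
    have e3 : B v v = B v v + 6 * (B v w + B w v) + 36 * B w w := by
      have h := q.2 (q.1 v) (q.1 v)
      rw [q.2 v v, hvw, map_add, map_zsmul, hqw, hvw, add_assoc, ← Int.cast_smul_eq_zsmul ℚ] at h
      simp only [map_add, map_smul, LinearMap.add_apply, LinearMap.smul_apply, smul_eq_mul] at h
      push_cast at h
      linarith
    have hww : B w w = 0 := by linarith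
    have hw0 : w = 0 := by
      by_contra h
      exact (hneg w hw h).ne hww
    rw [hvw, hw0, smul_zero, add_zero]

lemma EvenLattice.finite_of_le_translate (L : EvenLattice.{u}) (g : L.OAdele)
    {A : Submodule ℤ L.RatSpace} (hA : ∀ w ∈ A, w ∈ L.translate g) : Module.Finite ℤ A := by
  obtain ⟨M, hM, h⟩ := L.exists_translate_le g
  have hmem : ∀ w : A, M • (w : L.RatSpace) ∈ Submodule.span ℤ (Set.range L.ratBasis) := fun w => by
    rw [Module.Basis.mem_span_iff_repr_mem]
    intro i
    obtain ⟨n, hn⟩ := h w (hA _ w.2) i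
    refine ⟨n, ?_⟩
    rw [map_zsmul, Finsupp.smul_apply, ← Int.cast_smul_eq_zsmul ℚ, smul_eq_mul, hn]
    simp
  have : Module.Finite ℤ (Submodule.span ℤ (Set.range L.ratBasis)) :=
    Module.Finite.span_of_finite ℤ (Set.finite_range _)
  refine Module.Finite.of_injective
    (LinearMap.codRestrict (Submodule.span ℤ (Set.range L.ratBasis)) (M • A.subtype) hmem)
    fun x y hxy => ?_
  have h1 : M • (x : L.RatSpace) = M • (y : L.RatSpace) := congrArg Subtype.val hxy
  rw [← Int.cast_smul_eq_zsmul ℚ, ← Int.cast_smul_eq_zsmul ℚ] at h1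
  exact Subtype.ext (smul_right_injective _ (by exact_mod_cast hM : (M : ℚ) ≠ 0) h1)

/-- A finitely generated subgroup which spans a rational vector space has the expected rank. -/
lemma finrank_int_eq_of_spanning {V : Type*} [AddCommGroup V] [Module ℚ V] {N : Submodule ℚ V}
    {A : Submodule ℤ V} [Module.Finite ℤ A] (hAN : ∀ w ∈ A, w ∈ N)
    (hNA : ∀ w ∈ N, ∃ M : ℤ, M ≠ 0 ∧ M • w ∈ A) : Module.finrank ℤ A = Module.finrank ℚ N := by
  have : Module.IsTorsionFree ℤ V := Module.IsTorsionFree.trans ℚ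
  let b := Module.finBasis ℤ A
  let v : Fin (Module.finrank ℤ A) → N := fun i => ⟨b i, hAN _ (b i).2⟩
  have hli : LinearIndependent ℚ v := by
    rw [← LinearIndependent.iff_fractionRing ℤ ℚ]
    have h1 : LinearIndependent ℤ fun i => ((b i : A) : V) :=
      b.linearIndependent.map' A.subtype A.ker_subtype
    exact LinearIndependent.of_comp (N.subtype.restrictScalars ℤ) h1
  have hsp : ⊤ ≤ Submodule.span ℚ (Set.range v) := by
    rintro ⟨w, hw⟩ -
    obtain ⟨M, hM, hMw⟩ := hNA w hw
    have hM' : (M : ℚ) ≠ 0 := by exact_mod_cast hM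
    have e : (⟨w, hw⟩ : N) = (M : ℚ)⁻¹ • ∑ i, (b.repr ⟨_, hMw⟩ i : ℚ) • v i := by
      apply Subtype.ext
      have e1 := congrArg A.subtype (b.sum_repr ⟨_, hMw⟩)
      rw [map_sum] at e1
      have e2 : ((∑ i, (b.repr ⟨_, hMw⟩ i : ℚ) • v i : N) : V) = M • w := by
        rw [Submodule.coe_sum]
        refine Eq.trans (Finset.sum_congr rfl fun i _ => ?_) e1
        exact Int.cast_smul_eq_zsmul ℚ _ _
      rw [Submodule.coe_smul, e2, ← Int.cast_smul_eq_zsmul ℚ, inv_smul_smul₀ hM']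
    rw [e]
    exact Submodule.smul_mem _ _ (sum_mem fun i _ =>
      Submodule.smul_mem _ _ (Submodule.subset_span ⟨i, rfl⟩))
  simpa using (Module.finrank_eq_card_basis (Module.Basis.mk hli hsp)).symm

/-! ### Action on the orthogonal complement modulo `3` -/

namespace PrimitiveEmbedding

variable {T : EvenLattice.{u}} {S : EvenLattice.{v}} {ι : PrimitiveEmbedding T S}

lemma finrank_complement {r : ℕ} (hr : S.rank = T.rank + r) :
    Module.finrank ℚ ι.complement = r := by
  have h := ι.proj.finrank_range_add_finrank_ker
  rw [LinearMap.range_eq_top.2 fun x => ⟨_, ι.isOrthogonalSummand.proj_incl x⟩, finrank_top,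
    Module.finrank_baseChange, Module.finrank_baseChange] at h
  change T.rank + Module.finrank ℚ ι.complement = S.rank at h
  omega

lemma apply_mem_complement {Γ : Subgroup S.ORat} {p : T.ORat × S.ORat}
    (hp : p ∈ ι.compatiblePairs Γ) {w : S.RatSpace} (hw : w ∈ ι.complement) :
    p.2.1 w ∈ ι.complement := by
  rw [mem_complement_iff]
  intro x
  have h1 := hp.2 ((p.1⁻¹).1 x)
  have e : p.1.1 ((p.1⁻¹).1 x) = x := p.1.1.apply_symm_apply x
  rw [e] at h1
  rw [← h1, p.2.2, ratForm_incl_eq_zero hw]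

/-- The action on the orthogonal complement of `T` modulo `3` of the isometries in `Γ` which
preserve `T` is faithful. -/
lemma exists_hom_GL {n r : ℕ} (hS : S.HasSignature 2 n) (hr : S.rank = T.rank + r)
    (σ : PeriodDomain T.ratForm) {g : S.OAdele} {Γ : Subgroup S.ORat}
    (hΓ : ∀ q ∈ Γ, ∀ w, w ∈ S.translate g → q.1 w ∈ S.translate g) :
    ∃ φ : ι.compatiblePairs Γ →* GL (Fin r) (ZMod 3),
      ∀ p ∈ φ.ker, ∀ w ∈ ι.complement, p.1.2.1 w = w := by
  -- This is a lattice of full rank `r` in the complement, stable under all compatible pairs.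
  let A : Submodule ℤ S.RatSpace :=
    (S.translate g).toIntSubmodule ⊓ ι.complement.restrictScalars ℤ
  have hA : ∀ {w}, w ∈ A ↔ w ∈ S.translate g ∧ w ∈ ι.complement := Iff.rfl
  have hNA : ∀ w ∈ ι.complement, ∃ M : ℤ, M ≠ 0 ∧ M • w ∈ A := fun w hw => by
    obtain ⟨M, hM, h⟩ := S.exists_zsmul_mem_translate g w
    exact ⟨M, hM, h, zsmul_mem hw M⟩
  have : Module.Finite ℤ A := S.finite_of_le_translate g fun w hw => hw.1
  have : Module.IsTorsionFree ℤ S.RatSpace := Module.IsTorsionFree.trans ℚ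
  have hrank : Module.finrank ℤ A = r := by
    rw [finrank_int_eq_of_spanning (N := ι.complement) (fun w hw => (hA.1 hw).2) hNA,
      finrank_complement hr]
  let b : Module.Basis (Fin r) ℤ A := Module.finBasisOfFinrankEq ℤ A hrank
  have hpA : ∀ p : ι.compatiblePairs Γ, ∀ w ∈ A, p.1.2.1 w ∈ A := fun p w hw =>
    ⟨hΓ _ p.2.1 _ hw.1, apply_mem_complement p.2 hw.2⟩
  let ρ : ι.compatiblePairs Γ →* Module.End ℤ A :=
    { toFun := fun p => LinearMap.restrict
        ((p.1.2.1 : S.RatSpace →ₗ[ℚ] S.RatSpace).restrictScalars ℤ) (hpA p)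
      map_one' := rfl
      map_mul' := fun _ _ => rfl }
  have hρ : ∀ p (w : A), (ρ p w : S.RatSpace) = p.1.2.1 w := fun p w => rfl
  let red : Matrix (Fin r) (Fin r) ℤ →+* Matrix (Fin r) (Fin r) (ZMod 3) :=
    (Int.castRingHom (ZMod 3)).mapMatrix
  let ψ : ι.compatiblePairs Γ →* Matrix (Fin r) (Fin r) (ZMod 3) :=
    (red.comp (LinearMap.toMatrixAlgEquiv b).toRingEquiv.toRingHom).toMonoidHom.comp ρ
  refine ⟨ψ.toHomUnits, fun p hp => ?_⟩
  have h1 : ψ p = 1 := congrArg Units.val (MonoidHom.mem_ker.1 hp)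
  have h2 : ∀ i j, ((b.repr (ρ p (b j) - b j) i : ℤ) : ZMod 3) = 0 := fun i j => by
    have h3 : ((LinearMap.toMatrixAlgEquiv b (ρ p) i j : ℤ) : ZMod 3) =
        (1 : Matrix (Fin r) (Fin r) (ZMod 3)) i j := congrFun (congrFun h1 i) j
    rw [LinearMap.toMatrixAlgEquiv_apply] at h3
    rw [map_sub, Finsupp.sub_apply, Int.cast_sub, h3, Module.Basis.repr_self,
      Finsupp.single_apply, Matrix.one_apply]
    simp [eq_comm]
  have h4 : ∀ j, ∃ w : A, ρ p (b j) = b j + (3 : ℤ) • w := fun j => by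
    choose c hc using fun i => (ZMod.intCast_zmod_eq_zero_iff_dvd _ 3).1 (h2 i j)
    refine ⟨∑ i, c i • b i, ?_⟩
    rw [← sub_eq_iff_eq_add', ← b.sum_repr (ρ p (b j) - b j), Finset.smul_sum]
    exact Finset.sum_congr rfl fun i _ => by rw [hc, smul_smul]; rfl
  have h5 : ∀ v : A, ∃ w : A, ρ p v = v + (3 : ℤ) • w := fun v => by
    choose w hw using h4
    refine ⟨∑ j, b.repr v j • w j, ?_⟩
    conv_lhs => rw [← b.sum_repr v]
    conv_rhs => rw [← b.sum_repr v]
    rw [map_sum, Finset.smul_sum, ← Finset.sum_add_distrib]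
    refine Finset.sum_congr rfl fun j _ => ?_
    rw [map_zsmul, hw, smul_add, smul_comm]
    simp
  obtain ⟨z, rfl⟩ := PeriodDomain.mk_surjective σ
  have h6 : ∀ v ∈ A, p.1.2.1 v = v := fun v hv => by
    refine eq_self_of_congr_mod_three (A := A.toAddSubgroup) (fun v hv =>
      EvenLattice.exists_int_ratForm_eq (L := S) hv.1 hv.1) (fun v hv hv0 => ?_) (fun v hv => ?_) hv
    -- The complement is orthogonal to the image of the period vector `z`, which makes it negative
    -- definite.
    · refine EvenLattice.ratForm_neg_of_orthogonal hS
        (ι.rat_isIsometricEmbedding.isPeriodVector z.2) hv0 ?_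
      rw [complexForm_incl, LinearMap.mem_ker.1 hv.2, TensorProduct.tmul_zero, map_zero]
    · obtain ⟨w, hw⟩ := h5 ⟨v, hv⟩
      exact ⟨w, w.2, congrArg Subtype.val hw⟩
  intro w hw
  obtain ⟨M, hM, hMw⟩ := hNA w hw
  have h7 := h6 _ hMw
  rw [map_zsmul, ← Int.cast_smul_eq_zsmul ℚ, ← Int.cast_smul_eq_zsmul ℚ] at h7
  exact smul_right_injective _ (by exact_mod_cast hM : (M : ℚ) ≠ 0) h7

end PrimitiveEmbedding

/-! ### Arithmetic quotients inside the double coset space -/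

namespace EvenLattice

variable {L : EvenLattice.{u}} {GQ : Subgroup L.ORat} {GA K : Subgroup L.OAdele}

/-- The point `[σ, g]` of the double coset space. -/
def cosetMk (GQ : Subgroup L.ORat) (K : Subgroup L.OAdele) (σ : PeriodDomain L.ratForm) (g : GA) :
    L.CosetSpace GQ GA K :=
  Quotient.mk (L.cosetSetoid GQ GA K) (σ, g)

lemma cosetMk_eq_iff {σ τ : PeriodDomain L.ratForm} {a b : GA} :
    cosetMk GQ K σ a = cosetMk GQ K τ b ↔
      ∃ q ∈ GQ, ∃ k ∈ K, τ = q • σ ∧ (b : L.OAdele) = L.diag q * a * k :=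
  Quotient.eq (r := L.cosetSetoid GQ GA K)

lemma isOpen_cosetSpace_iff {A : Set (L.CosetSpace GQ GA K)} :
    IsOpen A ↔ ∀ a : GA, IsOpen {σ | cosetMk GQ K σ a ∈ A} := by
  let : TopologicalSpace GA := ⊥
  have : DiscreteTopology GA := ⟨rfl⟩
  have h : IsOpen A ↔ IsOpen (Quotient.mk (L.cosetSetoid GQ GA K) ⁻¹' A) := isOpen_coinduced
  rw [h]
  refine ⟨fun hA a => hA.preimage (Continuous.prodMk_left a), fun hA => ?_⟩
  have e : Quotient.mk (L.cosetSetoid GQ GA K) ⁻¹' A =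
      ⋃ a : GA, {σ | cosetMk GQ K σ a ∈ A} ×ˢ {a} := by
    ext ⟨σ, a⟩
    simp only [Set.mem_iUnion, Set.mem_prod, Set.mem_singleton_iff, exists_eq_right']
    rfl
  rw [e]
  exact isOpen_iUnion fun a => (hA a).prod (isOpen_discrete _)

lemma continuous_cosetMk (a : GA) : Continuous fun σ => cosetMk GQ K σ a :=
  continuous_def.2 fun _ hA => isOpen_cosetSpace_iff.1 hA a

lemma continuous_cosetSpace_iff {X : Type*} [TopologicalSpace X] {f : L.CosetSpace GQ GA K → X} :
    Continuous f ↔ ∀ a : GA, Continuous fun σ => f (cosetMk GQ K σ a) :=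
  ⟨fun hf a => hf.comp (continuous_cosetMk a), fun hf => continuous_def.2 fun _ hA =>
    isOpen_cosetSpace_iff.2 fun a => hA.preimage (hf a)⟩

lemma isOpenMap_cosetMk (a : GA) : IsOpenMap fun σ => cosetMk GQ K σ a := fun U hU => by
  rw [isOpen_cosetSpace_iff]
  intro b
  have e : {σ | cosetMk GQ K σ b ∈ (fun σ => cosetMk GQ K σ a) '' U} =
      ⋃ q ∈ {q : L.ORat | q ∈ GQ ∧ ∃ k ∈ K, (b : L.OAdele) = L.diag q * a * k},
        (fun σ => q⁻¹ • σ) ⁻¹' U := by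
    ext σ
    simp only [Set.mem_image, Set.mem_iUnion, Set.mem_preimage, Set.mem_ofPred_eq, cosetMk_eq_iff]
    constructor
    · rintro ⟨τ, hτ, q, hq, k, hk, rfl, h⟩
      exact ⟨q, ⟨hq, k, hk, h⟩, by rwa [inv_smul_smul]⟩
    · rintro ⟨q, ⟨hq, k, hk, h⟩, hσ⟩
      exact ⟨_, hσ, q, hq, k, hk, by rw [smul_inv_smul], h⟩
  rw [e]
  exact isOpen_biUnion fun q _ => hU.preimage (continuous_const_smul _)

/-- Each slice `D × {b}` lies entirely in the preimage of this set or is disjoint from it. So a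
connected component meeting the set stays in it, and all its points can be written with the same
adelic element `a`. -/
lemma isClopen_range_cosetMk (a : GA) : IsClopen (Set.range fun σ => cosetMk GQ K σ a) := by
  refine ⟨⟨?_⟩, (isOpenMap_cosetMk a).isOpen_range⟩
  rw [isOpen_cosetSpace_iff]
  intro b
  by_cases h : ∃ q ∈ GQ, ∃ k ∈ K, (b : L.OAdele) = L.diag q * a * k
  · convert! isOpen_empty using 1
    refine Set.eq_empty_of_forall_notMem fun σ hσ => hσ ?_
    obtain ⟨q, hq, k, hk, h⟩ := h
    exact ⟨q⁻¹ • σ, cosetMk_eq_iff.2 ⟨q, hq, k, hk, by rw [smul_inv_smul], h⟩⟩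
  · convert! isOpen_univ using 1
    refine Set.eq_univ_of_forall fun σ => ?_
    rintro ⟨τ, hτ⟩
    obtain ⟨q, hq, k, hk, -, h'⟩ := cosetMk_eq_iff.1 hτ
    exact h ⟨q, hq, k, hk, h'⟩

/-- The arithmetic group `G(ℚ) ∩ g K g⁻¹`. -/
noncomputable def arithmeticGroup (GQ : Subgroup L.ORat) (K : Subgroup L.OAdele) (g : L.OAdele) :
    Subgroup L.ORat :=
  GQ ⊓ K.comap ((MulAut.conj g⁻¹).toMonoidHom.comp L.diag)

lemma mem_arithmeticGroup {g : L.OAdele} {q : L.ORat} :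
    q ∈ arithmeticGroup GQ K g ↔ q ∈ GQ ∧ g⁻¹ * L.diag q * g ∈ K := by
  simp [arithmeticGroup, Subgroup.mem_inf]

lemma exists_eq_diag_mul_iff {g : L.OAdele} {q : L.ORat} (hq : q ∈ GQ) :
    (∃ k ∈ K, g = L.diag q * g * k) ↔ q ∈ arithmeticGroup GQ K g := by
  rw [mem_arithmeticGroup, and_iff_right hq]
  constructor
  · rintro ⟨k, hk, h⟩
    have e : g⁻¹ * L.diag q * g = k⁻¹ := by
      rw [eq_inv_iff_mul_eq_one, mul_assoc, mul_assoc, ← mul_assoc (L.diag q), ← h,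
        inv_mul_cancel]
    rw [e]
    exact inv_mem hk
  · intro h
    exact ⟨_, inv_mem h, by group⟩

lemma cosetMk_eq_same_iff {σ τ : PeriodDomain L.ratForm} {g : GA} :
    cosetMk GQ K σ g = cosetMk GQ K τ g ↔
      ∃ γ ∈ arithmeticGroup GQ K (g : L.OAdele), τ = γ • σ := by
  rw [cosetMk_eq_iff]
  constructor
  · rintro ⟨q, hq, k, hk, h1, h2⟩
    exact ⟨q, (exists_eq_diag_mul_iff hq).1 ⟨k, hk, h2⟩, h1⟩
  · rintro ⟨γ, hγ, h⟩
    obtain ⟨k, hk, h2⟩ := (exists_eq_diag_mul_iff (mem_arithmeticGroup.1 hγ).1).2 hγ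
    exact ⟨γ, (mem_arithmeticGroup.1 hγ).1, k, hk, h, h2⟩

/-- An isometry which normalizes the arithmetic group acts continuously on the corresponding part of
the double coset space. -/
lemma exists_continuous_smul {g : GA} {h : L.ORat}
    (hh : ∀ γ ∈ arithmeticGroup GQ K (g : L.OAdele),
      h * γ * h⁻¹ ∈ arithmeticGroup GQ K (g : L.OAdele)) :
    ∃ Φ : L.CosetSpace GQ GA K → L.CosetSpace GQ GA K, Continuous Φ ∧
      ∀ σ, Φ (cosetMk GQ K σ g) = cosetMk GQ K (h • σ) g := by
  classical
  rcases isEmpty_or_nonempty (PeriodDomain L.ratForm) with hD | ⟨⟨σ₀⟩⟩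
  · exact ⟨id, continuous_id, fun σ => hD.elim σ⟩
  let Q : GA → L.ORat → Prop := fun a q =>
    q ∈ GQ ∧ ∃ k ∈ K, (a : L.OAdele) = L.diag q * g * k
  let f : PeriodDomain L.ratForm × GA → L.CosetSpace GQ GA K := fun x =>
    if hx : ∃ q, Q x.2 q then cosetMk GQ K (h • hx.choose⁻¹ • x.1) g else cosetMk GQ K σ₀ g
  have hf : ∀ σ a q, Q a q → f (σ, a) = cosetMk GQ K (h • q⁻¹ • σ) g := fun σ a q hq => by
    have hx : ∃ q, Q (σ, a).2 q := ⟨q, hq⟩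
    have e : f (σ, a) = cosetMk GQ K (h • hx.choose⁻¹ • σ) g := dif_pos hx
    rw [e, cosetMk_eq_same_iff]
    obtain ⟨hq', k', hk', h'⟩ := hx.choose_spec
    set q' := hx.choose
    obtain ⟨hq, k, hk, hqk⟩ := hq
    have hγ : q⁻¹ * q' ∈ arithmeticGroup GQ K (g : L.OAdele) := by
      refine (exists_eq_diag_mul_iff (mul_mem (inv_mem hq) hq')).1 ⟨_, mul_mem hk' (inv_mem hk), ?_⟩
      have h1 : L.diag q * g * k = L.diag q' * g * k' := hqk.symm.trans h'
      calc (g : L.OAdele) = (L.diag q)⁻¹ * (L.diag q * g * k) * k⁻¹ := by group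
        _ = L.diag (q⁻¹ * q') * g * (k' * k⁻¹) := by
          rw [h1, map_mul, map_inv]
          group
    refine ⟨_, hh _ hγ, ?_⟩
    simp [smul_smul, mul_assoc]
  have hf0 : ∀ σ a, (¬ ∃ q, Q a q) → f (σ, a) = cosetMk GQ K σ₀ g := fun σ a ha => dif_neg ha
  refine ⟨Quotient.lift f ?_, continuous_cosetSpace_iff.2 fun a => ?_, fun σ => ?_⟩
  · rintro ⟨σ, a⟩ ⟨τ, b⟩ ⟨q, hq, k, hk, h1, h2⟩
    simp only at h1 h2
    subst h1
    by_cases ha : ∃ q, Q a q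
    · obtain ⟨q', hq', k', hk', h'⟩ := ha
      rw [hf σ a q' ⟨hq', k', hk', h'⟩, hf (q • σ) b (q * q') ⟨mul_mem hq hq', k' * k,
        mul_mem hk' hk, by rw [h2, h', map_mul]; group⟩]
      simp [smul_smul, mul_assoc]
    · have hb : ¬ ∃ q, Q b q := by
        rintro ⟨q', hq', k', hk', h'⟩
        refine ha ⟨q⁻¹ * q', mul_mem (inv_mem hq) hq', k' * k⁻¹, mul_mem hk' (inv_mem hk), ?_⟩
        calc (a : L.OAdele) = (L.diag q)⁻¹ * (L.diag q * a * k) * k⁻¹ := by group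
          _ = L.diag (q⁻¹ * q') * g * (k' * k⁻¹) := by
            rw [← h2, h', map_mul, map_inv]
            group
      rw [hf0 σ a ha, hf0 (q • σ) b hb]
  · change Continuous fun σ => f (σ, a)
    by_cases ha : ∃ q, Q a q
    · obtain ⟨q, hq⟩ := ha
      have e : (fun σ => f (σ, a)) = fun σ => cosetMk GQ K (h • q⁻¹ • σ) g :=
        funext fun σ => hf σ a q hq
      rw [e]
      exact (continuous_cosetMk g).comp ((continuous_const_smul h).comp (continuous_const_smul q⁻¹))
    · have e : (fun σ => f (σ, a)) = fun _ => cosetMk GQ K σ₀ g := funext fun σ => hf0 σ a ha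
      rw [e]
      exact continuous_const
  · exact (hf σ g 1 ⟨one_mem _, 1, one_mem _, by simp⟩).trans (by simp)

end EvenLattice

/-- The number of values of a function on a group whose fibres are the cosets of a subgroup. -/
lemma encard_range_eq_index {G X : Type*} [Group G] (H : Subgroup G) (hH : H.index ≠ 0) {f : G → X}
    (hf : ∀ a b, f a = f b ↔ a⁻¹ * b ∈ H) : (Set.range f).encard = H.index := by
  let F : G ⧸ H → X := Quotient.lift f fun a b h => (hf a b).2 (QuotientGroup.leftRel_apply.1 h)
  have hF : Function.Injective F := by
    intro x y
    induction x using QuotientGroup.induction_on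
    induction y using QuotientGroup.induction_on
    intro h
    exact QuotientGroup.eq.2 ((hf _ _).1 h)
  have e : Set.range f = Set.range F := by
    ext x
    constructor
    · rintro ⟨a, rfl⟩
      exact ⟨a, rfl⟩
    · rintro ⟨y, rfl⟩
      induction y using QuotientGroup.induction_on with
      | H a => exact ⟨a, rfl⟩
  have : Finite (G ⧸ H) := Nat.finite_of_card_ne_zero hH
  rw [e, ← Set.image_univ, hF.encard_image, Set.encard_univ, ENat.card_eq_coe_natCard]
  rfl

open EvenLattice

/-! ### Fibres and degrees -/

namespace PrimitiveEmbedding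

variable {T : EvenLattice.{u}} {S : EvenLattice.{v}} {ι : PrimitiveEmbedding T S}

/-- An isometry which extends `h` and is the identity on the orthogonal complement is the canonical
extension of `h`. -/
lemma eq_extendRat {p : T.ORat × S.ORat} (hp : ∀ x, p.2.1 (ι.rat x) = ι.rat (p.1.1 x))
    (hN : ∀ w ∈ ι.complement, p.2.1 w = w) : p.2 = ι.extendRat p.1 := by
  refine Subtype.ext (LinearEquiv.ext fun w => ?_)
  rw [IsOrthogonalSummand.extend_apply, ← hp, ← hN _ (sub_proj_mem_complement w), ← map_add]
  congr 1
  abel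

lemma extendRat_apply_of_mem_complement (h : T.ORat) {w : S.RatSpace} (hw : w ∈ ι.complement) :
    (ι.extendRat h).1 w = w := by
  rw [IsOrthogonalSummand.extend_apply, LinearMap.mem_ker.1 hw]
  simp

/-- Both sides agree on `T_ℚ` and are the identity on its complement. Consequently the first
components of compatible pairs normalize the arithmetic group of `T`. -/
lemma conj_extendRat {Γ : Subgroup S.ORat} {p : T.ORat × S.ORat}
    (hp : p ∈ ι.compatiblePairs Γ) (h : T.ORat) :
    p.2 * ι.extendRat h * p.2⁻¹ = ι.extendRat (p.1 * h * p.1⁻¹) := by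
  have hp' := inv_mem hp
  refine eq_extendRat (p := (p.1 * h * p.1⁻¹, p.2 * ι.extendRat h * p.2⁻¹)) (fun x => ?_)
    fun w hw => ?_
  · change p.2.1 ((ι.extendRat h).1 ((p⁻¹).2.1 (ι.rat x))) = _
    rw [hp'.2, IsOrthogonalSummand.extend_incl, hp.2]
    rfl
  · change p.2.1 ((ι.extendRat h).1 ((p⁻¹).2.1 w)) = _
    rw [extendRat_apply_of_mem_complement h (apply_mem_complement hp' hw)]
    exact p.2.1.apply_symm_apply w

lemma period_smul_of_mem_compatiblePairs {Γ : Subgroup S.ORat} {p : T.ORat × S.ORat}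
    (hp : p ∈ ι.compatiblePairs Γ) (σ : PeriodDomain T.ratForm) :
    ι.period (p.1 • σ) = p.2 • ι.period σ := by
  have e : (p.2.1 : S.RatSpace →ₗ[ℚ] S.RatSpace) ∘ₗ ι.rat =
      ι.rat ∘ₗ (p.1.1 : T.RatSpace →ₗ[ℚ] T.RatSpace) := LinearMap.ext hp.2
  have hk : IsIsometricEmbedding T.ratForm S.ratForm
      (ι.rat ∘ₗ (p.1.1 : T.RatSpace →ₗ[ℚ] T.RatSpace)) :=
    ⟨ι.rat_isIsometricEmbedding.injective.comp p.1.1.injective, fun x y =>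
      (ι.rat_isometry _ _).trans (p.1.2 x y)⟩
  rw [PeriodDomain.smul_def, PeriodDomain.smul_def, period,
    PeriodDomain.map_map (isIsometricEmbedding_coe p.1) ι.rat_isIsometricEmbedding hk rfl,
    PeriodDomain.map_map ι.rat_isIsometricEmbedding (isIsometricEmbedding_coe p.2) hk e]

section Fibres

variable {GQ : Subgroup T.ORat} {GA K : Subgroup T.OAdele} {GQ' : Subgroup S.ORat}
  {GA' K' : Subgroup S.OAdele}

lemma extendRat_mem_arithmeticGroup_iff (hQ : ∀ q, ι.extendRat q ∈ GQ' ↔ q ∈ GQ)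
    (hK : ∀ k, ι.extendAdele k ∈ K' ↔ k ∈ K) {g : T.OAdele} {q : T.ORat} :
    ι.extendRat q ∈ arithmeticGroup GQ' K' (ι.extendAdele g) ↔ q ∈ arithmeticGroup GQ K g := by
  have e : (ι.extendAdele g)⁻¹ * S.diag (ι.extendRat q) * ι.extendAdele g =
      ι.extendAdele (g⁻¹ * T.diag q * g) := by
    rw [EvenLattice.diag, IsOrthogonalSummand.extend_baseChange, map_mul, map_mul, map_inv]
  rw [mem_arithmeticGroup, mem_arithmeticGroup, hQ, e, hK]

lemma mem_compatiblePairs_extendRat {Γ : Subgroup S.ORat} {h : T.ORat} (hh : ι.extendRat h ∈ Γ) :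
    (h, ι.extendRat h) ∈ ι.compatiblePairs Γ :=
  ⟨hh, fun x => IsOrthogonalSummand.extend_incl _ h x⟩

/-- The degree of the map of double coset spaces on a connected component is finite, and divides the
order of `GL_r(𝔽_3)`. -/
theorem exists_hasDegreeOntoImage_cosetMap (ι : PrimitiveEmbedding T S) {n r : ℕ} (hS : S.HasSignature 2 n)
    (hr : S.rank = T.rank + r) (hQ : ∀ q, ι.extendRat q ∈ GQ' ↔ q ∈ GQ)
    (hA : ∀ g ∈ GA, ι.extendAdele g ∈ GA') (hK : ∀ k, ι.extendAdele k ∈ K' ↔ k ∈ K)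
    (hK' : K' ≤ S.OZHat) (x : T.CosetSpace GQ GA K) :
    ∃ d : ℕ, HasDegreeOntoImage ((connectedComponent x).domRestrict
      (ι.cosetMap (fun q hq => (hQ q).2 hq) hA fun k hk => (hK k).2 hk)) d ∧
        d ∣ Nat.card (GL (Fin r) (ZMod 3)) := by
  obtain ⟨⟨σ₀, g⟩, rfl⟩ := Quotient.exists_rep x
  set f := ι.cosetMap (fun q hq => (hQ q).2 hq) hA fun k hk => (hK k).2 hk
  let π : PeriodDomain T.ratForm → T.CosetSpace GQ GA K := fun σ => cosetMk GQ K σ g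
  change ∃ d : ℕ, HasDegreeOntoImage ((connectedComponent (π σ₀)).domRestrict f) d ∧ _
  let g' : GA' := ⟨ι.extendAdele g, hA g g.2⟩
  let Γ := arithmeticGroup GQ' K' (g' : S.OAdele)
  let ΓT := arithmeticGroup GQ K (g : T.OAdele)
  have hΓ : ∀ q ∈ Γ, ∀ w, w ∈ S.translate g' → q.1 w ∈ S.translate g' := fun q hq w hw =>
    (S.map_mem_translate (hK' (mem_arithmeticGroup.1 hq).2)).2 hw
  have hΓT : ∀ {q}, ι.extendRat q ∈ Γ ↔ q ∈ ΓT := extendRat_mem_arithmeticGroup_iff hQ hK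
  have hconj : ∀ p ∈ ι.compatiblePairs Γ, ∀ γ ∈ ΓT, p.1 * γ * p.1⁻¹ ∈ ΓT := fun p hp γ hγ => by
    rw [← hΓT, ← conj_extendRat hp]
    exact mul_mem (mul_mem hp.1 (hΓT.2 hγ)) (inv_mem hp.1)
  have hπ : ∀ {σ τ}, π σ = π τ ↔ ∃ γ ∈ ΓT, τ = γ • σ := cosetMk_eq_same_iff
  -- Since `p.1` normalizes `ΓT`, it descends to a continuous map, which sends components into
  -- components.
  have hcomp : ∀ p ∈ ι.compatiblePairs Γ, ∀ {σ τ}, π τ ∈ connectedComponent (π σ) →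
      π (p.1 • τ) ∈ connectedComponent (π (p.1 • σ)) := fun p hp σ τ h => by
    obtain ⟨Φ, hΦ, hΦπ⟩ := exists_continuous_smul (g := g) (hconj p hp)
    have h1 := hΦ.mapsTo_connectedComponent _ h
    rwa [hΦπ, hΦπ] at h1
  have hfπ : ∀ {σ τ}, f (π τ) = f (π σ) ↔ ∃ q ∈ Γ, ι.period τ = q • ι.period σ := fun {σ τ} => by
    rw [eq_comm]
    exact cosetMk_eq_same_iff (g := g')
  obtain ⟨φ, hφ⟩ := exists_hom_GL (ι := ι) hS hr σ₀ hΓ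
  obtain ⟨U, hU, hgen, hdense⟩ := exists_isOpen_isGeneric (ι := ι) hS hΓ
  -- Only the action on `D_T` is compared with `ΓT`, because an isometry such as `-1` acts trivially
  -- there without having to lie in `ΓT`.
  let Δ₁ : Subgroup (ι.compatiblePairs Γ) :=
    { carrier := {p | ∃ γ ∈ ΓT, ∀ τ : PeriodDomain T.ratForm, p.1.1 • τ = γ • τ}
      one_mem' := ⟨1, one_mem _, fun _ => rfl⟩
      mul_mem' := by
        rintro a b ⟨γ, hγ, h⟩ ⟨γ', hγ', h'⟩
        exact ⟨γ * γ', mul_mem hγ hγ', fun τ => by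
          rw [mul_smul, ← h', ← h, ← mul_smul]
          rfl⟩
      inv_mem' := by
        rintro a ⟨γ, hγ, h⟩
        refine ⟨γ⁻¹, inv_mem hγ, fun τ => ?_⟩
        change (a.1.1)⁻¹ • τ = _
        rw [inv_smul_eq_iff, h, smul_inv_smul] }
  -- The pairs preserving the component. The condition is tested at `σ₀`, but by `hcomp` it is the
  -- same at every point over the component.
  let ΔC : Subgroup (ι.compatiblePairs Γ) :=
    { carrier := {p | π (p.1.1 • σ₀) ∈ connectedComponent (π σ₀)}
      one_mem' := by
        change π ((1 : T.ORat) • σ₀) ∈ connectedComponent (π σ₀)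
        rw [one_smul]
        exact mem_connectedComponent
      mul_mem' := by
        rintro a b ha hb
        have h := hcomp a.1 a.2 hb
        rw [← connectedComponent_eq ha, ← mul_smul] at h
        exact h
      inv_mem' := by
        rintro a ha
        have h := hcomp _ (inv_mem a.2) ha
        change π ((a.1.1)⁻¹ • a.1.1 • σ₀) ∈ connectedComponent (π ((a.1.1)⁻¹ • σ₀)) at h
        rw [inv_smul_smul] at h
        change π ((a.1.1)⁻¹ • σ₀) ∈ connectedComponent (π σ₀)
        rw [← connectedComponent_eq h]
        exact mem_connectedComponent }
  have hker : φ.ker ≤ Δ₁ := fun p hp => by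
    have h := eq_extendRat p.2.2 (hφ p hp)
    exact ⟨p.1.1, hΓT.1 (h ▸ p.2.1), fun _ => rfl⟩
  -- The index of `Δ₁` in `ΔC` divides that of the normal subgroup `φ.ker` in `ΔC`, which divides
  -- the index of `φ.ker`, the order of the image of `φ`.
  have hdvd : (Δ₁.subgroupOf ΔC).index ∣ Nat.card (GL (Fin r) (ZMod 3)) :=
    ((Subgroup.relIndex_dvd_of_le_left ΔC hker).trans
      (Subgroup.relIndex_dvd_index_of_normal φ.ker ΔC)).trans
        (Subgroup.index_ker φ ▸ Subgroup.card_subgroup_dvd_card φ.range)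
  have hindex : (Δ₁.subgroupOf ΔC).index ≠ 0 := fun h => by
    rw [h, zero_dvd_iff] at hdvd
    exact Nat.card_pos.ne' hdvd
  refine ⟨_, ⟨Subtype.val ⁻¹' (π '' U), ?_, ?_, ?_⟩, hdvd⟩
  · exact (isOpenMap_cosetMk g U hU).preimage continuous_subtype_val
  · rw [dense_iff_inter_open]
    rintro _ ⟨O, hO, rfl⟩ ⟨⟨y, hy⟩, hyO⟩
    obtain ⟨σ, rfl⟩ := (isClopen_range_cosetMk g).connectedComponent_subset ⟨σ₀, rfl⟩ hy
    -- Density of `U` in `D_T` alone would not place `π τ` in the component of `π σ`; the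
    -- preconnected set `P` does.
    obtain ⟨P, hP, hσP, τ, hτP, hτO, hτU⟩ := hdense σ (π ⁻¹' O)
      (hO.preimage (continuous_cosetMk g)) hyO
    have hτ : π τ ∈ connectedComponent (π σ₀) := by
      have h1 := (hP.image π (continuous_cosetMk g).continuousOn).subset_connectedComponent
        (Set.mem_image_of_mem π hσP) (Set.mem_image_of_mem π hτP)
      rwa [← connectedComponent_eq hy] at h1
    exact ⟨⟨π τ, hτ⟩, hτO, τ, hτU, rfl⟩
  · rintro ⟨_, hy⟩ ⟨σ, hσ, rfl⟩
    have hmemC : ∀ p : ι.compatiblePairs Γ,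
        π (p.1.1 • σ) ∈ connectedComponent (π σ₀) ↔ p ∈ ΔC := fun p => by
      have h1 := hcomp p.1 p.2 hy
      have e := connectedComponent_eq h1
      constructor
      · intro h
        change π (p.1.1 • σ₀) ∈ connectedComponent (π σ₀)
        rw [connectedComponent_eq h, ← e]
        exact mem_connectedComponent
      · intro h
        rw [connectedComponent_eq h]
        exact h1
    -- The first clause of genericity turns each `q` that identifies two points into a compatible
    -- pair, so the fibre is an orbit of `ΔC`.
    have e : Subtype.val '' ((connectedComponent (π σ₀)).domRestrict f ⁻¹'
        {(connectedComponent (π σ₀)).domRestrict f ⟨π σ, hy⟩}) =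
        Set.range fun p : ΔC => π (p.1.1.1 • σ) := by
      ext y
      constructor
      · rintro ⟨⟨y, hyC⟩, hyf, rfl⟩
        obtain ⟨τ, rfl⟩ := (isClopen_range_cosetMk g).connectedComponent_subset ⟨σ₀, rfl⟩ hyC
        obtain ⟨q, hq, hτ⟩ := hfπ.1 (show f (π τ) = f (π σ) from hyf)
        obtain ⟨h, hh⟩ := (hgen σ hσ).1 q hq τ hτ
        have hτh : τ = h • σ := by
          refine PeriodDomain.map_injective ι.rat_isIsometricEmbedding (hτ.trans ?_)
          exact (period_smul_of_mem_compatiblePairs hh σ).symm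
        subst hτh
        exact ⟨⟨⟨(h, q), hh⟩, (hmemC _).1 hyC⟩, rfl⟩
      · rintro ⟨p, rfl⟩
        refine ⟨⟨_, (hmemC p.1).2 p.2⟩, ?_, rfl⟩
        exact hfπ.2 ⟨p.1.1.2, p.1.2.1, period_smul_of_mem_compatiblePairs p.1.2 σ⟩
    rw [← Subtype.val_injective.encard_image, e]
    refine encard_range_eq_index _ hindex fun a b => ?_
    rw [hπ, Subgroup.mem_subgroupOf]
    constructor
    · rintro ⟨γ, hγ, h⟩
      have hγ' : (a.1.1.1)⁻¹ * γ * a.1.1.1 ∈ ΓT := by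
        simpa using hconj _ (inv_mem a.1.2) γ hγ
      refine ⟨_, hγ', fun τ => ?_⟩
      -- The pairs `a⁻¹ b` and `γ' = a⁻¹ γ a` agree at `σ`. By the second clause of genericity their
      -- quotient, fixing `σ`, acts trivially on `D_T`, so `a⁻¹ b` lies in `Δ₁`.
      have h1 := (hgen σ hσ).2 ((a.1⁻¹ * b.1)⁻¹.1 * (_, _))
        (mul_mem (a.1⁻¹ * b.1)⁻¹.2 (mem_compatiblePairs_extendRat (hΓT.2 hγ'))) ?_ τ
      · change ((a.1.1.1⁻¹ * b.1.1.1)⁻¹ * (a.1.1.1⁻¹ * γ * a.1.1.1)) • τ = τ at h1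
        rw [mul_smul, inv_smul_eq_iff] at h1
        exact h1.symm
      · change ((a.1.1.1⁻¹ * b.1.1.1)⁻¹ * (a.1.1.1⁻¹ * γ * a.1.1.1)) • σ = σ
        rw [mul_smul, inv_smul_eq_iff, mul_smul, mul_smul, ← h, mul_smul]
    · rintro ⟨γ, hγ, h⟩
      refine ⟨_, hconj _ a.1.2 γ hγ, ?_⟩
      have h1 := h σ
      change (a.1.1.1⁻¹ * b.1.1.1) • σ = γ • σ at h1
      rw [mul_smul, inv_smul_eq_iff] at h1
      rw [h1, mul_smul, mul_smul, inv_smul_smul]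

end Fibres

end PrimitiveEmbedding

end OrthogonalModuli

theorem mainTheorem3 :
    ∃ b : ℕ → ℕ, ∀ (T : OrthogonalModuli.EvenLattice.{u}) (S : OrthogonalModuli.EvenLattice.{v})
      (m n : ℕ), T.HasSignature 2 m → S.HasSignature 2 n →
      ∀ (ι : OrthogonalModuli.PrimitiveEmbedding T S) (r : ℕ), S.rank = T.rank + r →
        (∀ x : T.M, ∃ d : ℕ,
          OrthogonalModuli.HasDegreeOntoImage ((connectedComponent x).domRestrict ι.mapM) d ∧
            d ≤ b r ∧ (r = 1 → d ∣ 4)) ∧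
        (∀ x : T.Sh, ∃ d : ℕ,
          OrthogonalModuli.HasDegreeOntoImage ((connectedComponent x).domRestrict ι.mapSh) d ∧
            d ≤ b r ∧ (r = 1 → d ∣ 4)) := by
  refine ⟨fun r => Nat.card (GL (Fin r) (ZMod 3)), fun T S m n _ hS ι r hr => ?_⟩
  have hbound : ∀ d, d ∣ Nat.card (GL (Fin r) (ZMod 3)) →
      d ≤ Nat.card (GL (Fin r) (ZMod 3)) ∧ (r = 1 → d ∣ 4) := fun d hd => by
    refine ⟨Nat.le_of_dvd Nat.card_pos hd, ?_⟩
    rintro rfl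
    -- For `r = 1` the group is `𝔽_3ˣ`, of order `2`.
    rw [Matrix.card_GL_field] at hd
    exact (by simpa using hd : d ∣ 2).trans ⟨2, rfl⟩
  refine ⟨fun x => ?_, fun x => ?_⟩
  · obtain ⟨d, h, hd⟩ := ι.exists_hasDegreeOntoImage_cosetMap (GQ := ⊤) (GA := ⊤)
      (K := T.OZHatStar) (GQ' := ⊤) (GA' := ⊤) (K' := S.OZHatStar) hS hr (fun _ => Iff.rfl)
      (fun _ _ => Subgroup.mem_top _) (fun _ => ι.extendAdele_mem_OZHatStar_iff)
      (fun _ hk => hk.1) x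
    exact ⟨d, h, hbound d hd⟩
  · obtain ⟨d, h, hd⟩ := ι.exists_hasDegreeOntoImage_cosetMap (GQ := T.SORat) (GA := T.SOAdele)
      (K := T.SOZHatStar) (GQ' := S.SORat) (GA' := S.SOAdele) (K' := S.SOZHatStar) hS hr
      (fun _ => OrthogonalModuli.IsOrthogonalSummand.extend_mem_special_iff _)
      (fun _ hg => ι.extendAdele_mem_SOAdele hg)
      (fun _ => and_congr (OrthogonalModuli.IsOrthogonalSummand.extend_mem_special_iff _)
        ι.extendAdele_mem_OZHatStar_iff) (fun _ hk => hk.2.1) x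
    exact ⟨d, h, hbound d hd⟩
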